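/- **Setting.** Let $\varphi:\mathbb R\to[0,\infty]$ be lower semicontinuous with $\varphi(1)=0$, $\varphi=\infty$ on $(-\infty,0)$, finite and differentiable on $(0,\infty)$ and strongly convex with modulus $\kappa>0$; let $\eta>0$, $K=\lim_{s\to0+}\varphi'(s)\in[-\infty,\infty)$. Let $\hat{\mathbb P}$ be a probability measure on a finite-dimensional normed space, $\rho>0$, and $\nu_z$ the uniform distribution on the closed ball $\mathbb B_\rho(z)$. The loss $f_\theta(z')$ is measurable in $z'$ and, for every $z'\in\bigcup_{z\in\mathrm{supp}\,\hat{\mathbb P}}\mathbb B_\rho(z)$, $L_f$-Lipschitz in $\theta$ (Euclidean norm) on an open set containing $\Theta\subseteq\mathbb R^p$; $\nabla f_\theta(z')$ denotes its gradient in $\theta$ or, where it is not differentiable, a (regular) subgradient, chosen measurably in $z'$. Put $$F(\theta)=\mathbb E_{z\sim\hat{\mathbb P}}[R(\theta;z)],\qquad R(\theta;z)=\sup_{\gamma\ll\nu_z}\Big\{\mathbb E_\gamma[f_\theta]-\eta\,\mathbb E_{\nu_z}\big[\varphi(\tfrac{d\gamma}{d\nu_z})\big]\Big\}.$$ **Algorithm.**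 For data $v_1,\dots,v_m$ consider $\max_{\gamma\in\Delta^m}\{\sum_i\gamma_iv_i-\frac\eta m\sum_i\varphi(m\gamma_i)\}$, whose dual objective is $D(v;\mu)=\mu+\frac1m\sum_i(\eta\varphi)^*(v_i-\mu)$. The bisection algorithm with precision $\epsilon>0$ starts from the interval $[\underline\mu,\overline\mu]$, $\underline\mu=\min v$, $\overline\mu=\max v+\eta(\max v-\min v)$ if $K=-\infty$ and $\overline\mu=\max v-\eta K$ otherwise, and performs $\max\{1,\lceil\frac12\log_2\frac{\varrho^2}{2\kappa\eta\epsilon}\rceil\}$ steps with $\varrho=\overline\mu-\underline\mu$ (one step if $\varrho=0$). A step takes the midpoint $\mu$, computes $h(\mu)=\frac1m\sum_{v_i>\mu+\eta K}(\varphi')^{-1}(\frac{v_i-\mu}\eta)-1$, and sets $\overline\mu=\mu$ if $h(\mu)\le0$ and $\underline\mu=\mu$ otherwise. It returns the last midpoint $\tilde\mu(v)$ and the weights $\tilde\gamma_i=\frac1m(\varphi')^{-1}(\frac{v_i-\tilde\mu}\eta)$ if $v_i>\tilde\mu+\eta K$, $\tilde\gamma_i=0$ otherwise. **Estimators.** Let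 $\zeta^\ell=(z,z'_1,\dots,z'_{2^\ell})$ with $z\sim\hat{\mathbb P}$ and, given $z$, $z'_i$ i.i.d. from $\nu_z$. For a block $I$ of samples, with $\tilde\gamma$ computed from the data $(f_\theta(z'_i))_{i\in I}$, put $\nabla\widetilde R_I=\sum_{i\in I}\tilde\gamma_i\nabla f_\theta(z'_i)$. Let $g^\ell=\nabla\widetilde R_{[1:2^\ell]}$, $G^0=g^0$, and $G^\ell=\nabla\widetilde R_{[1:2^\ell]}-\frac12(\nabla\widetilde R_{[1:2^{\ell-1}]}+\nabla\widetilde R_{[2^{\ell-1}+1:2^\ell]})$ for $\ell\ge1$. For $n\ge1$, $L\ge0$, $$V^{\rm SG}(\theta)=\frac1n\sum_{i=1}^ng^L(\theta,\zeta^L_i),\qquad V^{\rm RT\text{-}MLMC}(\theta)=\frac1n\sum_{i=1}^n\frac{G^{\hat L_i}(\theta,\zeta_i^{\hat L_i})}{\mathbb P(\hat L=\hat L_i)},\qquad\mathbb P(\hat L=\ell)=\frac{2^{-\ell}}{2-2^{-L}},\ 0\le\ell\le L,$$ with $n$ independent copies. The cost of an estimator is the number of samples generated plus the number of times the bisection algorithm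 queries a data point (one query of each of the $m$ data points per step, for the initial interval, and for the output weights). **Proposition.** Suppose that for some $C\ge1$, for all $\theta\in\Theta$, $z\in\mathrm{supp}\,\hat{\mathbb P}$, $m$ and $z'_1,\dots,z'_m\in\mathbb B_\rho(z)$, each optimal $\gamma^*$ for the data $f_\theta(z'_i)$ satisfies $\chi^2(\gamma^*,\frac1m\mathbf 1)=m\sum_i(\gamma^*_i-\frac1m)^2\le C$. Then for all $\epsilon>0$, $L\ge0$, $n\ge1$ and $\theta\in\Theta$, the estimators are square integrable and: 1. (Bias) $\mathbb E[V^{\rm SG}(\theta)]=\mathbb E[V^{\rm RT\text{-}MLMC}(\theta)]$. Suppose moreover that for all $\theta\in\Theta$, $z\in\mathrm{supp}\,\hat{\mathbb P}$ the inverse cdf of $(f_\theta)_\#\nu_z$ is $G_{\rm idf}$-Lipschitz on $(0,1)$, and that $f_\theta(z')$ is integrable for $z\sim\hat{\mathbb P}$, $z'\sim\nu_z$. Then $R(\theta;\cdot)$ is $\hat{\mathbb P}$-integrable and the common mean is $\nabla\widetilde F(\theta)$, where $\widetilde F(\theta)=\Phi(\theta;\theta)$, $$\Phi(\theta;\vartheta)=\mathbb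 E_{\zeta^L}\big[D\big((f_\theta(z'_i))_i;\,\tilde\mu((f_\vartheta(z'_i))_i)\big)\big],$$ $\nabla\widetilde F(\theta)=\nabla_\theta\Phi(\theta;\vartheta)|_{\vartheta=\theta}$ is the gradient with the computed multipliers held fixed (a true gradient if $f$ is differentiable in $\theta$ at that point for every $z'\in\bigcup_{z\in\mathrm{supp}\,\hat{\mathbb P}}\mathbb B_\rho(z)$, and a regular subgradient in general), and $|\widetilde F(\theta)-F(\theta)|\le\epsilon+G_{\rm idf}2^{-L}$. 2. (Second-order moment) $\mathbb E\|V^{\rm SG}(\theta)\|_2^2\le2L_f^2\big[1+\frac{2\epsilon}{\kappa\eta}\big]$ and $\mathbb E\|V^{\rm RT\text{-}MLMC}(\theta)\|_2^2\le\frac{96L_f^2}{\kappa\eta}2^L\epsilon+6(L+1)L_f^2C$. 3. (Variance) $\mathbb V\mathrm{ar}[V]=\mathbb E\|V-\mathbb EV\|_2^2$ is, for each of the two estimators, at most $\frac1n$ times the corresponding bound in 2. 4. (Cost) If for every $z\in\mathrm{supp}\,\hat{\mathbb P}$ the values of $f_\theta$ lie $\nu_z$-almost surely in an interval of length $B$,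 and $\epsilon\le\frac12$, then the SG estimator costs almost surely at most $A\,n2^L\log\frac1\epsilon$ and, if $L\ge1$, the RT-MLMC estimator has expected cost at most $A\,nL\log\frac1\epsilon$, where $A$ depends only on $\varphi,\kappa,\eta,B$. -/

import Mathlib

open MeasureTheory ProbabilityTheory Set Filter Topology
open scoped ENNReal

noncomputable section

namespace PhiDRO

/-! ### Divergence functions and penalized DRO problems -/

/-- The real value of an extended-valued function (used only where it is finite). -/
def finPart (φ : ℝ → ℝ≥0∞) (s : ℝ) : ℝ := (φ s).toReal

/-- The divergence functions of the setting: `φ : ℝ → [0, ∞]` is lower semicontinuous, `φ 1 = 0`,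
`φ = ∞` on the negative half-line, `φ` is finite and differentiable on `(0, ∞)`, and `φ` is
strongly convex with modulus `κ` (on its domain, hence as an extended-valued function). -/
structure IsDivergence (φ : ℝ → ℝ≥0∞) (κ : ℝ) : Prop where
  lsc : LowerSemicontinuous φ
  one : φ 1 = 0
  neg : ∀ x : ℝ, x < 0 → φ x = ⊤
  finite : ∀ x : ℝ, 0 < x → φ x ≠ ⊤
  diff : DifferentiableOn ℝ (finPart φ) (Ioi 0)
  strong : StrongConvexOn {x : ℝ | φ x ≠ ⊤} κ (finPart φ)

/-- The convex conjugate `(ηφ)^*(t) = sup_s (t s - η φ(s))`. -/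
def conj (φ : ℝ → ℝ≥0∞) (η t : ℝ) : ℝ :=
  sSup {y : ℝ | ∃ s : ℝ, φ s ≠ ⊤ ∧ y = t * s - η * finPart φ s}

/-- A probability vector `γ` with finite penalty `∑ φ(m γ_i)`. -/
def Feasible (φ : ℝ → ℝ≥0∞) {m : ℕ} (γ : Fin m → ℝ) : Prop :=
  γ ∈ stdSimplex ℝ (Fin m) ∧ ∀ i, φ (m * γ i) ≠ ⊤

/-- The objective `∑ γ_i v_i - (η/m) ∑ φ(m γ_i)`, for data points `v_1, …, v_m`. -/
def discObj (φ : ℝ → ℝ≥0∞) (η : ℝ) {m : ℕ} (v γ : Fin m → ℝ) : ℝ :=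
  ∑ i, γ i * v i - η / m * ∑ i, finPart φ (m * γ i)

/-- `γ` is an optimal probability vector for the data points `v`. -/
def IsOptimalWeight (φ : ℝ → ℝ≥0∞) (η : ℝ) {m : ℕ} (v γ : Fin m → ℝ) : Prop :=
  Feasible φ γ ∧ ∀ γ', Feasible φ γ' → discObj φ η v γ' ≤ discObj φ η v γ

/-- The `χ²`-divergence of a vector `γ` from the uniform vector `(1/m, …, 1/m)`. -/
def chiSq {m : ℕ} (γ : Fin m → ℝ) : ℝ := ∑ i, (γ i - 1 / m) ^ 2 / (1 / m)

/-- The penalized `φ`-divergence DRO value with reference measure `ν`: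
`sup_γ { E_γ[h] - η E_ν[φ(dγ/dν)] }` over the probability measures `γ ≪ ν`. -/
def robustValue {E : Type*} [MeasurableSpace E] (φ : ℝ → ℝ≥0∞) (η : ℝ) (ν : Measure E)
    (h : E → ℝ) : ℝ :=
  sSup {r : ℝ | ∃ γ : Measure E, IsProbabilityMeasure γ ∧ γ ≪ ν ∧ Integrable h γ ∧
    ∫⁻ x, φ (γ.rnDeriv ν x).toReal ∂ν ≠ ⊤ ∧
    r = ∫ x, h x ∂γ - η * (∫⁻ x, φ (γ.rnDeriv ν x).toReal ∂ν).toReal}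

/-! ### The bisection algorithm -/

/-- The parameters of the penalty: the divergence function `φ`, the regularization level `η`, the
modulus `κ` of strong convexity, and `K = lim_{s → 0+} φ'(s) ∈ [-∞, ∞)`. -/
structure Penalty where
  phi : ℝ → ℝ≥0∞
  eta : ℝ
  kappa : ℝ
  K : EReal

/-- The standing assumptions on the parameters. -/
structure Penalty.Valid (S : Penalty) : Prop where
  eta_pos : 0 < S.eta
  kappa_pos : 0 < S.kappa
  isDivergence : IsDivergence S.phi S.kappa
  tendsto_K : Tendsto (fun s : ℝ => ((deriv (finPart S.phi) s : ℝ) : EReal)) (𝓝[>] 0) (𝓝 S.K)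

namespace Penalty

variable (S : Penalty)

/-- The inverse `(φ')⁻¹` of the derivative `φ'` on `(0, ∞)`. -/
def invDeriv (y : ℝ) : ℝ := Function.invFunOn (deriv (finPart S.phi)) (Ioi 0) y

/-- `i ∈ 𝒩`, that is, `v_i ≤ μ + η K`. -/
def Inactive {m : ℕ} (v : Fin m → ℝ) (μ : ℝ) (i : Fin m) : Prop :=
  (v i : EReal) ≤ (μ : EReal) + (S.eta : EReal) * S.K

open Classical in
/-- The weights `γ_i = 0` for `i ∈ 𝒩` and `γ_i = (1/m) (φ')⁻¹((v_i - μ)/η)` otherwise. -/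
def weight {m : ℕ} (v : Fin m → ℝ) (μ : ℝ) (i : Fin m) : ℝ :=
  if S.Inactive v μ i then 0 else 1 / m * S.invDeriv ((v i - μ) / S.eta)

open Classical in
/-- `h(μ) = (1/m) ∑_{i ∉ 𝒩} (φ')⁻¹((v_i - μ)/η) - 1`. -/
def excess {m : ℕ} (v : Fin m → ℝ) (μ : ℝ) : ℝ :=
  1 / m * ∑ i with ¬ S.Inactive v μ i, S.invDeriv ((v i - μ) / S.eta) - 1

/-- Left end of the initial interval. -/
def lower {m : ℕ} (v : Fin m → ℝ) : ℝ := ⨅ i, v i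

open Classical in
/-- Right end of the initial interval. -/
def upper {m : ℕ} (v : Fin m → ℝ) : ℝ :=
  if S.K = ⊥ then (⨆ i, v i) - S.eta * ((⨅ i, v i) - ⨆ i, v i)
  else (⨆ i, v i) - S.eta * S.K.toReal

/-- The number of bisection steps: `(1/2) log₂(ϱ² / (2κη) · 1/ε)`, with `ϱ` the length of the
initial interval, rounded up to an integer, and at least one step. -/
def iterations (ε : ℝ) {m : ℕ} (v : Fin m → ℝ) : ℕ :=
  max 1 ⌈1 / 2 * Real.logb 2
    ((S.upper v - lower v) ^ 2 / (2 * S.kappa * S.eta) * (1 / ε))⌉₊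

end Penalty

/-- State of the bisection search: current interval, current multiplier, and the number of times
that a data point has been queried. -/
structure BisectState where
  lo : ℝ
  hi : ℝ
  mu : ℝ
  queries : ℕ

namespace Penalty

variable (S : Penalty)

/-- Initial state; computing the minimum and the maximum of the data queries every point once. -/
def initState {m : ℕ} (v : Fin m → ℝ) : BisectState :=
  { lo := lower v, hi := S.upper v, mu := (lower v + S.upper v) / 2, queries := m }

open Classical in
/-- One bisection step; it queries every data point once. -/
def step {m : ℕ} (v : Fin m → ℝ) (s : BisectState) : BisectState :=
  let μ := (s.lo + s.hi) / 2
  if S.excess v μ ≤ 0 then { lo := s.lo, hi := μ, mu := μ, queries := s.queries + m }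
  else { lo := μ, hi := s.hi, mu := μ, queries := s.queries + m }

/-- Final state of the bisection search with precision `ε`. -/
def run (ε : ℝ) {m : ℕ} (v : Fin m → ℝ) : BisectState :=
  (S.step v)^[S.iterations ε v] (S.initState v)

/-- The multiplier `μ` returned by the algorithm. -/
def outMu (ε : ℝ) {m : ℕ} (v : Fin m → ℝ) : ℝ := (S.run ε v).mu

/-- The vector of weights `γ` returned by the algorithm. -/
def outWeight (ε : ℝ) {m : ℕ} (v : Fin m → ℝ) : Fin m → ℝ := S.weight v (S.outMu ε v)

/-- The number of queries of data points by the whole algorithm (the output weights need one more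
pass through the data). -/
def solveCost (ε : ℝ) {m : ℕ} (v : Fin m → ℝ) : ℕ := (S.run ε v).queries + m

/-- The dual objective `μ + (1/m) ∑ (ηφ)^*(v_i - μ)`, whose minimum over `μ` is the value of the
penalized problem with data `v`. -/
def dualValue {m : ℕ} (v : Fin m → ℝ) (μ : ℝ) : ℝ :=
  μ + 1 / m * ∑ i, conj S.phi S.eta (v i - μ)

end Penalty

/-! ### Sampling -/

section Sampling

variable {E : Type*} [NormedAddCommGroup E] [MeasureSpace E]

/-- `ν_z`, the uniform distribution on the ball of radius `ρ` about `z`. -/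
def unifBall (ρ : ℝ) (z : E) : Measure E := ProbabilityTheory.cond volume (Metric.closedBall z ρ)

variable [BorelSpace E] [(volume : Measure E).IsAddHaarMeasure]

instance (ρ : ℝ) (z : E) : IsFiniteMeasure (unifBall ρ z) := by
  unfold unifBall; infer_instance

theorem unifBall_eq_map (ρ : ℝ) (z : E) :
    unifBall ρ z = (unifBall ρ (0 : E)).map (fun b => z + b) := by
  have hpre : (fun b : E => z + b) ⁻¹' Metric.closedBall z ρ = Metric.closedBall 0 ρ := by
    ext b; simp
  have hemb : MeasurableEmbedding (fun b : E => z + b) := measurableEmbedding_addLeft z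
  have hvol : (volume : Measure E).map (fun b => z + b) = volume :=
    map_add_left_eq_self volume z
  have hball : (volume : Measure E) (Metric.closedBall z ρ) =
      volume (Metric.closedBall (0 : E) ρ) := by
    rw [← hpre, measure_preimage_add]
  unfold unifBall ProbabilityTheory.cond
  rw [Measure.map_smul, hball]
  congr 1
  conv_lhs => rw [← hvol]
  rw [hemb.restrict_map, hpre]

variable [NormedSpace ℝ E] [FiniteDimensional ℝ E]

/-- Given `z`, the law of `m` i.i.d. samples from `ν_z`. -/
def sampleKernel (E : Type*) [NormedAddCommGroup E] [MeasureSpace E] [NormedSpace ℝ E]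
    [FiniteDimensional ℝ E] [BorelSpace E] [(volume : Measure E).IsAddHaarMeasure]
    (ρ : ℝ) (m : ℕ) : Kernel E (Fin m → E) where
  toFun z := Measure.pi fun _ => unifBall ρ z
  measurable' := by
    have h : ∀ z : E, (Measure.pi fun _ : Fin m => unifBall ρ z) =
        (Measure.pi fun _ : Fin m => unifBall ρ (0 : E)).map (fun b i => z + b i) := by
      intro z
      have : ∀ _ : Fin m, SigmaFinite ((unifBall ρ (0 : E)).map (fun b => z + b)) := by
        intro _; rw [← unifBall_eq_map]; infer_instance
      rw [Measure.pi_map_pi (fun _ => (measurable_const_add z).aemeasurable)]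
      simp_rw [← unifBall_eq_map]
    rw [funext h]
    refine Measure.measurable_of_measurable_coe _ fun s hs => ?_
    have hm : Measurable (fun p : E × (Fin m → E) => fun i => p.1 + p.2 i) := by fun_prop
    have h2 : ∀ z : E, ((Measure.pi fun _ : Fin m => unifBall ρ (0 : E)).map
        (fun b i => z + b i)) s = (Measure.pi fun _ : Fin m => unifBall ρ (0 : E))
          (Prod.mk z ⁻¹' ((fun p : E × (Fin m → E) => fun i => p.1 + p.2 i) ⁻¹' s)) := by
      intro z
      rw [Measure.map_apply (by fun_prop) hs]
      rfl
    simp_rw [h2]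
    exact measurable_measure_prodMk_left (hm hs)

/-- The law of `ζ^ℓ = (z, z'_1, …, z'_{2^ℓ})`: first `z ∼ P`, then `2^ℓ` i.i.d. samples from
`ν_z`. -/
def sampleLaw (P : Measure E) (ρ : ℝ) (l : ℕ) : Measure (E × (Fin (2 ^ l) → E)) :=
  P ⊗ₘ sampleKernel E ρ (2 ^ l)

/-- The law of `n` independent copies of `ζ^L`. -/
def sgLaw (P : Measure E) (ρ : ℝ) (L n : ℕ) : Measure (Fin n → E × (Fin (2 ^ L) → E)) :=
  Measure.pi fun _ => sampleLaw P ρ L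

/-- The truncated geometric distribution on `{0, …, L}`. -/
def levelProb (L l : ℕ) : ℝ := (2 : ℝ)⁻¹ ^ l / (2 - (2 : ℝ)⁻¹ ^ L)

/-- The law of a random level `l ∈ {0, …, L}` together with a sample `ζ^l` of that level. -/
def levelLaw (P : Measure E) (ρ : ℝ) (L : ℕ) :
    Measure ((l : Fin (L + 1)) × (E × (Fin (2 ^ (l : ℕ)) → E))) :=
  ∑ l : Fin (L + 1), ENNReal.ofReal (levelProb L l) •
    (sampleLaw P ρ l).map (fun ζ => ⟨l, ζ⟩)

/-- The law of `n` independent copies of a random level with its sample. -/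
def mlmcLaw (P : Measure E) (ρ : ℝ) (L n : ℕ) :
    Measure (Fin n → (l : Fin (L + 1)) × (E × (Fin (2 ^ (l : ℕ)) → E))) :=
  Measure.pi fun _ => levelLaw P ρ L

/-- The objective `F(θ) = E_{z ∼ P}[R(θ; z)]`, for the loss `h = f_θ`. -/
def objective (S : Penalty) (P : Measure E) (ρ : ℝ) (h : E → ℝ) : ℝ :=
  ∫ z, robustValue S.phi S.eta (unifBall ρ z) h ∂P

end Sampling

/-- First half of a list of `2^(k+1)` samples. -/
def firstHalf {E : Type*} {k : ℕ} (w : Fin (2 ^ (k + 1)) → E) : Fin (2 ^ k) → E :=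
  fun i => w ⟨i, by have := i.2; rw [pow_succ]; omega⟩

/-- Second half of a list of `2^(k+1)` samples. -/
def secondHalf {E : Type*} {k : ℕ} (w : Fin (2 ^ (k + 1)) → E) : Fin (2 ^ k) → E :=
  fun i => w ⟨2 ^ k + i, by have := i.2; rw [pow_succ]; omega⟩

/-! ### The gradient estimators -/

section Estimators

/- At a fixed decision, `h` is the loss `z' ↦ f_θ(z')` and `g` is the gradient
`z' ↦ ∇_θ f_θ(z')`. -/
variable {E : Type*} {p : ℕ} (S : Penalty) (ε : ℝ) (h : E → ℝ)
  (g : E → EuclideanSpace ℝ (Fin p))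

/-- `∑ γ̃_i ∇f_θ(z'_i)`, where `γ̃` is returned by the bisection algorithm. -/
def gradEst {m : ℕ} (w : Fin m → E) : EuclideanSpace ℝ (Fin p) :=
  ∑ i, S.outWeight ε (fun j => h (w j)) i • g (w i)

/-- The multilevel difference; at level `0` there is nothing to subtract. -/
def levelDiff : (l : ℕ) → (Fin (2 ^ l) → E) → EuclideanSpace ℝ (Fin p)
  | 0, w => gradEst S ε h g w
  | _ + 1, w => gradEst S ε h g w -
      (1 / 2 : ℝ) • (gradEst S ε h g (firstHalf w) + gradEst S ε h g (secondHalf w))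

/-- The SG estimator. -/
def sgEst {L n : ℕ} (ω : Fin n → E × (Fin (2 ^ L) → E)) : EuclideanSpace ℝ (Fin p) :=
  (1 / n : ℝ) • ∑ i, gradEst S ε h g (ω i).2

/-- The RT-MLMC estimator. -/
def mlmcEst {L n : ℕ} (ω : Fin n → (l : Fin (L + 1)) × (E × (Fin (2 ^ (l : ℕ)) → E))) :
    EuclideanSpace ℝ (Fin p) :=
  (1 / n : ℝ) • ∑ i, (levelProb L (ω i).1)⁻¹ • levelDiff S ε h g (ω i).1 (ω i).2.2

/-- Cost of one SG estimator: samples generated plus queries made by the bisection algorithm. -/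
def sgCost {L n : ℕ} (ω : Fin n → E × (Fin (2 ^ L) → E)) : ℕ :=
  ∑ i, (1 + 2 ^ L + S.solveCost ε (fun j => h ((ω i).2 j)))

/-- Queries made by the bisection algorithm in one multilevel difference. -/
def levelSolveCost : (l : ℕ) → (Fin (2 ^ l) → E) → ℕ
  | 0, w => S.solveCost ε (fun j => h (w j))
  | _ + 1, w => S.solveCost ε (fun j => h (w j)) +
      (S.solveCost ε (fun j => h (firstHalf w j)) + S.solveCost ε (fun j => h (secondHalf w j)))

/-- Cost of one RT-MLMC estimator. -/
def mlmcCost {L n : ℕ} (ω : Fin n → (l : Fin (L + 1)) × (E × (Fin (2 ^ (l : ℕ)) → E))) : ℕ :=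
  ∑ i, (1 + 2 ^ ((ω i).1 : ℕ) + levelSolveCost S ε h (ω i).1 (ω i).2.2)

end Estimators

/-- The surrogate objective `Φ(θ; ϑ)`: the expected dual objective at `θ`, evaluated at the
multipliers that the algorithm computes from the data at `ϑ`. The surrogate `F̃` is
`F̃(θ) = Φ(θ; θ)`, the expected optimal value estimated by the algorithm, and its gradient is taken
with the computed multipliers held fixed, `∇F̃(θ) = ∇_θ Φ(θ; ϑ)|_{ϑ = θ}`. -/
def surrogate {E : Type*} [NormedAddCommGroup E] [MeasureSpace E] [NormedSpace ℝ E]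
    [FiniteDimensional ℝ E] [BorelSpace E] [(volume : Measure E).IsAddHaarMeasure] {p : ℕ}
    (S : Penalty) (ε : ℝ) (P : Measure E) (ρ : ℝ) (L : ℕ)
    (f : EuclideanSpace ℝ (Fin p) → E → ℝ) (ϑ θ : EuclideanSpace ℝ (Fin p)) : ℝ :=
  ∫ ζ, S.dualValue (fun j => f θ (ζ.2 j)) (S.outMu ε (fun j => f ϑ (ζ.2 j))) ∂(sampleLaw P ρ L)

/-! ### Assumptions -/

/-- `v` is a (regular) subgradient of `u` at `x`: `u(y) ≥ u(x) + ⟨v, y - x⟩ + o(‖y - x‖)`. For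
convex `u` these are the usual subgradients, for `u` differentiable at `x` only the gradient. -/
def IsSubgradAt {p : ℕ} (u : EuclideanSpace ℝ (Fin p) → ℝ) (v x : EuclideanSpace ℝ (Fin p)) :
    Prop :=
  ∀ c : ℝ, 0 < c → ∀ᶠ y in 𝓝 x, u x + inner ℝ v (y - x) - c * ‖y - x‖ ≤ u y

/-- The inverse cdf (quantile function) of a distribution on the line. -/
def quantile (μ : Measure ℝ) (u : ℝ) : ℝ := sInf {t : ℝ | u ≤ μ.real (Iic t)}

/-- The inverse cdf is `G`-Lipschitz on `(0, 1)`. -/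
def LipschitzQuantile (μ : Measure ℝ) (G : ℝ) : Prop :=
  ∀ u ∈ Ioo (0 : ℝ) 1, ∀ v ∈ Ioo (0 : ℝ) 1, |quantile μ u - quantile μ v| ≤ G * |u - v|

/-- The points `z' ∈ 𝔹_ρ(z)`, `z ∈ supp P`, at which losses may be evaluated. -/
def attackSet {E : Type*} [NormedAddCommGroup E] [MeasurableSpace E] (P : Measure E) (ρ : ℝ) :
    Set E :=
  {z' | ∃ z ∈ P.support, z' ∈ Metric.closedBall z ρ}

/-- The total variance `E‖V - E V‖²` of a random vector. -/
def vecVar {Ω : Type*} [MeasurableSpace Ω] {p : ℕ} (V : Ω → EuclideanSpace ℝ (Fin p))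
    (μ : Measure Ω) : ℝ :=
  ∫ ω, ‖V ω - ∫ ω', V ω' ∂μ‖ ^ 2 ∂μ

end PhiDRO

end

open PhiDRO

/-! Strong convexity of φ drives the whole proof. The function s ↦ ts - ηφ(s) has a unique maximizer
`S.argmax t` and falls off at least like κη/2 times the squared distance from it (`argmax_spec`).
Hence the conjugate is differentiable with derivative `argmax`, which is nondecreasing and
1/(κη)-Lipschitz. The weights are `argmax (v i - μ)` divided by m, the function h is minus the
derivative of the dual objective D, and D is convex and 1/(κη)-smooth. Bisection keeps an exact
multiplier `muStar` inside its interval and ends with squared error at most 2κηε. By smoothness D is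
then within ε of its minimum, and the computed weights are within δ = √(2ε/(κη)) (`weightErr`) of
the optimal ones in ℓ¹.

Moments: a gradient estimate has norm at most Lf(1 + δ). In a multilevel difference, the exact
weights of the full sample and half the exact weights of a half-sample differ only through the
multiplier. By monotonicity these differences all have the same sign on that half, so their ℓ¹ norm
is |A|, with A the sum of γ*ᵢ - 1/m over the half (`sum_abs_optWeight_sub`). The centred weights are
exchangeable and sum to zero, so the diagonal of their second-moment matrix determines the rest, and
E A² ≤ C/(4(m - 1)) (`integral_sq_sum_half_le`). At level l this has order 2^{-l}, which compensates
the division by the level probability: every level contributes a bounded amount besides a solver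
error proportional to 2^l ε. The expectations telescope because either half of a sample has the law
of the preceding level.

Bias: with the multiplier frozen, the gradient estimate is a (sub)gradient of the dual objective in
θ, and dominated convergence moves this through the expectation. For the distance to the true
objective, strong duality (`robustValue_eq`) writes R as a population dual value. A minimum has
smaller expectation than the population minimum, so the sample value is too low on average. To see
that it is too low by at most G/m, write the loss as Q(u), with u uniform and Q the inverse cdf,
take an independent second sample y, and linearize the conjugate at y along the sorted matching of y
with the data x. The loss is the mean over k of r(y₍ₖ₎)(Q(y₍ₖ₎) - Q(x₍ₖ₎)), where r = `argmax (Q -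
μ)` is the optimal density. Symmetrization and monotonicity of r and Q replace Q by G times the
identity, and bounds on ranks and on mean order statistics show that the remaining sum is at most ∫
r = 1 in expectation.

Cost: a solve on m points uses a number of queries of order m log(1/ε), and the expected number of
samples at the random level is at most L + 1. -/

namespace PhiDRO

noncomputable section

/-! ### Convex analysis of the penalty -/

namespace IsDivergence

variable {φ : ℝ → ℝ≥0∞} {κ : ℝ}

theorem nonneg_of_ne_top (hφ : IsDivergence φ κ) {y : ℝ} (hy : φ y ≠ ⊤) : 0 ≤ y := by
  by_contra h
  exact hy (hφ.neg y (not_le.1 h))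

theorem finPart_one (hφ : IsDivergence φ κ) : finPart φ 1 = 0 := by
  simp [finPart, hφ.one]

theorem finPart_nonneg (φ : ℝ → ℝ≥0∞) (y : ℝ) : 0 ≤ finPart φ y := ENNReal.toReal_nonneg

/-- The gradient inequality for strongly convex functions. -/
theorem gradient_ineq (hφ : IsDivergence φ κ) {x y : ℝ} (hx : 0 < x) (hy : φ y ≠ ⊤) :
    finPart φ x + deriv (finPart φ) x * (y - x) + κ / 2 * (y - x) ^ 2 ≤ finPart φ y := by
  have hc := strongConvexOn_iff_convex.1 hφ.strong
  have hxd : x ∈ {x : ℝ | φ x ≠ ⊤} := hφ.finite x hx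
  have hd : HasDerivAt (finPart φ) (deriv (finPart φ) x) x :=
    ((hφ.diff x hx).differentiableAt (Ioi_mem_nhds hx)).hasDerivAt
  -- Subtracting κ/2 · x² leaves a convex function; its tangent line bound, rearranged, is the
  -- claim.
  have hd2 : HasDerivAt (fun x : ℝ => finPart φ x - κ / 2 * ‖x‖ ^ 2)
      (deriv (finPart φ) x - κ / 2 * (2 * x)) x := by
    have h2 : HasDerivAt (fun x : ℝ => κ / 2 * ‖x‖ ^ 2) (κ / 2 * (2 * x)) x := by
      simp only [Real.norm_eq_abs, sq_abs]
      simpa using (hasDerivAt_pow 2 x).const_mul (κ / 2)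
    exact hd.sub h2
  rcases lt_trichotomy x y with h | h | h
  · have := hc.le_slope_of_hasDerivAt hxd hy h hd2
    rw [slope_def_field, le_div_iff₀ (by linarith)] at this
    simp only [Real.norm_eq_abs, sq_abs] at this
    nlinarith
  · subst h; simp
  · have := hc.slope_le_of_hasDerivAt hy hxd h hd2
    rw [slope_def_field, div_le_iff₀ (by linarith)] at this
    simp only [Real.norm_eq_abs, sq_abs] at this
    nlinarith

theorem deriv_strong_mono (hφ : IsDivergence φ κ) {x y : ℝ} (hx : 0 < x) (hy : 0 < y) :
    κ * (y - x) ^ 2 ≤ (deriv (finPart φ) y - deriv (finPart φ) x) * (y - x) := by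
  have h1 := hφ.gradient_ineq hx (hφ.finite y hy)
  have h2 := hφ.gradient_ineq hy (hφ.finite x hx)
  nlinarith

end IsDivergence

/-! ### The conjugate function, its maximizer and its smoothness. -/

namespace Penalty

variable {S : Penalty}

/-- Derivatives have the intermediate value property, so no continuity of φ' is needed: it suffices
that φ' takes a value below y near 0 and a value above y somewhere. -/
theorem Valid.exists_deriv_eq (hS : S.Valid) {y : ℝ} (hy : S.K < y) :
    ∃ x ∈ Ioi (0 : ℝ), deriv (finPart S.phi) x = y := by
  have hev := hS.tendsto_K.eventually (gt_mem_nhds hy)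
  obtain ⟨x₁, hx₁, hx₁0⟩ := (hev.and self_mem_nhdsWithin).exists
  have hx₁' : deriv (finPart S.phi) x₁ < y := by exact_mod_cast hx₁
  have hx₁0' : (0 : ℝ) < x₁ := hx₁0
  -- Since φ' increases at rate at least κ, this step length is enough to reach the level y.
  set x₂ : ℝ := x₁ + (y - deriv (finPart S.phi) x₁) / S.kappa with hx₂
  have hk := hS.kappa_pos
  have hpos : 0 < (y - deriv (finPart S.phi) x₁) / S.kappa := div_pos (by linarith) hk
  have hx₂0 : 0 < x₂ := by linarith
  have hm := hS.isDivergence.deriv_strong_mono hx₁0' hx₂0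
  have h21 : x₂ - x₁ = (y - deriv (finPart S.phi) x₁) / S.kappa := by rw [hx₂]; ring
  have hle : y ≤ deriv (finPart S.phi) x₂ := by
    have : S.kappa * (x₂ - x₁) ≤ deriv (finPart S.phi) x₂ - deriv (finPart S.phi) x₁ := by
      have h0 : 0 < x₂ - x₁ := by rw [h21]; exact hpos
      nlinarith
    rw [h21, mul_div_cancel₀ _ hk.ne'] at this
    linarith
  have hord := (convex_Ioi (0 : ℝ)).image_deriv (f := finPart S.phi)
    (fun x hx => (hS.isDivergence.diff x hx).differentiableAt (Ioi_mem_nhds hx))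
  exact hord.ordConnected.out ⟨x₁, hx₁0, rfl⟩ ⟨x₂, hx₂0, rfl⟩ ⟨hx₁'.le, hle⟩

theorem Valid.invDeriv_pos (hS : S.Valid) {y : ℝ} (hy : S.K < y) : 0 < S.invDeriv y :=
  Function.invFunOn_mem (hS.exists_deriv_eq hy)

theorem Valid.deriv_invDeriv (hS : S.Valid) {y : ℝ} (hy : S.K < y) :
    deriv (finPart S.phi) (S.invDeriv y) = y :=
  Function.invFunOn_eq (hS.exists_deriv_eq hy)

theorem Valid.K_lt_top (hS : S.Valid) : S.K < ⊤ := by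
  have hev : ∀ᶠ s : ℝ in 𝓝[>] 0, ((deriv (finPart S.phi) s : ℝ) : EReal) ≤
      ((deriv (finPart S.phi) 1 : ℝ) : EReal) := by
    have : Ioo (0 : ℝ) 1 ∈ 𝓝[>] (0 : ℝ) := Ioo_mem_nhdsGT one_pos
    filter_upwards [this] with s hs
    have h := hS.isDivergence.deriv_strong_mono hs.1 one_pos
    have hk := hS.kappa_pos
    have h1 : 0 < 1 - s := by linarith [hs.2]
    have : 0 ≤ deriv (finPart S.phi) 1 - deriv (finPart S.phi) s := by
      by_contra hcon
      have h2 : (deriv (finPart S.phi) 1 - deriv (finPart S.phi) s) * (1 - s) < 0 :=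
        mul_neg_of_neg_of_pos (by linarith) h1
      nlinarith [mul_nonneg hk.le (sq_nonneg (1 - s))]
    exact_mod_cast (by linarith : deriv (finPart S.phi) s ≤ deriv (finPart S.phi) 1)
  exact (le_of_tendsto hS.tendsto_K hev).trans_lt (EReal.coe_lt_top _)

theorem Valid.tendsto_deriv (hS : S.Valid) {k : ℝ} (hk : S.K = k) :
    Tendsto (deriv (finPart S.phi)) (𝓝[>] 0) (𝓝 k) := by
  have := hS.tendsto_K
  rw [hk] at this
  exact EReal.tendsto_coe.1 this

/-- The gradient inequality at x, tested at 1 where φ vanishes, gives φ(x) ≤ -φ'(x)(1 - x). This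
stays bounded as x decreases to 0 when K is finite, and lower semicontinuity carries the bound to
φ(0). -/
theorem Valid.phi_zero_ne_top (hS : S.Valid) {k : ℝ} (hk : S.K = k) : S.phi 0 ≠ ⊤ := by
  intro htop
  have hlim : Tendsto (fun x : ℝ => -(deriv (finPart S.phi) x * (1 - x))) (𝓝[>] 0)
      (𝓝 (-(k * (1 - 0)))) := by
    refine ((hS.tendsto_deriv hk).mul (tendsto_const_nhds.sub ?_)).neg
    exact tendsto_nhdsWithin_of_tendsto_nhds tendsto_id
  have hb : ∀ᶠ x : ℝ in 𝓝[>] 0, -(deriv (finPart S.phi) x * (1 - x)) < -(k * (1 - 0)) + 1 :=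
    hlim.eventually (gt_mem_nhds (by linarith))
  have hl : ∀ᶠ x : ℝ in 𝓝[>] 0, ENNReal.ofReal (-(k * (1 - 0)) + 1) < S.phi x := by
    refine Filter.Eventually.filter_mono nhdsWithin_le_nhds
      (hS.isDivergence.lsc 0 _ ?_)
    change _ < S.phi 0
    rw [htop]; exact ENNReal.ofReal_lt_top
  obtain ⟨x, ⟨h1, h2⟩, hx⟩ := ((hb.and hl).and self_mem_nhdsWithin).exists
  have hx0 : (0 : ℝ) < x := hx
  have hg := hS.isDivergence.gradient_ineq hx0 (hS.isDivergence.finite 1 one_pos)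
  rw [hS.isDivergence.finPart_one] at hg
  have h3 := ENNReal.lt_ofReal_iff_toReal_lt (hS.isDivergence.finite x hx0)
    (b := -(k * (1 - 0)) + 1)
  have h4 : S.phi x < ENNReal.ofReal (-(k * (1 - 0)) + 1) := by
    rw [h3]
    have : finPart S.phi x < -(k * (1 - 0)) + 1 := by
      nlinarith [mul_nonneg hS.kappa_pos.le (sq_nonneg (1 - x))]
    exact this
  exact lt_asymm h2 h4

/-- This is the limit of the gradient inequality as x decreases to 0, with K in the role of φ'(0).
Lower semicontinuity supplies the one half of continuity that is needed, φ(x) > φ(0) - e near 0. -/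
theorem Valid.gradient_ineq_zero (hS : S.Valid) {k : ℝ} (hk : S.K = k) {y : ℝ}
    (hy : S.phi y ≠ ⊤) :
    finPart S.phi 0 + k * y + S.kappa / 2 * y ^ 2 ≤ finPart S.phi y := by
  refine le_of_forall_pos_sub_le fun e he => ?_
  have hlim : Tendsto (fun x : ℝ => (finPart S.phi 0 - e) + deriv (finPart S.phi) x * (y - x) +
      S.kappa / 2 * (y - x) ^ 2) (𝓝[>] 0)
      (𝓝 ((finPart S.phi 0 - e) + k * (y - 0) + S.kappa / 2 * (y - 0) ^ 2)) := by
    have hid : Tendsto (fun x : ℝ => x) (𝓝[>] 0) (𝓝 0) :=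
      tendsto_nhdsWithin_of_tendsto_nhds tendsto_id
    have hsub := (tendsto_const_nhds (x := y)).sub hid
    exact (tendsto_const_nhds.add ((hS.tendsto_deriv hk).mul hsub)).add
      (tendsto_const_nhds.mul (hsub.pow 2))
  have hl : ∀ᶠ x : ℝ in 𝓝[>] 0, finPart S.phi 0 - e < finPart S.phi x := by
    -- A negative threshold is passed trivially since φ ≥ 0; it is split off because
    -- `ENNReal.ofReal` would truncate it to 0.
    rcases lt_or_ge (finPart S.phi 0 - e) 0 with h | h
    · exact Eventually.of_forall fun x => h.trans_le (IsDivergence.finPart_nonneg _ _)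
    · have hlt : ENNReal.ofReal (finPart S.phi 0 - e) < S.phi 0 := by
        rw [ENNReal.ofReal_lt_iff_lt_toReal h (hS.phi_zero_ne_top hk)]
        change _ < finPart S.phi 0
        linarith
      have h1 := Filter.Eventually.filter_mono (nhdsWithin_le_nhds (s := Ioi 0))
        (hS.isDivergence.lsc 0 _ hlt)
      filter_upwards [h1, self_mem_nhdsWithin] with x hx hx0
      exact (ENNReal.ofReal_lt_iff_lt_toReal h (hS.isDivergence.finite x hx0)).1 hx
  have hle : ∀ᶠ x : ℝ in 𝓝[>] 0, (finPart S.phi 0 - e) + deriv (finPart S.phi) x * (y - x) +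
      S.kappa / 2 * (y - x) ^ 2 ≤ finPart S.phi y := by
    filter_upwards [hl, self_mem_nhdsWithin] with x hx hx0
    linarith [hS.isDivergence.gradient_ineq hx0 hy]
  have := le_of_tendsto hlim hle
  simp only [sub_zero] at this
  linarith

variable (S) in
open Classical in
/-- The maximizer of `s ↦ t s - η φ(s)`. -/
def argmax (t : ℝ) : ℝ :=
  if (t : EReal) ≤ (S.eta : EReal) * S.K then 0 else S.invDeriv (t / S.eta)

theorem Valid.argmax_of_K_lt (hS : S.Valid) {t : ℝ} (h : ¬ (t : EReal) ≤ (S.eta : EReal) * S.K) :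
    S.K < ((t / S.eta : ℝ) : EReal) := by
  have hη := hS.eta_pos
  induction hK : S.K with
  | bot => exact EReal.bot_lt_coe _
  | top => exact absurd hK hS.K_lt_top.ne
  | coe k =>
    rw [hK] at h
    have h' : S.eta * k < t := by
      by_contra hcon
      exact h (by exact_mod_cast not_lt.1 hcon)
    have : k < t / S.eta := by rw [lt_div_iff₀ hη]; linarith
    exact_mod_cast this

/-- The maximizer `argmax t` is feasible, and the objective decays quadratically around it. -/
theorem Valid.argmax_spec (hS : S.Valid) (t : ℝ) :
    S.phi (S.argmax t) ≠ ⊤ ∧ ∀ y, S.phi y ≠ ⊤ →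
      t * y - S.eta * finPart S.phi y ≤ t * S.argmax t - S.eta * finPart S.phi (S.argmax t) -
        S.kappa * S.eta / 2 * (y - S.argmax t) ^ 2 := by
  have hη := hS.eta_pos
  by_cases h : (t : EReal) ≤ (S.eta : EReal) * S.K
  · have ha : S.argmax t = 0 := if_pos h
    -- K = -∞ is excluded in this case, since no real t lies below ηK = -∞.
    obtain ⟨k, hK⟩ : ∃ k : ℝ, S.K = k := by
      induction hK : S.K with
      | bot =>
        rw [hK, EReal.coe_mul_bot_of_pos hη] at h
        exact absurd h (not_le.2 (EReal.bot_lt_coe _))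
      | top => exact absurd hK hS.K_lt_top.ne
      | coe k => exact ⟨k, rfl⟩
    rw [ha]
    refine ⟨hS.phi_zero_ne_top hK, fun y hy => ?_⟩
    have hg := hS.gradient_ineq_zero hK hy
    have hy0 := hS.isDivergence.nonneg_of_ne_top hy
    rw [hK] at h
    have ht : t ≤ S.eta * k := by exact_mod_cast h
    nlinarith [mul_le_mul_of_nonneg_left hg hη.le, mul_le_mul_of_nonneg_right ht hy0]
  · have ha : S.argmax t = S.invDeriv (t / S.eta) := if_neg h
    have hK := hS.argmax_of_K_lt h
    have hpos := hS.invDeriv_pos hK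
    have hd := hS.deriv_invDeriv hK
    rw [ha]
    refine ⟨hS.isDivergence.finite _ hpos, fun y hy => ?_⟩
    have hg := hS.isDivergence.gradient_ineq hpos hy
    rw [hd] at hg
    have h2 := mul_le_mul_of_nonneg_left hg hη.le
    have h3 : S.eta * (t / S.eta) = t := mul_div_cancel₀ _ hη.ne'
    have h4 : S.eta * (finPart S.phi (S.invDeriv (t / S.eta)) + t / S.eta *
        (y - S.invDeriv (t / S.eta)) + S.kappa / 2 * (y - S.invDeriv (t / S.eta)) ^ 2) =
        S.eta * finPart S.phi (S.invDeriv (t / S.eta)) + t * (y - S.invDeriv (t / S.eta)) +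
          S.eta * (S.kappa / 2 * (y - S.invDeriv (t / S.eta)) ^ 2) := by
      rw [mul_add, mul_add, ← mul_assoc S.eta (t / S.eta), h3]
    rw [h4] at h2
    nlinarith

theorem Valid.argmax_nonneg (hS : S.Valid) (t : ℝ) : 0 ≤ S.argmax t :=
  hS.isDivergence.nonneg_of_ne_top (hS.argmax_spec t).1

theorem Valid.isGreatest_conj (hS : S.Valid) (t : ℝ) :
    IsGreatest {y : ℝ | ∃ s : ℝ, S.phi s ≠ ⊤ ∧ y = t * s - S.eta * finPart S.phi s}
      (t * S.argmax t - S.eta * finPart S.phi (S.argmax t)) := by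
  refine ⟨⟨_, (hS.argmax_spec t).1, rfl⟩, ?_⟩
  rintro _ ⟨s, hs, rfl⟩
  have := (hS.argmax_spec t).2 s hs
  nlinarith [mul_nonneg (mul_pos hS.kappa_pos hS.eta_pos).le (sq_nonneg (s - S.argmax t))]

theorem Valid.conj_eq (hS : S.Valid) (t : ℝ) :
    conj S.phi S.eta t = t * S.argmax t - S.eta * finPart S.phi (S.argmax t) :=
  (hS.isGreatest_conj t).csSup_eq

theorem Valid.le_conj (hS : S.Valid) (t : ℝ) {y : ℝ} (hy : S.phi y ≠ ⊤) :
    t * y - S.eta * finPart S.phi y ≤ conj S.phi S.eta t := by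
  rw [hS.conj_eq]
  exact (hS.isGreatest_conj t).2 ⟨y, hy, rfl⟩

theorem Valid.self_le_conj (hS : S.Valid) (t : ℝ) : t ≤ conj S.phi S.eta t := by
  have := hS.le_conj t (hS.isDivergence.finite 1 one_pos)
  rw [hS.isDivergence.finPart_one] at this
  linarith

theorem Valid.conj_le (hS : S.Valid) (t : ℝ) : conj S.phi S.eta t ≤ t * S.argmax t := by
  rw [hS.conj_eq]
  have := mul_nonneg hS.eta_pos.le (IsDivergence.finPart_nonneg S.phi (S.argmax t))
  linarith

/-- The point `argmax t` competes in the supremum that defines the conjugate at t', so it is a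
subgradient at t. -/
theorem Valid.conj_add_le (hS : S.Valid) (t t' : ℝ) :
    conj S.phi S.eta t + S.argmax t * (t' - t) ≤ conj S.phi S.eta t' := by
  have := hS.le_conj t' (hS.argmax_spec t).1
  rw [hS.conj_eq t]
  linarith

theorem Valid.conj_le_add (hS : S.Valid) (t t' : ℝ) :
    conj S.phi S.eta t' ≤ conj S.phi S.eta t + S.argmax t * (t' - t) +
      (t' - t) ^ 2 / (2 * S.kappa * S.eta) := by
  have h := (hS.argmax_spec t).2 _ (hS.argmax_spec t').1
  rw [← hS.conj_eq] at h
  have hc : 0 < S.kappa * S.eta := mul_pos hS.kappa_pos hS.eta_pos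
  rw [hS.conj_eq t']
  set d := S.argmax t' - S.argmax t with hd
  -- The left side is a concave quadratic in d with maximum at d = (t' - t)/(κη).
  have hq : (t' - t) * d - S.kappa * S.eta / 2 * d ^ 2 ≤
      (t' - t) ^ 2 / (2 * S.kappa * S.eta) := by
    rw [le_div_iff₀ (by linarith)]
    nlinarith [sq_nonneg (t' - t - S.kappa * S.eta * d)]
  have : S.argmax t' = S.argmax t + d := by rw [hd]; ring
  nlinarith

/-- The sum of the two decay estimates, each tested at the maximizer of the other. Monotonicity and
the Lipschitz bound of `argmax` both follow. -/
theorem Valid.argmax_cocoercive (hS : S.Valid) (t t' : ℝ) :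
    S.kappa * S.eta * (S.argmax t - S.argmax t') ^ 2 ≤
      (t - t') * (S.argmax t - S.argmax t') := by
  have h1 := (hS.argmax_spec t).2 _ (hS.argmax_spec t').1
  have h2 := (hS.argmax_spec t').2 _ (hS.argmax_spec t).1
  nlinarith

theorem Valid.argmax_mono (hS : S.Valid) : Monotone S.argmax := by
  intro t t' h
  have hc := hS.argmax_cocoercive t t'
  have hk : 0 < S.kappa * S.eta := mul_pos hS.kappa_pos hS.eta_pos
  by_contra hcon
  have hd : 0 < S.argmax t - S.argmax t' := by linarith
  nlinarith [mul_pos hk (pow_pos hd 2), mul_nonneg (sub_nonneg.2 h) hd.le]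

theorem Valid.abs_argmax_sub_le (hS : S.Valid) (t t' : ℝ) :
    |S.argmax t - S.argmax t'| ≤ |t - t'| / (S.kappa * S.eta) := by
  have hk : 0 < S.kappa * S.eta := mul_pos hS.kappa_pos hS.eta_pos
  have hc := hS.argmax_cocoercive t t'
  rw [le_div_iff₀ hk]
  rcases eq_or_lt_of_le (abs_nonneg (S.argmax t - S.argmax t')) with h | h
  · rw [← h, zero_mul]; exact abs_nonneg _
  · have h1 : (t - t') * (S.argmax t - S.argmax t') ≤ |t - t'| * |S.argmax t - S.argmax t'| := by
      rw [← abs_mul]; exact le_abs_self _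
    rw [← sq_abs (S.argmax t - S.argmax t')] at hc
    nlinarith

theorem Valid.lipschitzWith_argmax (hS : S.Valid) :
    LipschitzWith (Real.toNNReal (1 / (S.kappa * S.eta))) S.argmax := by
  refine LipschitzWith.of_dist_le_mul fun t t' => ?_
  have hk : 0 < S.kappa * S.eta := mul_pos hS.kappa_pos hS.eta_pos
  rw [Real.dist_eq, Real.dist_eq, Real.coe_toNNReal _ (by positivity)]
  refine (hS.abs_argmax_sub_le t t').trans (le_of_eq ?_)
  ring

theorem Valid.continuous_argmax (hS : S.Valid) : Continuous S.argmax :=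
  hS.lipschitzWith_argmax.continuous

/-- At t = 0 the point 1 is optimal because φ ≥ 0 = φ(1), and quadratic decay makes the optimum
unique. This normalization brackets the multiplier: data above μ get weight at least 1/m, data below
at most 1/m. -/
theorem Valid.argmax_zero (hS : S.Valid) : S.argmax 0 = 1 := by
  have h := (hS.argmax_spec 0).2 1 (hS.isDivergence.finite 1 one_pos)
  rw [hS.isDivergence.finPart_one] at h
  have hk : 0 < S.kappa * S.eta := mul_pos hS.kappa_pos hS.eta_pos
  have h1 := mul_nonneg hS.eta_pos.le (IsDivergence.finPart_nonneg S.phi (S.argmax 0))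
  have h2 : S.kappa * S.eta / 2 * (1 - S.argmax 0) ^ 2 ≤ 0 := by linarith
  have h3 : (1 - S.argmax 0) ^ 2 = 0 := by
    by_contra hne
    have : 0 < (1 - S.argmax 0) ^ 2 := lt_of_le_of_ne (sq_nonneg _) (Ne.symm hne)
    nlinarith
  have := pow_eq_zero_iff (two_ne_zero) |>.1 h3
  linarith

/-- The first-order remainder lies between 0 and a multiple of (x - t)². -/
theorem Valid.hasDerivAt_conj (hS : S.Valid) (t : ℝ) :
    HasDerivAt (conj S.phi S.eta) (S.argmax t) t := by
  have hk : 0 < 2 * S.kappa * S.eta := mul_pos (mul_pos two_pos hS.kappa_pos) hS.eta_pos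
  rw [hasDerivAt_iff_isLittleO]
  refine Asymptotics.IsBigO.trans_isLittleO (g := fun x => (x - t) ^ 2) ?_ ?_
  · refine Asymptotics.IsBigO.of_bound (1 / (2 * S.kappa * S.eta)) (Eventually.of_forall ?_)
    intro x
    have h1 := hS.conj_add_le t x
    have h2 := hS.conj_le_add t x
    rw [Real.norm_eq_abs, Real.norm_eq_abs, abs_of_nonneg (sq_nonneg (x - t)), smul_eq_mul,
      abs_of_nonneg (by linarith)]
    rw [one_div, inv_mul_eq_div]
    linarith
  · simpa using Asymptotics.isLittleO_pow_sub_sub t (by norm_num : 1 < 2)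

theorem Valid.continuous_conj (hS : S.Valid) : Continuous (conj S.phi S.eta) :=
  continuous_iff_continuousAt.2 fun t => (hS.hasDerivAt_conj t).continuousAt

theorem inactive_iff {m : ℕ} (v : Fin m → ℝ) (μ : ℝ) (i : Fin m) :
    S.Inactive v μ i ↔ ((v i - μ : ℝ) : EReal) ≤ (S.eta : EReal) * S.K := by
  unfold Inactive
  generalize (S.eta : EReal) * S.K = c
  induction c with
  | bot => simp only [EReal.add_bot, le_bot_iff, EReal.coe_ne_bot]
  | top => simp only [EReal.coe_add_top, le_top]
  | coe c => rw [← EReal.coe_add, EReal.coe_le_coe_iff, EReal.coe_le_coe_iff, sub_le_iff_le_add']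

/-- From here on weights are handled through the everywhere defined, continuous `argmax`, and
inactive indices need no separate treatment. -/
theorem weight_eq {m : ℕ} (v : Fin m → ℝ) (μ : ℝ) (i : Fin m) :
    S.weight v μ i = 1 / m * S.argmax (v i - μ) := by
  unfold weight argmax
  simp only [inactive_iff]
  split_ifs <;> simp

theorem excess_eq {m : ℕ} (v : Fin m → ℝ) (μ : ℝ) :
    S.excess v μ = 1 / m * ∑ i, S.argmax (v i - μ) - 1 := by
  classical
  unfold excess argmax
  simp only [inactive_iff]
  rw [Finset.sum_filter]
  congr 2
  refine Finset.sum_congr rfl fun i _ => ?_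
  split_ifs <;> simp_all

end Penalty

end

end PhiDRO

namespace PhiDRO

noncomputable section

/-! ### The bisection algorithm -/

namespace Penalty

variable {S : Penalty}

/-! ### The dual problem of a finite sample and its exact solution. -/

section Dual

variable {m : ℕ} (v : Fin m → ℝ)

theorem Valid.excess_antitone (hS : S.Valid) : Antitone (S.excess v) := by
  intro a b hab
  rw [excess_eq, excess_eq]
  gcongr with i
  exact hS.argmax_mono (by linarith)

theorem Valid.continuous_excess (hS : S.Valid) : Continuous (S.excess v) := by
  have := hS.continuous_argmax
  simp_rw [funext (excess_eq v)]
  fun_prop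

theorem lower_le (i : Fin m) : lower v ≤ v i := ciInf_le (Set.finite_range v).bddBelow i

theorem le_sup (i : Fin m) : v i ≤ ⨆ j, v j := le_ciSup (Set.finite_range v).bddAbove i

/-- `argmax` is nondecreasing, vanishes at ηK and equals 1 at 0, so ηK must be negative. Hence the
right end of the initial interval lies above all the data. -/
theorem Valid.eta_mul_K_neg (hS : S.Valid) (hK : S.K ≠ ⊥) :
    S.eta * S.K.toReal < 0 ∧ S.argmax (S.eta * S.K.toReal) = 0 := by
  obtain ⟨k, hk⟩ : ∃ k : ℝ, S.K = k :=
    ⟨S.K.toReal, (EReal.coe_toReal hS.K_lt_top.ne hK).symm⟩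
  have h0 : S.argmax (S.eta * S.K.toReal) = 0 := by
    refine if_pos ?_
    rw [hk, EReal.toReal_coe, EReal.coe_mul]
  refine ⟨?_, h0⟩
  by_contra hcon
  have := hS.argmax_mono (not_lt.1 hcon)
  rw [h0, hS.argmax_zero] at this
  linarith

theorem Valid.le_upper (hS : S.Valid) (i : Fin m) : v i ≤ S.upper v := by
  have h1 := le_sup v i
  have h2 := lower_le v i
  unfold lower at h2
  unfold upper
  split_ifs with hK
  · nlinarith [hS.eta_pos]
  · linarith [(hS.eta_mul_K_neg hK).1]

theorem Valid.excess_lower_nonneg (hS : S.Valid) (hm : 0 < m) : 0 ≤ S.excess v (lower v) := by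
  rw [excess_eq]
  have hm' : (0 : ℝ) < m := by exact_mod_cast hm
  have : ∑ _i : Fin m, (1 : ℝ) ≤ ∑ i, S.argmax (v i - lower v) :=
    Finset.sum_le_sum fun i _ => by
      rw [← hS.argmax_zero]
      exact hS.argmax_mono (by linarith [lower_le v i])
  simp only [Finset.sum_const, Finset.card_univ, Fintype.card_fin, nsmul_eq_mul, mul_one] at this
  rw [sub_nonneg, one_div, inv_mul_eq_div, le_div_iff₀ hm']
  linarith

theorem Valid.excess_upper_nonpos (hS : S.Valid) (hm : 0 < m) : S.excess v (S.upper v) ≤ 0 := by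
  rw [excess_eq]
  have hm' : (0 : ℝ) < m := by exact_mod_cast hm
  have : ∑ i, S.argmax (v i - S.upper v) ≤ ∑ _i : Fin m, (1 : ℝ) :=
    Finset.sum_le_sum fun i _ => by
      rw [← hS.argmax_zero]
      exact hS.argmax_mono (by linarith [hS.le_upper v i])
  simp only [Finset.sum_const, Finset.card_univ, Fintype.card_fin, nsmul_eq_mul, mul_one] at this
  rw [sub_nonpos, one_div, inv_mul_eq_div, div_le_iff₀ hm']
  linarith

theorem Valid.lower_le_upper (hS : S.Valid) (hm : 0 < m) : lower v ≤ S.upper v :=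
  (lower_le v ⟨0, hm⟩).trans (hS.le_upper v ⟨0, hm⟩)

variable (S) in
/-- An exact dual multiplier. -/
def muStar : ℝ := sInf {μ | lower v ≤ μ ∧ S.excess v μ ≤ 0}

theorem Valid.muStar_mem (hS : S.Valid) (hm : 0 < m) :
    IsLeast {μ | lower v ≤ μ ∧ S.excess v μ ≤ 0} (S.muStar v) := by
  have hne : {μ | lower v ≤ μ ∧ S.excess v μ ≤ 0}.Nonempty :=
    ⟨_, hS.lower_le_upper v hm, hS.excess_upper_nonpos v hm⟩
  have hb : BddBelow {μ | lower v ≤ μ ∧ S.excess v μ ≤ 0} := ⟨lower v, fun μ h => h.1⟩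
  have hcl : IsClosed {μ | lower v ≤ μ ∧ S.excess v μ ≤ 0} :=
    isClosed_Ici.inter (isClosed_Iic.preimage (hS.continuous_excess v))
  exact ⟨hcl.csInf_mem hne hb, fun μ h => csInf_le hb h⟩

/-- Since h is nonincreasing, the set whose infimum is `muStar` is a closed ray. This description
gives both the bisection decision and the measurability of `muStar`. -/
theorem Valid.muStar_le_iff (hS : S.Valid) (hm : 0 < m) (c : ℝ) :
    S.muStar v ≤ c ↔ lower v ≤ c ∧ S.excess v c ≤ 0 := by
  refine ⟨fun h => ⟨(hS.muStar_mem v hm).1.1.trans h, ?_⟩, fun h => (hS.muStar_mem v hm).2 h⟩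
  exact (hS.excess_antitone v h).trans (hS.muStar_mem v hm).1.2

theorem Valid.excess_muStar (hS : S.Valid) (hm : 0 < m) : S.excess v (S.muStar v) = 0 := by
  refine le_antisymm (hS.muStar_mem v hm).1.2 ?_
  obtain ⟨r, hr, hr0⟩ := intermediate_value_Icc' (hS.lower_le_upper v hm)
    (hS.continuous_excess v).continuousOn
    ⟨hS.excess_upper_nonpos v hm, hS.excess_lower_nonneg v hm⟩
  rw [← hr0]
  exact hS.excess_antitone v ((hS.muStar_mem v hm).2 ⟨hr.1, hr0.le⟩)

theorem Valid.sum_argmax_muStar (hS : S.Valid) (hm : 0 < m) :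
    1 / (m : ℝ) * ∑ i, S.argmax (v i - S.muStar v) = 1 := by
  have := hS.excess_muStar v hm
  rw [excess_eq] at this
  linarith

theorem muStar_comp_perm (σ : Equiv.Perm (Fin m)) : S.muStar (v ∘ σ) = S.muStar v := by
  have h1 : lower (v ∘ σ) = lower v := σ.iInf_comp (g := v)
  have h2 : S.excess (v ∘ σ) = S.excess v := by
    funext μ
    rw [excess_eq, excess_eq]
    congr 2
    exact Equiv.sum_comp σ (fun i => S.argmax (v i - μ))
  unfold muStar
  rw [h1, h2]

/-- The average over the data of the subgradient bound for the conjugate: D is convex with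
derivative `-S.excess v μ`. The matching upper bound `dualValue_le` is its 1/(κη)-smoothness. -/
theorem Valid.le_dualValue (hS : S.Valid) (hm : 0 < m) (μ μ' : ℝ) :
    S.dualValue v μ - S.excess v μ * (μ' - μ) ≤ S.dualValue v μ' := by
  have hm' : (0 : ℝ) < m := by exact_mod_cast hm
  have h : 1 / (m : ℝ) * ∑ i, (conj S.phi S.eta (v i - μ) + S.argmax (v i - μ) * (μ - μ')) ≤
      1 / (m : ℝ) * ∑ i, conj S.phi S.eta (v i - μ') := by
    gcongr with i
    have := hS.conj_add_le (v i - μ) (v i - μ')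
    rwa [show v i - μ' - (v i - μ) = μ - μ' by ring] at this
  rw [Finset.sum_add_distrib, ← Finset.sum_mul] at h
  unfold dualValue
  rw [excess_eq]
  linarith

theorem Valid.dualValue_le (hS : S.Valid) (hm : 0 < m) (μ μ' : ℝ) :
    S.dualValue v μ' ≤ S.dualValue v μ - S.excess v μ * (μ' - μ) +
      (μ' - μ) ^ 2 / (2 * S.kappa * S.eta) := by
  have hm' : (0 : ℝ) < m := by exact_mod_cast hm
  have h : 1 / (m : ℝ) * ∑ i, conj S.phi S.eta (v i - μ') ≤
      1 / (m : ℝ) * ∑ i, (conj S.phi S.eta (v i - μ) + S.argmax (v i - μ) * (μ - μ') +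
        (μ' - μ) ^ 2 / (2 * S.kappa * S.eta)) := by
    gcongr with i
    have := hS.conj_le_add (v i - μ) (v i - μ')
    rwa [show v i - μ' - (v i - μ) = μ - μ' by ring,
      show (μ - μ') ^ 2 = (μ' - μ) ^ 2 by ring] at this
  rw [Finset.sum_add_distrib, Finset.sum_add_distrib, ← Finset.sum_mul, Finset.sum_const,
    Finset.card_univ, Fintype.card_fin, nsmul_eq_mul, mul_add, ← mul_assoc (1 / (m : ℝ)) (m : ℝ),
    one_div_mul_cancel hm'.ne', one_mul] at h
  unfold dualValue
  rw [excess_eq]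
  linarith

theorem Valid.dualValue_muStar_le (hS : S.Valid) (hm : 0 < m) (μ : ℝ) :
    S.dualValue v (S.muStar v) ≤ S.dualValue v μ := by
  have := hS.le_dualValue v hm (S.muStar v) μ
  rw [hS.excess_muStar v hm] at this
  linarith

/-- The choice s = 1 in the conjugate is free of penalty, so every dual value dominates the plain
mean. It serves as the lower half of an integrable envelope for the optimal value. -/
theorem Valid.mean_le_dualValue (hS : S.Valid) (hm : 0 < m) (μ : ℝ) :
    1 / (m : ℝ) * ∑ i, v i ≤ S.dualValue v μ := by
  have hm' : (0 : ℝ) < m := by exact_mod_cast hm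
  have h : 1 / (m : ℝ) * ∑ i, (v i - μ) ≤ 1 / (m : ℝ) * ∑ i, conj S.phi S.eta (v i - μ) := by
    gcongr with i
    exact hS.self_le_conj _
  rw [Finset.sum_sub_distrib, Finset.sum_const, Finset.card_univ, Fintype.card_fin, nsmul_eq_mul,
    mul_sub, ← mul_assoc (1 / (m : ℝ)) (m : ℝ), one_div_mul_cancel hm'.ne', one_mul] at h
  unfold dualValue
  linarith

variable (S) in
/-- The exact optimal weights. -/
def optWeight : Fin m → ℝ := S.weight v (S.muStar v)

theorem optWeight_comp_perm (σ : Equiv.Perm (Fin m)) (i : Fin m) :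
    S.optWeight (v ∘ σ) i = S.optWeight v (σ i) := by
  unfold optWeight
  rw [muStar_comp_perm, weight_eq, weight_eq, Function.comp_apply]

theorem Valid.weight_nonneg (hS : S.Valid) (μ : ℝ) (i : Fin m) : 0 ≤ S.weight v μ i := by
  rw [weight_eq]
  exact mul_nonneg (by positivity) (hS.argmax_nonneg _)

theorem Valid.sum_optWeight (hS : S.Valid) (hm : 0 < m) : ∑ i, S.optWeight v i = 1 := by
  unfold optWeight
  simp_rw [weight_eq]
  rw [← Finset.mul_sum]
  exact hS.sum_argmax_muStar v hm

theorem Valid.optWeight_le_one (hS : S.Valid) (hm : 0 < m) (i : Fin m) : S.optWeight v i ≤ 1 := by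
  rw [← hS.sum_optWeight v hm]
  exact Finset.single_le_sum (fun j _ => hS.weight_nonneg v _ j) (Finset.mem_univ i)

/-- At `muStar` the weights sum to one, so the multiplier cancels and only the nonnegative penalty
is dropped. -/
theorem Valid.dualValue_muStar_le_sum (hS : S.Valid) (hm : 0 < m) :
    S.dualValue v (S.muStar v) ≤ ∑ i, S.optWeight v i * v i := by
  have hm' : (0 : ℝ) < m := by exact_mod_cast hm
  have h : 1 / (m : ℝ) * ∑ i, conj S.phi S.eta (v i - S.muStar v) ≤
      1 / (m : ℝ) * ∑ i, ((v i - S.muStar v) * S.argmax (v i - S.muStar v)) := by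
    gcongr with i
    exact hS.conj_le _
  have h1 := hS.sum_argmax_muStar v hm
  have h2 : ∑ i, S.optWeight v i * v i =
      1 / (m : ℝ) * ∑ i, ((v i - S.muStar v) * S.argmax (v i - S.muStar v)) + S.muStar v *
        (1 / (m : ℝ) * ∑ i, S.argmax (v i - S.muStar v)) := by
    rw [Finset.mul_sum, Finset.mul_sum, Finset.mul_sum, ← Finset.sum_add_distrib]
    refine Finset.sum_congr rfl fun i _ => ?_
    unfold optWeight
    rw [weight_eq]
    ring
  rw [h1] at h2
  unfold dualValue
  linarith

theorem Valid.abs_dualValue_muStar_le (hS : S.Valid) (hm : 0 < m) :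
    |S.dualValue v (S.muStar v)| ≤ ∑ i, |v i| := by
  rw [abs_le]
  constructor
  · refine le_trans ?_ (hS.mean_le_dualValue v hm _)
    rw [Finset.mul_sum, ← Finset.sum_neg_distrib]
    refine Finset.sum_le_sum fun i _ => ?_
    have h1 : (1 : ℝ) / m ≤ 1 := by
      rw [div_le_one (by exact_mod_cast hm)]; exact_mod_cast hm
    have h0 : (0 : ℝ) ≤ 1 / m := by positivity
    calc -|v i| ≤ -|1 / (m : ℝ) * v i| := by
          rw [abs_mul, abs_of_nonneg h0]
          nlinarith [abs_nonneg (v i)]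
      _ ≤ _ := neg_abs_le _
  · refine (hS.dualValue_muStar_le_sum v hm).trans (Finset.sum_le_sum fun i _ => ?_)
    calc S.optWeight v i * v i ≤ S.optWeight v i * |v i| :=
          mul_le_mul_of_nonneg_left (le_abs_self _) (hS.weight_nonneg v _ i)
      _ ≤ 1 * |v i| := mul_le_mul_of_nonneg_right (hS.optWeight_le_one v hm i) (abs_nonneg _)
      _ = _ := one_mul _

/-- The χ² hypothesis speaks of optimal vectors, so `optWeight` has to be one. On vectors of total
mass 1 the data may be shifted by `muStar`, after which each summand is maximized separately by
`argmax`. -/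
theorem Valid.isOptimalWeight_optWeight (hS : S.Valid) (hm : 0 < m) :
    IsOptimalWeight S.phi S.eta v (S.optWeight v) := by
  have hm' : (0 : ℝ) < m := by exact_mod_cast hm
  have hmw : ∀ i, (m : ℝ) * S.optWeight v i = S.argmax (v i - S.muStar v) := by
    intro i
    unfold optWeight
    rw [weight_eq, ← mul_assoc, mul_one_div_cancel hm'.ne', one_mul]
  have hobj : ∀ γ : Fin m → ℝ, ∑ i, γ i = 1 → discObj S.phi S.eta v γ = S.muStar v +
      1 / m * ∑ i, ((v i - S.muStar v) * (m * γ i) - S.eta * finPart S.phi (m * γ i)) := by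
    intro γ hγ
    unfold discObj
    have : 1 / (m : ℝ) *
        ∑ i, ((v i - S.muStar v) * (m * γ i) - S.eta * finPart S.phi (m * γ i)) =
        ∑ i, γ i * v i - S.muStar v * ∑ i, γ i - S.eta / m * ∑ i, finPart S.phi (m * γ i) := by
      rw [Finset.mul_sum, Finset.mul_sum, Finset.mul_sum, ← Finset.sum_sub_distrib,
        ← Finset.sum_sub_distrib]
      refine Finset.sum_congr rfl fun i _ => ?_
      field_simp
    rw [this, hγ]
    ring
  refine ⟨⟨⟨fun i => hS.weight_nonneg v _ i, hS.sum_optWeight v hm⟩, fun i => ?_⟩,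
    fun γ hγ => ?_⟩
  · rw [hmw]; exact (hS.argmax_spec _).1
  · rw [hobj γ hγ.1.2, hobj _ (hS.sum_optWeight v hm)]
    refine add_le_add le_rfl (mul_le_mul_of_nonneg_left (Finset.sum_le_sum fun i _ => ?_)
      (by positivity))
    rw [hmw, ← hS.conj_eq]
    exact hS.le_conj _ (hγ.2 i)

end Dual

/-! ### Accuracy and query count of the bisection. -/

section Bisection

variable {m : ℕ} (v : Fin m → ℝ)

/-- The bound `lower v ≤ s.lo` is carried along because `muStar_le_iff` asks for it at the midpoint.
The current multiplier is an interval endpoint only after a step has been made, whence the condition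
k ≠ 0. -/
theorem Valid.bisect_invariant (hS : S.Valid) (hm : 0 < m) (k : ℕ) :
    let s := (S.step v)^[k] (S.initState v)
    s.lo ≤ S.muStar v ∧ S.muStar v ≤ s.hi ∧ s.hi - s.lo = (S.upper v - lower v) / 2 ^ k ∧
      s.queries = m + k * m ∧ lower v ≤ s.lo ∧ (k ≠ 0 → s.mu = s.lo ∨ s.mu = s.hi) := by
  induction k with
  | zero =>
    refine ⟨(hS.muStar_mem v hm).1.1, ?_, by simp [initState],
      by simp [initState], le_rfl, by simp⟩
    exact (hS.muStar_le_iff v hm _).2 ⟨hS.lower_le_upper v hm, hS.excess_upper_nonpos v hm⟩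
  | succ k ih =>
    simp only [Function.iterate_succ_apply'] at ih ⊢
    set s := (S.step v)^[k] (S.initState v)
    obtain ⟨h1, h2, h3, h4, h6, -⟩ := ih
    have hμ : S.excess v ((s.lo + s.hi) / 2) ≤ 0 → S.muStar v ≤ (s.lo + s.hi) / 2 := by
      intro h
      exact (hS.muStar_le_iff v hm _).2 ⟨by linarith, h⟩
    unfold step
    by_cases h : S.excess v ((s.lo + s.hi) / 2) ≤ 0
    · simp only [h, if_true]
      refine ⟨h1, hμ h, ?_, ?_, h6, fun _ => by simp⟩
      · rw [pow_succ, ← div_div, ← h3]; ring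
      · rw [h4]; ring
    · simp only [h, if_false]
      refine ⟨?_, h2, ?_, ?_, by linarith, fun _ => by simp⟩
      · by_contra hcon
        exact h ((hS.muStar_le_iff v hm _).1 (not_le.1 hcon).le).2
      · rw [pow_succ, ← div_div, ← h3]; ring
      · rw [h4]; ring

theorem iterations_pos (S : Penalty) (ε : ℝ) : 1 ≤ S.iterations ε v := le_max_left _ _

theorem Valid.solveCost_eq (hS : S.Valid) (hm : 0 < m) (ε : ℝ) :
    S.solveCost ε v = (S.iterations ε v + 2) * m := by
  unfold solveCost run
  rw [(hS.bisect_invariant v hm _).2.2.2.1]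
  ring

/-- The output is an endpoint of a final interval that also contains `muStar`, so the error is at
most ϱ/2^N. The number of steps is chosen so that 4^N ≥ ϱ²/(2κηε). -/
theorem Valid.sq_outMu_sub_le (hS : S.Valid) (hm : 0 < m) {ε : ℝ} (hε : 0 < ε) :
    (S.outMu ε v - S.muStar v) ^ 2 ≤ 2 * S.kappa * S.eta * ε := by
  obtain ⟨h1, h2, h3, -, -, h5⟩ := hS.bisect_invariant v hm (S.iterations ε v)
  have h5 := h5 (by have := iterations_pos v S ε; omega)
  have hk := hS.kappa_pos
  have hη := hS.eta_pos
  change _ ≤ _ at h1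
  have hsq : (S.outMu ε v - S.muStar v) ^ 2 ≤
      ((S.upper v - lower v) / 2 ^ S.iterations ε v) ^ 2 := by
    unfold outMu run
    rw [← h3]
    rcases h5 with h | h <;> rw [h] <;> nlinarith
  refine hsq.trans ?_
  rw [div_pow, ← pow_mul, div_le_iff₀ (by positivity)]
  set ϱ := S.upper v - lower v with hϱ
  -- The logarithm of 0 is 0 by convention and carries no information, so a degenerate interval is
  -- treated apart.
  rcases eq_or_ne ϱ 0 with h0 | h0
  · rw [h0, zero_pow two_ne_zero]; positivity
  · have hX : 0 < ϱ ^ 2 / (2 * S.kappa * S.eta) * (1 / ε) := by positivity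
    have hT : 1 / 2 * Real.logb 2 (ϱ ^ 2 / (2 * S.kappa * S.eta) * (1 / ε)) ≤
        (S.iterations ε v : ℝ) := by
      refine (Nat.le_ceil _).trans ?_
      exact_mod_cast le_max_right _ _
    have h4 : Real.logb 2 (ϱ ^ 2 / (2 * S.kappa * S.eta) * (1 / ε)) ≤
        ((S.iterations ε v * 2 : ℕ) : ℝ) := by push_cast; linarith
    rw [Real.logb_le_iff_le_rpow one_lt_two hX, Real.rpow_natCast, mul_one_div,
      div_le_iff₀ hε, div_le_iff₀ (by positivity)] at h4
    linarith

/-- The derivative of D vanishes at `muStar`, so smoothness makes the loss quadratic in the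
multiplier error. -/
theorem Valid.dualValue_outMu_le (hS : S.Valid) (hm : 0 < m) {ε : ℝ} (hε : 0 < ε) :
    S.dualValue v (S.outMu ε v) ≤ S.dualValue v (S.muStar v) + ε := by
  have h := hS.dualValue_le v hm (S.muStar v) (S.outMu ε v)
  rw [hS.excess_muStar v hm, zero_mul, sub_zero] at h
  have hk : 0 < 2 * S.kappa * S.eta := mul_pos (mul_pos two_pos hS.kappa_pos) hS.eta_pos
  have h2 : (S.outMu ε v - S.muStar v) ^ 2 / (2 * S.kappa * S.eta) ≤ ε := by
    rw [div_le_iff₀ hk]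
    linarith [hS.sq_outMu_sub_le v hm hε]
  linarith

variable (S) in
/-- The `ℓ¹`-accuracy of the computed weights. -/
def weightErr (ε : ℝ) : ℝ := √(2 * ε / (S.kappa * S.eta))

theorem weightErr_nonneg (ε : ℝ) : 0 ≤ S.weightErr ε := Real.sqrt_nonneg _

theorem Valid.sq_weightErr (hS : S.Valid) {ε : ℝ} (hε : 0 < ε) :
    S.weightErr ε ^ 2 = 2 * ε / (S.kappa * S.eta) :=
  Real.sq_sqrt (div_nonneg (by linarith) (mul_pos hS.kappa_pos hS.eta_pos).le)

theorem Valid.abs_outWeight_sub_le (hS : S.Valid) (hm : 0 < m) {ε : ℝ} (hε : 0 < ε) (i : Fin m) :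
    |S.outWeight ε v i - S.optWeight v i| ≤ 1 / m * S.weightErr ε := by
  unfold outWeight optWeight
  rw [weight_eq, weight_eq, ← mul_sub, abs_mul, abs_of_nonneg (by positivity : (0 : ℝ) ≤ 1 / m)]
  have hk : 0 < S.kappa * S.eta := mul_pos hS.kappa_pos hS.eta_pos
  gcongr
  refine (hS.abs_argmax_sub_le _ _).trans (Real.le_sqrt_of_sq_le ?_)
  rw [show v i - S.outMu ε v - (v i - S.muStar v) = -(S.outMu ε v - S.muStar v) by ring, abs_neg,
    div_pow, sq_abs, div_le_div_iff₀ (by positivity) hk]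
  have := mul_le_mul_of_nonneg_right (hS.sq_outMu_sub_le v hm hε) hk.le
  nlinarith

theorem Valid.sum_abs_outWeight_sub_le (hS : S.Valid) (hm : 0 < m) {ε : ℝ} (hε : 0 < ε) :
    ∑ i, |S.outWeight ε v i - S.optWeight v i| ≤ S.weightErr ε := by
  have hm' : (m : ℝ) ≠ 0 := by exact_mod_cast hm.ne'
  refine (Finset.sum_le_sum fun i _ => hS.abs_outWeight_sub_le v hm hε i).trans (le_of_eq ?_)
  rw [Finset.sum_const, Finset.card_univ, Fintype.card_fin, nsmul_eq_mul, ← mul_assoc,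
    mul_one_div_cancel hm', one_mul]

theorem Valid.sum_outWeight_le (hS : S.Valid) (hm : 0 < m) {ε : ℝ} (hε : 0 < ε) :
    ∑ i, S.outWeight ε v i ≤ 1 + S.weightErr ε := by
  rw [← hS.sum_optWeight v hm]
  have h := hS.sum_abs_outWeight_sub_le v hm hε
  have h2 : ∑ i, (S.outWeight ε v i - S.optWeight v i) ≤
      ∑ i, |S.outWeight ε v i - S.optWeight v i| :=
    Finset.sum_le_sum fun i _ => le_abs_self _
  rw [Finset.sum_sub_distrib] at h2
  linarith

theorem Valid.outWeight_nonneg (hS : S.Valid) (ε : ℝ) (i : Fin m) : 0 ≤ S.outWeight ε v i :=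
  hS.weight_nonneg v _ i

end Bisection

/-! ### Measurability of the algorithm's output in the data. -/

section Measurability

variable {m : ℕ}

theorem measurable_lower : Measurable (lower : (Fin m → ℝ) → ℝ) := by
  unfold lower
  exact Measurable.iInf fun i => measurable_pi_apply i

theorem measurable_upper : Measurable (S.upper : (Fin m → ℝ) → ℝ) := by
  have h1 : Measurable fun v : Fin m → ℝ => ⨅ i, v i :=
    Measurable.iInf fun i => measurable_pi_apply i
  have h2 : Measurable fun v : Fin m → ℝ => ⨆ i, v i :=
    Measurable.iSup fun i => measurable_pi_apply i
  unfold upper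
  split_ifs <;> fun_prop

theorem Valid.measurable_excess (hS : S.Valid) {X : Type*} [MeasurableSpace X]
    {V : X → Fin m → ℝ} (hV : Measurable V) {μ : X → ℝ} (hμ : Measurable μ) :
    Measurable fun x => S.excess (V x) (μ x) := by
  have := hS.continuous_argmax.measurable
  simp_rw [excess_eq]
  fun_prop

theorem Valid.measurable_muStar (hS : S.Valid) (hm : 0 < m) :
    Measurable (S.muStar : (Fin m → ℝ) → ℝ) := by
  refine measurable_of_Iic fun c => ?_
  have : S.muStar ⁻¹' Iic c = {v : Fin m → ℝ | lower v ≤ c} ∩ {v | S.excess v c ≤ 0} := by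
    ext v
    exact hS.muStar_le_iff v hm c
  rw [this]
  exact (measurableSet_le measurable_lower measurable_const).inter
    (measurableSet_le (hS.measurable_excess measurable_id measurable_const) measurable_const)

theorem measurable_iterations (ε : ℝ) :
    Measurable (S.iterations ε : (Fin m → ℝ) → ℕ) := by
  have h1 : Measurable fun v : Fin m → ℝ => S.upper v - lower v :=
    measurable_upper.sub measurable_lower
  unfold iterations Real.logb
  refine measurable_const.max (Nat.measurable_ceil.comp ?_)
  have : Measurable fun v : Fin m → ℝ =>
      Real.log ((S.upper v - lower v) ^ 2 / (2 * S.kappa * S.eta) * (1 / ε)) :=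
    Real.measurable_log.comp (((h1.pow_const 2).div_const _).mul_const _)
  exact (this.div_const _).const_mul _

theorem Valid.measurable_iterate (hS : S.Valid) (k : ℕ) :
    Measurable (fun v : Fin m → ℝ => ((S.step v)^[k] (S.initState v)).lo) ∧
    Measurable (fun v : Fin m → ℝ => ((S.step v)^[k] (S.initState v)).hi) ∧
    Measurable (fun v : Fin m → ℝ => ((S.step v)^[k] (S.initState v)).mu) := by
  induction k with
  | zero =>
    simp only [Function.iterate_zero, id_eq, initState]
    exact ⟨measurable_lower, measurable_upper,
      (measurable_lower.add measurable_upper).div_const 2⟩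
  | succ k ih =>
    simp only [Function.iterate_succ_apply']
    obtain ⟨h1, h2, -⟩ := ih
    have hmid := (h1.add h2).div_const 2
    have hset : MeasurableSet {v : Fin m → ℝ | S.excess v
        ((((S.step v)^[k] (S.initState v)).lo + ((S.step v)^[k] (S.initState v)).hi) / 2) ≤ 0} :=
      measurableSet_le (hS.measurable_excess measurable_id hmid) measurable_const
    unfold step at *
    simp only [apply_ite BisectState.lo, apply_ite BisectState.hi, apply_ite BisectState.mu]
    refine ⟨Measurable.ite hset h1 hmid, Measurable.ite hset hmid h2, Measurable.ite hset hmid hmid⟩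

/-- The number of bisection steps depends on the data, so the output is a countable family of
measurable functions read off at a measurable index. -/
theorem measurable_apply_index {X : Type*} [MeasurableSpace X] {F : ℕ → X → ℝ} {N : X → ℕ}
    (hF : ∀ k, Measurable (F k)) (hN : Measurable N) : Measurable fun x => F (N x) x := by
  have h : Measurable fun q : ℕ × X => F q.1 q.2 := measurable_from_prod_countable_right hF
  exact h.comp (hN.prodMk measurable_id)

theorem Valid.measurable_outMu (hS : S.Valid) (ε : ℝ) :
    Measurable (S.outMu ε : (Fin m → ℝ) → ℝ) :=
  measurable_apply_index (F := fun k v => ((S.step v)^[k] (S.initState v)).mu)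
    (fun k => (hS.measurable_iterate k).2.2) (measurable_iterations ε)

theorem Valid.measurable_outWeight (hS : S.Valid) (ε : ℝ) (i : Fin m) :
    Measurable fun v : Fin m → ℝ => S.outWeight ε v i := by
  have := hS.continuous_argmax.measurable
  have h2 := hS.measurable_outMu (m := m) ε
  unfold outWeight
  simp_rw [weight_eq]
  fun_prop

theorem Valid.measurable_optWeight (hS : S.Valid) (hm : 0 < m) (i : Fin m) :
    Measurable fun v : Fin m → ℝ => S.optWeight v i := by
  have := hS.continuous_argmax.measurable
  have h2 := hS.measurable_muStar hm
  unfold optWeight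
  simp_rw [weight_eq]
  fun_prop

theorem Valid.measurable_dualValue (hS : S.Valid) {X : Type*} [MeasurableSpace X]
    {V : X → Fin m → ℝ} (hV : Measurable V) {μ : X → ℝ} (hμ : Measurable μ) :
    Measurable fun x => S.dualValue (V x) (μ x) := by
  have := hS.continuous_conj.measurable
  unfold dualValue
  fun_prop

end Measurability

end Penalty

/-! ### Comparison of a sample with its halves. -/

section Halves

variable {S : Penalty}

theorem sum_halves {k : ℕ} {M : Type*} [AddCommMonoid M] (F : Fin (2 ^ (k + 1)) → M) :
    ∑ i, F i = ∑ i : Fin (2 ^ k), firstHalf F i + ∑ i : Fin (2 ^ k), secondHalf F i := by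
  have h : 2 ^ k + 2 ^ k = 2 ^ (k + 1) := by ring
  rw [← Equiv.sum_comp (finCongr h) F, Fin.sum_univ_add]
  rfl

/-- Reoptimizing over a part of the data moves all the weights in the same direction. -/
theorem Penalty.Valid.sum_abs_argmax_sub (hS : S.Valid) {m : ℕ} (v : Fin m → ℝ) (a b : ℝ) :
    ∑ i, |S.argmax (v i - a) - S.argmax (v i - b)| =
      |∑ i, (S.argmax (v i - a) - S.argmax (v i - b))| := by
  rcases le_total a b with h | h
  · have h0 : ∀ i, 0 ≤ S.argmax (v i - a) - S.argmax (v i - b) := fun i =>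
      sub_nonneg.2 (hS.argmax_mono (by linarith))
    rw [abs_of_nonneg (Finset.sum_nonneg fun i _ => h0 i)]
    exact Finset.sum_congr rfl fun i _ => abs_of_nonneg (h0 i)
  · have h0 : ∀ i, S.argmax (v i - a) - S.argmax (v i - b) ≤ 0 := fun i =>
      sub_nonpos.2 (hS.argmax_mono (by linarith))
    rw [abs_of_nonpos (Finset.sum_nonpos fun i _ => h0 i), ← Finset.sum_neg_distrib]
    exact Finset.sum_congr rfl fun i _ => abs_of_nonpos (h0 i)

/-- Both weights come from the same data value with two different multipliers, so their differences
share a sign and the sum of absolute values is the absolute value of the sum. The half-sample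
weights have mass 1; halved, this is the mass 2^k / 2^(k+1) that uniform weights put on the half. -/
theorem Penalty.Valid.sum_abs_optWeight_sub (hS : S.Valid) {k : ℕ} (v : Fin (2 ^ (k + 1)) → ℝ)
    (u : Fin (2 ^ k) → ℝ) (e : Fin (2 ^ k) → Fin (2 ^ (k + 1))) (hu : ∀ i, u i = v (e i)) :
    ∑ i, |S.optWeight v (e i) - 1 / 2 * S.optWeight u i| =
      |∑ i, (S.optWeight v (e i) - 1 / 2 ^ (k + 1))| := by
  have hm : 0 < 2 ^ k := by positivity
  have hw : ∀ i, S.optWeight v (e i) - 1 / 2 * S.optWeight u i =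
      1 / 2 ^ (k + 1) * (S.argmax (u i - S.muStar v) - S.argmax (u i - S.muStar u)) := by
    intro i
    unfold Penalty.optWeight
    rw [Penalty.weight_eq, Penalty.weight_eq, hu]
    push_cast
    rw [pow_succ]
    field_simp
  have h1 : ∑ i, |S.optWeight v (e i) - 1 / 2 * S.optWeight u i| =
      |∑ i, (S.optWeight v (e i) - 1 / 2 * S.optWeight u i)| := by
    simp_rw [hw]
    rw [← Finset.mul_sum, abs_mul, ← hS.sum_abs_argmax_sub, Finset.mul_sum]
    refine Finset.sum_congr rfl fun i _ => ?_
    rw [abs_mul]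
  rw [h1]
  congr 1
  rw [Finset.sum_sub_distrib, Finset.sum_sub_distrib, ← Finset.mul_sum, hS.sum_optWeight u hm,
    Finset.sum_const, Finset.card_univ, Fintype.card_fin, nsmul_eq_mul]
  have h2 : ((2 ^ k : ℕ) : ℝ) * (1 / 2 ^ (k + 1)) = 1 / 2 * 1 := by
    push_cast
    rw [pow_succ]
    field_simp
  rw [h2]

end Halves

end

end PhiDRO

set_option linter.unusedSectionVars false

namespace PhiDRO

noncomputable section

/-! ### Averages of independent copies -/

section Averages

variable {Ω : Type*} [MeasurableSpace Ω] {μ : Measure Ω} [IsProbabilityMeasure μ] {p : ℕ}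
  {Y : Ω → EuclideanSpace ℝ (Fin p)}

/-- The average of a function over `n` independent copies. -/
def average (n : ℕ) (Y : Ω → EuclideanSpace ℝ (Fin p)) (ω : Fin n → Ω) :
    EuclideanSpace ℝ (Fin p) := (1 / n : ℝ) • ∑ i, Y (ω i)

theorem memLp_comp_eval {n : ℕ} {F : Type*} [NormedAddCommGroup F] {Y : Ω → F} {q : ℝ≥0∞}
    (hY : MemLp Y q μ) (i : Fin n) :
    MemLp (fun ω : Fin n → Ω => Y (ω i)) q (Measure.pi fun _ => μ) :=
  hY.comp_measurePreserving (measurePreserving_eval (fun _ : Fin n => μ) i)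

theorem memLp_average (n : ℕ) (hY : MemLp Y 2 μ) :
    MemLp (average n Y) 2 (Measure.pi fun _ => μ) :=
  (memLp_finsetSum Finset.univ fun i _ => memLp_comp_eval hY i).const_smul (1 / n : ℝ)

theorem integral_average {n : ℕ} (hn : 1 ≤ n) (hY : Integrable Y μ) :
    ∫ ω, average n Y ω ∂(Measure.pi fun _ => μ) = ∫ x, Y x ∂μ := by
  have hn' : (n : ℝ) ≠ 0 := by exact_mod_cast (by omega : n ≠ 0)
  unfold average
  rw [integral_smul, integral_finsetSum]
  · simp_rw [integral_comp_eval (μ := fun _ : Fin n => μ) hY.aestronglyMeasurable]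
    rw [Finset.sum_const, Finset.card_univ, Fintype.card_fin, ← Nat.cast_smul_eq_nsmul ℝ,
      smul_smul, one_div_mul_cancel hn', one_smul]
  · intro i _
    exact (memLp_one_iff_integrable.1 (memLp_comp_eval (memLp_one_iff_integrable.2 hY) i))

/-- Only Cauchy–Schwarz is used; independence enters in the variance bound. -/
theorem integral_norm_sq_average_le {n : ℕ} (hn : 1 ≤ n) (hY : MemLp Y 2 μ) :
    ∫ ω, ‖average n Y ω‖ ^ 2 ∂(Measure.pi fun _ => μ) ≤ ∫ x, ‖Y x‖ ^ 2 ∂μ := by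
  have hn' : (0 : ℝ) < n := by exact_mod_cast hn
  have hint : ∀ i : Fin n, Integrable (fun ω : Fin n → Ω => ‖Y (ω i)‖ ^ 2)
      (Measure.pi fun _ => μ) := fun i => (memLp_comp_eval hY i).integrable_norm_pow two_ne_zero
  have hle : ∀ ω : Fin n → Ω, ‖average n Y ω‖ ^ 2 ≤ 1 / n * ∑ i, ‖Y (ω i)‖ ^ 2 := by
    intro ω
    unfold average
    rw [norm_smul, mul_pow, Real.norm_eq_abs, sq_abs]
    have h1 : ‖∑ i, Y (ω i)‖ ^ 2 ≤ (∑ i, ‖Y (ω i)‖) ^ 2 := by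
      gcongr
      exact norm_sum_le _ _
    have h2 : (∑ i, ‖Y (ω i)‖) ^ 2 ≤ n * ∑ i, ‖Y (ω i)‖ ^ 2 := by
      simpa using sq_sum_le_card_mul_sum_sq (s := (Finset.univ : Finset (Fin n)))
        (f := fun i => ‖Y (ω i)‖)
    calc (1 / (n : ℝ)) ^ 2 * ‖∑ i, Y (ω i)‖ ^ 2
        ≤ (1 / (n : ℝ)) ^ 2 * (n * ∑ i, ‖Y (ω i)‖ ^ 2) := by gcongr; exact h1.trans h2
      _ = _ := by field_simp
  calc ∫ ω, ‖average n Y ω‖ ^ 2 ∂(Measure.pi fun _ => μ)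
      ≤ ∫ ω, 1 / n * ∑ i : Fin n, ‖Y (ω i)‖ ^ 2 ∂(Measure.pi fun _ => μ) :=
        integral_mono ((memLp_average n hY).integrable_norm_pow two_ne_zero)
          ((integrable_finsetSum _ fun i _ => hint i).const_mul _) hle
    _ = ∫ x, ‖Y x‖ ^ 2 ∂μ := by
        rw [integral_const_mul, integral_finsetSum _ fun i _ => hint i]
        simp_rw [integral_comp_eval (μ := fun _ : Fin n => μ) (f := fun x => ‖Y x‖ ^ 2)
          (hY.integrable_norm_pow two_ne_zero).aestronglyMeasurable]
        rw [Finset.sum_const, Finset.card_univ, Fintype.card_fin, nsmul_eq_mul, ← mul_assoc,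
          one_div_mul_cancel hn'.ne', one_mul]

theorem memLp_coord (hY : MemLp Y 2 μ) (c : Fin p) : MemLp (fun x => Y x c) 2 μ :=
  (EuclideanSpace.proj (𝕜 := ℝ) c : EuclideanSpace ℝ (Fin p) →L[ℝ] ℝ).comp_memLp' hY

theorem integral_coord (hY : Integrable Y μ) (c : Fin p) :
    (∫ x, Y x ∂μ) c = ∫ x, Y x c ∂μ :=
  ((EuclideanSpace.proj (𝕜 := ℝ) c : EuclideanSpace ℝ (Fin p) →L[ℝ] ℝ).integral_comp_comm hY).symm

theorem vecVar_eq_sum (hY : MemLp Y 2 μ) :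
    vecVar Y μ = ∑ c, Var[fun x => Y x c; μ] := by
  have h1 := hY.integrable one_le_two
  unfold vecVar
  simp_rw [EuclideanSpace.norm_sq_eq, Real.norm_eq_abs, sq_abs]
  rw [integral_finsetSum]
  · refine Finset.sum_congr rfl fun c _ => ?_
    rw [variance_eq_integral (memLp_coord hY c).aemeasurable, ← integral_coord h1]
    rfl
  · intro c _
    exact (memLp_coord (hY.sub (memLp_const _)) c).integrable_sq

/-- In each coordinate the variances of independent summands add, which produces the factor 1/n. The
variance of a single copy is then bounded by its second moment. -/
theorem vecVar_average_le {n : ℕ} (hn : 1 ≤ n) (hY : MemLp Y 2 μ) :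
    vecVar (average n Y) (Measure.pi fun _ => μ) ≤ 1 / n * ∫ x, ‖Y x‖ ^ 2 ∂μ := by
  have hn' : (0 : ℝ) < n := by exact_mod_cast hn
  rw [vecVar_eq_sum (memLp_average n hY)]
  have hvar : ∀ c, Var[fun ω => average n Y ω c; Measure.pi fun _ => μ] ≤
      1 / n * ∫ x, (Y x c) ^ 2 ∂μ := by
    intro c
    have hc := (memLp_coord hY c).const_mul (1 / n : ℝ)
    have h1 : (fun ω : Fin n → Ω => average n Y ω c) =
        ∑ i, fun ω : Fin n → Ω => (fun x => (1 / n : ℝ) * Y x c) (ω i) := by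
      funext ω
      simp [average, Finset.mul_sum]
    rw [h1, variance_sum_pi (μ := fun _ : Fin n => μ) (X := fun _ x => (1 / n : ℝ) * Y x c)
      (fun _ => hc)]
    rw [Finset.sum_const, Finset.card_univ, Fintype.card_fin, nsmul_eq_mul, variance_const_mul]
    have h2 := variance_le_expectation_sq (μ := μ) (X := fun x => Y x c)
      (memLp_coord hY c).aestronglyMeasurable
    calc (n : ℝ) * ((1 / n) ^ 2 * Var[fun x => Y x c; μ])
        = 1 / n * Var[fun x => Y x c; μ] := by field_simp
      _ ≤ 1 / n * ∫ x, (Y x c) ^ 2 ∂μ := by gcongr; exact h2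
  refine (Finset.sum_le_sum fun c _ => hvar c).trans (le_of_eq ?_)
  rw [← Finset.mul_sum, ← integral_finsetSum]
  · simp_rw [EuclideanSpace.norm_sq_eq, Real.norm_eq_abs, sq_abs]
  · intro c _
    exact (memLp_coord hY c).integrable_sq

end Averages

theorem integral_comp_measurePreserving {X Y F : Type*} [MeasurableSpace X] [MeasurableSpace Y]
    [NormedAddCommGroup F] [NormedSpace ℝ F] {μ : Measure X} {ν : Measure Y} {T : X → Y}
    (hT : MeasurePreserving T μ ν) {f : Y → F} (hf : AEStronglyMeasurable f ν) :
    ∫ x, f (T x) ∂μ = ∫ y, f y ∂ν := by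
  rw [← hT.map_eq] at hf ⊢
  exact (integral_map hT.measurable.aemeasurable hf).symm

/-! ### Sampling laws -/

/-- Selecting distinct coordinates of i.i.d. samples gives i.i.d. samples. -/
theorem measurePreserving_comp_injective {X : Type*} [MeasurableSpace X] (ν : Measure X)
    [IsProbabilityMeasure ν] {k m : ℕ} {e : Fin k → Fin m} (he : Function.Injective e) :
    MeasurePreserving (fun w : Fin m → X => fun i => w (e i)) (Measure.pi fun _ => ν)
      (Measure.pi fun _ => ν) := by
  classical
  refine ⟨by fun_prop, (Measure.pi_eq fun s hs => ?_).symm⟩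
  rw [Measure.map_apply (by fun_prop) (MeasurableSet.univ_pi hs)]
  -- The preimage of a box is a box: side j is `s i` if j = e i, and the whole space if j is not in
  -- the range of e.
  have hpre : (fun w : Fin m → X => fun i => w (e i)) ⁻¹' (univ.pi s) =
      univ.pi fun j => ⋂ (i : Fin k) (_ : e i = j), s i := by
    ext w
    simp only [mem_preimage, mem_univ_pi, mem_iInter]
    exact ⟨fun h j i hij => hij ▸ h i, fun h i => h (e i) i rfl⟩
  rw [hpre, Measure.pi_pi, ← Finset.prod_subset (Finset.subset_univ (Finset.univ.image e)),
    Finset.prod_image fun a _ b _ h => he h]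
  · refine Finset.prod_congr rfl fun i _ => ?_
    congr 1
    ext x
    simp only [mem_iInter]
    exact ⟨fun h => h i rfl, fun h j hj => he hj ▸ h⟩
  · intro j _ hj
    have : (⋂ (i : Fin k) (_ : e i = j), s i) = univ := by
      refine eq_univ_of_forall fun x => ?_
      simp only [mem_iInter]
      intro i hi
      exact absurd (Finset.mem_image.2 ⟨i, Finset.mem_univ i, hi⟩) hj
    rw [this, measure_univ]

section Laws

variable {E : Type*} [NormedAddCommGroup E] [NormedSpace ℝ E] [FiniteDimensional ℝ E]
  [MeasureSpace E] [BorelSpace E] [(volume : Measure E).IsAddHaarMeasure] {ρ : ℝ}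

theorem isProbabilityMeasure_unifBall (hρ : 0 < ρ) (z : E) :
    IsProbabilityMeasure (unifBall ρ z) := by
  refine cond_isProbabilityMeasure_of_finite ?_ ?_
  · exact (Metric.measure_closedBall_pos volume z hρ).ne'
  · exact measure_closedBall_lt_top.ne

theorem ae_unifBall_mem (z : E) : ∀ᵐ x ∂(unifBall ρ z), x ∈ Metric.closedBall z ρ :=
  ae_cond_mem Metric.isClosed_closedBall.measurableSet

theorem sampleKernel_apply (m : ℕ) (z : E) :
    sampleKernel E ρ m z = Measure.pi fun _ => unifBall ρ z := rfl

theorem isMarkovKernel_sampleKernel (hρ : 0 < ρ) (m : ℕ) : IsMarkovKernel (sampleKernel E ρ m) :=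
  ⟨fun z => by
    have := isProbabilityMeasure_unifBall hρ z
    rw [sampleKernel_apply]
    infer_instance⟩

/-- The joint law of `z ∼ P` and of `m` i.i.d. samples from `ν_z`. -/
def jointLaw (P : Measure E) (ρ : ℝ) (m : ℕ) : Measure (E × (Fin m → E)) :=
  P ⊗ₘ sampleKernel E ρ m

variable {P : Measure E} [IsProbabilityMeasure P]

theorem isProbabilityMeasure_jointLaw (hρ : 0 < ρ) (m : ℕ) :
    IsProbabilityMeasure (jointLaw P ρ m) := by
  have := isMarkovKernel_sampleKernel (E := E) hρ m
  unfold jointLaw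
  infer_instance

/-- Given z the samples are i.i.d. A permutation e gives exchangeability, a half gives the law of
the preceding level, and a single index gives the law of one sample. -/
theorem measurePreserving_jointLaw (hρ : 0 < ρ) {k m : ℕ} {e : Fin k → Fin m}
    (he : Function.Injective e) :
    MeasurePreserving (fun ζ : E × (Fin m → E) => (ζ.1, fun i => ζ.2 (e i)))
      (jointLaw P ρ m) (jointLaw P ρ k) := by
  have := isMarkovKernel_sampleKernel (E := E) hρ m
  have := isMarkovKernel_sampleKernel (E := E) hρ k
  have hmeas : Measurable (fun ζ : E × (Fin m → E) => (ζ.1, fun i => ζ.2 (e i))) := by fun_prop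
  refine ⟨hmeas, ?_⟩
  unfold jointLaw
  ext s hs
  rw [Measure.map_apply hmeas hs, Measure.compProd_apply (hmeas hs), Measure.compProd_apply hs]
  refine lintegral_congr fun z => ?_
  have := isProbabilityMeasure_unifBall hρ z
  rw [sampleKernel_apply, sampleKernel_apply,
    ← (measurePreserving_comp_injective (unifBall ρ z) he).measure_preimage
      (measurable_prodMk_left hs).nullMeasurableSet]
  rfl

theorem ae_mem_support (P : Measure E) : ∀ᵐ z ∂P, z ∈ P.support := Measure.support_mem_ae

theorem ae_jointLaw (hρ : 0 < ρ) (m : ℕ) :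
    ∀ᵐ ζ ∂(jointLaw P ρ m), ζ.1 ∈ P.support ∧ ∀ i, ζ.2 i ∈ Metric.closedBall ζ.1 ρ := by
  have := isMarkovKernel_sampleKernel (E := E) hρ m
  unfold jointLaw
  rw [Measure.ae_compProd_iff]
  · filter_upwards [ae_mem_support P] with z hz
    have := isProbabilityMeasure_unifBall hρ z
    rw [sampleKernel_apply]
    have : ∀ᵐ w ∂(Measure.pi fun _ : Fin m => unifBall ρ z),
        ∀ i, w i ∈ Metric.closedBall z ρ := by
      rw [ae_all_iff]
      intro i
      exact (measurePreserving_eval (fun _ : Fin m => unifBall ρ z) i).quasiMeasurePreserving.ae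
        (ae_unifBall_mem z)
    filter_upwards [this] with w hw using ⟨hz, hw⟩
  · refine ((Measure.isClosed_support (μ := P)).measurableSet.preimage measurable_fst).inter ?_
    have : {ζ : E × (Fin m → E) | ∀ i, ζ.2 i ∈ Metric.closedBall ζ.1 ρ} =
        ⋂ i, {ζ | dist (ζ.2 i) ζ.1 ≤ ρ} := by
      ext ζ; simp
    change MeasurableSet {ζ : E × (Fin m → E) | ∀ i, ζ.2 i ∈ Metric.closedBall ζ.1 ρ}
    rw [this]
    exact MeasurableSet.iInter fun i => measurableSet_le (by fun_prop) measurable_const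

theorem ae_jointLaw_attackSet (hρ : 0 < ρ) (m : ℕ) :
    ∀ᵐ ζ ∂(jointLaw P ρ m), ∀ i, ζ.2 i ∈ attackSet P ρ := by
  filter_upwards [ae_jointLaw hρ m] with ζ hζ i using ⟨ζ.1, hζ.1, hζ.2 i⟩

theorem firstHalf_injective (k : ℕ) :
    Function.Injective (firstHalf (fun j : Fin (2 ^ (k + 1)) => j)) := by
  intro a b h
  simp only [firstHalf, Fin.mk.injEq] at h
  exact Fin.ext h

theorem secondHalf_injective (k : ℕ) :
    Function.Injective (secondHalf (fun j : Fin (2 ^ (k + 1)) => j)) := by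
  intro a b h
  simp only [secondHalf, Fin.mk.injEq] at h
  exact Fin.ext (by omega)

/-! ### Random levels -/

theorem two_sub_pow_pos (L : ℕ) : (0 : ℝ) < 2 - (2 : ℝ)⁻¹ ^ L := by
  have : (2 : ℝ)⁻¹ ^ L ≤ 1 := pow_le_one₀ (by norm_num) (by norm_num)
  linarith

theorem levelProb_pos (L l : ℕ) : 0 < levelProb L l :=
  div_pos (by positivity) (two_sub_pow_pos L)

theorem sum_levelProb (L : ℕ) : ∑ l : Fin (L + 1), levelProb L l = 1 := by
  unfold levelProb
  rw [← Finset.sum_div, div_eq_one_iff_eq (two_sub_pow_pos L).ne',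
    Fin.sum_univ_eq_sum_range (fun l => (2 : ℝ)⁻¹ ^ l), geom_sum_eq (by norm_num)]
  rw [pow_succ]
  ring

theorem measurable_sigmaMk' {ι : Type*} {X : ι → Type*} [∀ i, MeasurableSpace (X i)] (i : ι) :
    Measurable (Sigma.mk i : X i → Sigma X) := by
  intro s hs
  exact (MeasurableSpace.measurableSet_iInf.1 hs) i

theorem measurable_sigma {ι Y : Type*} {X : ι → Type*} [∀ i, MeasurableSpace (X i)]
    [MeasurableSpace Y] {F : Sigma X → Y} (hF : ∀ i, Measurable fun x => F ⟨i, x⟩) :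
    Measurable F := by
  intro s hs
  exact MeasurableSpace.measurableSet_iInf.2 fun i => hF i hs

theorem isProbabilityMeasure_levelLaw (hρ : 0 < ρ) (L : ℕ) :
    IsProbabilityMeasure (levelLaw P ρ L) := by
  constructor
  have h : ∀ l : Fin (L + 1), (ENNReal.ofReal (levelProb L l) • (sampleLaw P ρ l).map
      (fun ζ => (⟨l, ζ⟩ : (l : Fin (L + 1)) × (E × (Fin (2 ^ (l : ℕ)) → E))))) univ =
      ENNReal.ofReal (levelProb L l) := by
    intro l
    have := isProbabilityMeasure_jointLaw (P := P) hρ (2 ^ (l : ℕ))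
    change IsProbabilityMeasure (sampleLaw P ρ l) at this
    have hmk : Measurable (fun ζ : E × (Fin (2 ^ (l : ℕ)) → E) =>
        (⟨l, ζ⟩ : (l : Fin (L + 1)) × (E × (Fin (2 ^ (l : ℕ)) → E)))) := measurable_sigmaMk' l
    rw [Measure.smul_apply, Measure.map_apply hmk MeasurableSet.univ,
      preimage_univ, measure_univ, smul_eq_mul, mul_one]
  unfold levelLaw
  rw [Measure.finsetSum_apply]
  simp_rw [h]
  rw [← ENNReal.ofReal_sum_of_nonneg (f := fun l : Fin (L + 1) => levelProb L l)
    fun l _ => (levelProb_pos L l).le, sum_levelProb, ENNReal.ofReal_one]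

/-- The law is a finite mixture of the level laws, each carried by its own summand of the sigma
type. -/
theorem integral_levelLaw {F : Type*} [NormedAddCommGroup F] [NormedSpace ℝ F] {L : ℕ}
    {Y : ((l : Fin (L + 1)) × (E × (Fin (2 ^ (l : ℕ)) → E))) → F} (hY : StronglyMeasurable Y)
    (hint : ∀ l : Fin (L + 1), Integrable (fun ζ => Y ⟨l, ζ⟩) (sampleLaw P ρ l)) :
    Integrable Y (levelLaw P ρ L) ∧
      ∫ x, Y x ∂(levelLaw P ρ L) =
        ∑ l : Fin (L + 1), levelProb L l • ∫ ζ, Y ⟨l, ζ⟩ ∂(sampleLaw P ρ l) := by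
  have hm : ∀ l : Fin (L + 1), Integrable Y (ENNReal.ofReal (levelProb L l) •
      (sampleLaw P ρ l).map (fun ζ => ⟨l, ζ⟩)) := by
    intro l
    refine Integrable.smul_measure ?_ ENNReal.ofReal_ne_top
    exact (integrable_map_measure hY.aestronglyMeasurable
      (measurable_sigmaMk' l).aemeasurable).2 (hint l)
  unfold levelLaw
  refine ⟨integrable_finsetSum_measure.2 fun l _ => hm l, ?_⟩
  rw [integral_finsetSum_measure fun l _ => hm l]
  refine Finset.sum_congr rfl fun l _ => ?_
  rw [integral_smul_measure, ENNReal.toReal_ofReal (levelProb_pos L l).le,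
    integral_map (measurable_sigmaMk' l).aemeasurable hY.aestronglyMeasurable]

end Laws

end

end PhiDRO

set_option linter.unusedSectionVars false

namespace PhiDRO

noncomputable section

/-! ### Second moments of the gradient estimators -/

section GradientEstimators

variable {E : Type*} {p : ℕ} {S : Penalty} {ε : ℝ} {h : E → ℝ}
  {g : E → EuclideanSpace ℝ (Fin p)}

theorem norm_gradEst_le (hS : S.Valid) (hε : 0 < ε) {m : ℕ} (hm : 0 < m) {M : ℝ} (hM : 0 ≤ M)
    {w : Fin m → E} (hw : ∀ i, ‖g (w i)‖ ≤ M) :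
    ‖gradEst S ε h g w‖ ≤ M * (1 + S.weightErr ε) := by
  have h1 := hS.sum_outWeight_le (fun j => h (w j)) hm hε
  calc ‖gradEst S ε h g w‖ ≤ ∑ i, ‖S.outWeight ε (fun j => h (w j)) i • g (w i)‖ :=
        norm_sum_le _ _
    _ ≤ ∑ i, S.outWeight ε (fun j => h (w j)) i * M := by
        refine Finset.sum_le_sum fun i _ => ?_
        rw [norm_smul, Real.norm_eq_abs, abs_of_nonneg (hS.outWeight_nonneg _ _ _)]
        exact mul_le_mul_of_nonneg_left (hw i) (hS.outWeight_nonneg _ _ _)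
    _ = M * ∑ i, S.outWeight ε (fun j => h (w j)) i := by rw [← Finset.sum_mul, mul_comm]
    _ ≤ _ := by gcongr

/-- The exact weights are inserted on both sides. The solver error of the full sample is kept as a
sum over this half, so that the two halves together use up a single `weightErr`. -/
theorem sum_abs_half_le (hS : S.Valid) (hε : 0 < ε) {k : ℕ} (v : Fin (2 ^ (k + 1)) → ℝ)
    (u : Fin (2 ^ k) → ℝ) (e : Fin (2 ^ k) → Fin (2 ^ (k + 1))) (hu : ∀ i, u i = v (e i)) :
    ∑ i, |S.outWeight ε v (e i) - 1 / 2 * S.outWeight ε u i| ≤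
      ∑ i, |S.outWeight ε v (e i) - S.optWeight v (e i)| +
        |∑ i, (S.optWeight v (e i) - 1 / 2 ^ (k + 1))| + 1 / 2 * S.weightErr ε := by
  have hm : 0 < 2 ^ k := by positivity
  have h1 := hS.sum_abs_outWeight_sub_le u hm hε
  rw [← hS.sum_abs_optWeight_sub v u e hu]
  calc ∑ i, |S.outWeight ε v (e i) - 1 / 2 * S.outWeight ε u i|
      ≤ ∑ i, (|S.outWeight ε v (e i) - S.optWeight v (e i)| +
          |S.optWeight v (e i) - 1 / 2 * S.optWeight u i| +
          1 / 2 * |S.outWeight ε u i - S.optWeight u i|) := by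
        refine Finset.sum_le_sum fun i _ => ?_
        have h3 : (1 / 2 : ℝ) * |S.outWeight ε u i - S.optWeight u i| =
            |1 / 2 * S.optWeight u i - 1 / 2 * S.outWeight ε u i| := by
          rw [← mul_sub, abs_mul, abs_sub_comm, abs_of_pos (by norm_num : (0 : ℝ) < 1 / 2)]
        rw [h3]
        refine le_trans (le_of_eq ?_) (abs_add_three _ _ _)
        congr 1
        ring
    _ ≤ _ := by
        rw [Finset.sum_add_distrib, Finset.sum_add_distrib, ← Finset.mul_sum]
        gcongr

/-- Each half contributes the same reoptimization term. The solver errors are δ for the full sample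
and δ/2 for each of the two halves, in total 2δ. -/
theorem norm_levelDiff_succ_le (hS : S.Valid) (hε : 0 < ε) {M : ℝ} (hM : 0 ≤ M) {k : ℕ}
    {w : Fin (2 ^ (k + 1)) → E} (hw : ∀ i, ‖g (w i)‖ ≤ M) :
    ‖levelDiff S ε h g (k + 1) w‖ ≤ M * (2 * |∑ i : Fin (2 ^ k), firstHalf
      (fun j => S.optWeight (fun j => h (w j)) j - 1 / 2 ^ (k + 1)) i| + 2 * S.weightErr ε) := by
  have hm : 0 < 2 ^ (k + 1) := by positivity
  set v : Fin (2 ^ (k + 1)) → ℝ := fun j => h (w j) with hv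
  set x : Fin (2 ^ (k + 1)) → ℝ := fun j => S.optWeight v j - 1 / 2 ^ (k + 1) with hx
  set e₁ : Fin (2 ^ k) → Fin (2 ^ (k + 1)) := firstHalf (fun j => j) with he₁
  set e₂ : Fin (2 ^ k) → Fin (2 ^ (k + 1)) := secondHalf (fun j => j) with he₂
  set d : Fin (2 ^ k) → ℝ := fun i => S.outWeight ε v (e₁ i) -
    1 / 2 * S.outWeight ε (fun i => v (e₁ i)) i with hd
  set d' : Fin (2 ^ k) → ℝ := fun i => S.outWeight ε v (e₂ i) -
    1 / 2 * S.outWeight ε (fun i => v (e₂ i)) i with hd'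
  have hsplit : levelDiff S ε h g (k + 1) w =
      ∑ i, d i • g (w (e₁ i)) + ∑ i, d' i • g (w (e₂ i)) := by
    have h0 : levelDiff S ε h g (k + 1) w = gradEst S ε h g w -
      (1 / 2 : ℝ) • (gradEst S ε h g (firstHalf w) + gradEst S ε h g (secondHalf w)) := rfl
    have h1 : gradEst S ε h g w = ∑ i, S.outWeight ε v (e₁ i) • g (w (e₁ i)) +
        ∑ i, S.outWeight ε v (e₂ i) • g (w (e₂ i)) := by
      unfold gradEst
      rw [sum_halves]
      rfl
    have h2 : gradEst S ε h g (firstHalf w) =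
        ∑ i, S.outWeight ε (fun i => v (e₁ i)) i • g (w (e₁ i)) := rfl
    have h3 : gradEst S ε h g (secondHalf w) =
        ∑ i, S.outWeight ε (fun i => v (e₂ i)) i • g (w (e₂ i)) := rfl
    rw [h0, h1, h2, h3]
    simp only [hd, hd', sub_smul, mul_smul, Finset.sum_sub_distrib, ← Finset.smul_sum, smul_add]
    abel
  have hnorm : ∀ (c : Fin (2 ^ k) → ℝ) (e : Fin (2 ^ k) → Fin (2 ^ (k + 1))),
      ‖∑ i, c i • g (w (e i))‖ ≤ M * ∑ i, |c i| := by
    intro c e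
    refine (norm_sum_le _ _).trans ?_
    rw [Finset.mul_sum]
    refine Finset.sum_le_sum fun i _ => ?_
    rw [norm_smul, Real.norm_eq_abs, mul_comm]
    exact mul_le_mul_of_nonneg_right (hw _) (abs_nonneg _)
  have hb1 := sum_abs_half_le hS hε v (fun i => v (e₁ i)) e₁ (fun _ => rfl)
  have hb2 := sum_abs_half_le hS hε v (fun i => v (e₂ i)) e₂ (fun _ => rfl)
  have htot := hS.sum_abs_outWeight_sub_le v hm hε
  rw [sum_halves] at htot
  have hsum0 : ∑ i, x i = 0 := by
    rw [hx, Finset.sum_sub_distrib, hS.sum_optWeight v hm, Finset.sum_const, Finset.card_univ,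
      Fintype.card_fin, nsmul_eq_mul]
    push_cast
    rw [mul_one_div_cancel (by positivity), sub_self]
  rw [sum_halves] at hsum0
  -- The centred weights sum to zero, so the sums over the two halves are opposite.
  have h12 : |∑ i, (S.optWeight v (e₂ i) - 1 / 2 ^ (k + 1))| =
      |∑ i, (S.optWeight v (e₁ i) - 1 / 2 ^ (k + 1))| := by
    rw [← abs_neg]
    congr 1
    change -∑ i : Fin (2 ^ k), secondHalf x i = ∑ i : Fin (2 ^ k), firstHalf x i
    linarith
  rw [h12] at hb2
  change _ ≤ M * (2 * |∑ i, (S.optWeight v (e₁ i) - 1 / 2 ^ (k + 1))| + 2 * S.weightErr ε)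
  change ∑ i, |S.outWeight ε v (e₁ i) - S.optWeight v (e₁ i)| +
    ∑ i, |S.outWeight ε v (e₂ i) - S.optWeight v (e₂ i)| ≤ S.weightErr ε at htot
  rw [hsplit]
  calc ‖∑ i, d i • g (w (e₁ i)) + ∑ i, d' i • g (w (e₂ i))‖
      ≤ M * ∑ i, |d i| + M * ∑ i, |d' i| :=
        (norm_add_le _ _).trans (add_le_add (hnorm d e₁) (hnorm d' e₂))
    _ = M * (∑ i, |d i| + ∑ i, |d' i|) := by ring
    _ ≤ _ := by
        refine mul_le_mul_of_nonneg_left ?_ hM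
        linarith

variable [MeasurableSpace E]

theorem measurable_gradEst (hS : S.Valid) (hh : Measurable h) (hg : Measurable g) (m : ℕ) :
    Measurable (gradEst S ε h g : (Fin m → E) → EuclideanSpace ℝ (Fin p)) := by
  unfold gradEst
  refine Finset.measurable_sum _ fun i _ => ?_
  have h1 : Measurable fun w : Fin m → E => g (w i) := hg.comp (measurable_pi_apply i)
  have h2 : Measurable fun w : Fin m → E => S.outWeight ε (fun j => h (w j)) i :=
    (hS.measurable_outWeight ε i).comp
      (measurable_pi_lambda _ fun j => hh.comp (measurable_pi_apply j))
  exact h2.smul h1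

theorem measurable_levelDiff (hS : S.Valid) (hh : Measurable h) (hg : Measurable g) (l : ℕ) :
    Measurable (levelDiff S ε h g l) := by
  cases l with
  | zero => exact measurable_gradEst hS hh hg _
  | succ k =>
    have h1 : Measurable (fun w : Fin (2 ^ (k + 1)) → E => (firstHalf w : Fin (2 ^ k) → E)) :=
      measurable_pi_lambda _ fun i => measurable_pi_apply _
    have h2 : Measurable (fun w : Fin (2 ^ (k + 1)) → E => (secondHalf w : Fin (2 ^ k) → E)) :=
      measurable_pi_lambda _ fun i => measurable_pi_apply _
    exact (measurable_gradEst hS hh hg _).sub ((((measurable_gradEst hS hh hg _).comp h1).add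
      ((measurable_gradEst hS hh hg _).comp h2)).const_smul (1 / 2 : ℝ))

end GradientEstimators

/-! ### Second moments of multilevel differences and telescoping of their means. -/

section Moments

variable {E : Type*} [NormedAddCommGroup E] [NormedSpace ℝ E] [FiniteDimensional ℝ E]
  [MeasureSpace E] [BorelSpace E] [(volume : Measure E).IsAddHaarMeasure] {ρ : ℝ}
  {P : Measure E} [IsProbabilityMeasure P]
  {p : ℕ} {S : Penalty} {ε : ℝ} {h : E → ℝ} {g : E → EuclideanSpace ℝ (Fin p)} {M C : ℝ}

/-- The sum of exchangeable, centred weights over one half of the data has a variance of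
order `1 / m`. -/
theorem integral_sq_sum_half_le (hS : S.Valid) (hρ : 0 < ρ) (hh : Measurable h) (k : ℕ)
    (hC : ∀ z ∈ P.support, ∀ w : Fin (2 ^ (k + 1)) → E, (∀ i, w i ∈ Metric.closedBall z ρ) →
      chiSq (S.optWeight fun j => h (w j)) ≤ C) :
    ∫ ζ, (∑ i : Fin (2 ^ k), firstHalf (fun j => S.optWeight (fun j => h (ζ.2 j)) j -
      1 / 2 ^ (k + 1)) i) ^ 2 ∂(jointLaw P ρ (2 ^ (k + 1))) ≤
      C / (4 * (2 ^ (k + 1) - 1)) := by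
  classical
  have hm : 0 < 2 ^ (k + 1) := by positivity
  set m := 2 ^ (k + 1) with hmdef
  have := isProbabilityMeasure_jointLaw (P := P) hρ m
  set X : Fin m → E × (Fin m → E) → ℝ := fun j ζ =>
    S.optWeight (fun j => h (ζ.2 j)) j - 1 / 2 ^ (k + 1) with hX
  have hXm : ∀ j, Measurable (X j) := by
    intro j
    exact ((hS.measurable_optWeight hm j).comp (by fun_prop)).sub_const _
  have hXb : ∀ j ζ, |X j ζ| ≤ 1 := by
    intro j ζ
    have h0 := hS.weight_nonneg (fun j => h (ζ.2 j)) (S.muStar fun j => h (ζ.2 j)) j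
    change 0 ≤ S.optWeight (fun j => h (ζ.2 j)) j at h0
    have h1 := hS.optWeight_le_one (fun j => h (ζ.2 j)) hm j
    have h2 : (0 : ℝ) ≤ 1 / 2 ^ (k + 1) := by positivity
    have h3 : (1 : ℝ) / 2 ^ (k + 1) ≤ 1 := by
      rw [div_le_one (by positivity)]; exact one_le_pow₀ one_le_two
    rw [abs_le]
    constructor <;> simp only [hX] <;> linarith
  have hint : ∀ i j, Integrable (fun ζ => X i ζ * X j ζ) (jointLaw P ρ m) := by
    intro i j
    refine Integrable.of_bound ((hXm i).mul (hXm j)).aestronglyMeasurable 1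
      (Eventually.of_forall fun ζ => ?_)
    rw [norm_mul, Real.norm_eq_abs, Real.norm_eq_abs]
    exact mul_le_one₀ (hXb i ζ) (abs_nonneg _) (hXb j ζ)
  have hsum0 : ∀ ζ, ∑ j, X j ζ = 0 := by
    intro ζ
    simp only [hX]
    rw [Finset.sum_sub_distrib, hS.sum_optWeight _ hm, Finset.sum_const, Finset.card_univ,
      Fintype.card_fin, nsmul_eq_mul, hmdef]
    push_cast
    rw [mul_one_div_cancel (by positivity), sub_self]
  -- The second-moment matrix of the centred weights; by exchangeability it is invariant under
  -- simultaneous permutation of rows and columns.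
  set c : Fin m → Fin m → ℝ := fun i j => ∫ ζ, X i ζ * X j ζ ∂(jointLaw P ρ m) with hc
  have hperm : ∀ (σ : Equiv.Perm (Fin m)) i j, c (σ i) (σ j) = c i j := by
    intro σ i j
    have hmp := measurePreserving_jointLaw (P := P) hρ σ.injective
    have hcomp := integral_comp_measurePreserving hmp (hint i j).aestronglyMeasurable
    simp only [hc]
    rw [← hcomp]
    refine integral_congr_ae (Eventually.of_forall fun ζ => ?_)
    simp only [hX]
    have h1 := Penalty.optWeight_comp_perm (S := S) (fun j => h (ζ.2 j)) σ i
    have h2 := Penalty.optWeight_comp_perm (S := S) (fun j => h (ζ.2 j)) σ j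
    rw [← h1, ← h2]
    rfl
  -- Row i sums to zero and its m - 1 off-diagonal entries coincide.
  have hoff : ∀ i j, i ≠ j → ((m : ℝ) - 1) * c i j = -c i i := by
    intro i j hij
    have hconst : ∀ j' ∈ Finset.univ.erase i, c i j' = c i j := by
      intro j' hj'
      have h1 := hperm (Equiv.swap j j') i j
      rwa [Equiv.swap_apply_left, Equiv.swap_apply_of_ne_of_ne hij (Finset.ne_of_mem_erase hj').symm]
        at h1
    have hz : ∑ j', c i j' = 0 := by
      simp only [hc]
      rw [← integral_finsetSum _ fun j _ => hint i j]
      simp_rw [← Finset.mul_sum, hsum0, mul_zero, integral_zero]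
    rw [← Finset.add_sum_erase _ _ (Finset.mem_univ i), Finset.sum_congr rfl hconst,
      Finset.sum_const, Finset.card_erase_of_mem (Finset.mem_univ i), Finset.card_univ,
      Fintype.card_fin, nsmul_eq_mul, Nat.cast_sub (by omega : 1 ≤ m)] at hz
    push_cast at hz
    linarith
  set e₁ : Fin (2 ^ k) → Fin m := firstHalf (fun j => j) with he₁
  set e₂ : Fin (2 ^ k) → Fin m := secondHalf (fun j => j) with he₂
  have hne : ∀ i j, e₁ i ≠ e₂ j := by
    intro i j hij
    have : (i : ℕ) = 2 ^ k + j := congrArg Fin.val hij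
    have := i.2
    omega
  have hm1 : (0 : ℝ) < (m : ℝ) - 1 := by
    have : 2 ≤ m := by
      rw [hmdef, pow_succ]
      have : 0 < 2 ^ k := by positivity
      omega
    have : (2 : ℝ) ≤ m := by exact_mod_cast this
    linarith
  have hAB : ∀ ζ, ∑ i, X (e₁ i) ζ = -∑ i, X (e₂ i) ζ := by
    intro ζ
    have := hsum0 ζ
    rw [sum_halves] at this
    change ∑ i, X (e₁ i) ζ + ∑ i, X (e₂ i) ζ = 0 at this
    linarith
  -- As the two half sums are opposite, A² is minus their product, and only off-diagonal entries
  -- occur.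
  have hval : ∫ ζ, (∑ i, X (e₁ i) ζ) ^ 2 ∂(jointLaw P ρ m) = -∑ i, ∑ j, c (e₁ i) (e₂ j) := by
    simp only [hc]
    have h1 : ∀ i, ∑ j, ∫ ζ, X (e₁ i) ζ * X (e₂ j) ζ ∂(jointLaw P ρ m) =
        ∫ ζ, ∑ j, X (e₁ i) ζ * X (e₂ j) ζ ∂(jointLaw P ρ m) := fun i =>
      (integral_finsetSum _ fun j _ => hint _ _).symm
    simp_rw [h1]
    rw [← integral_finsetSum _ fun i _ => integrable_finsetSum _ fun j _ => hint (e₁ i) (e₂ j),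
      ← integral_neg]
    refine integral_congr_ae (Eventually.of_forall fun ζ => ?_)
    change (∑ i, X (e₁ i) ζ) ^ 2 = -∑ i, ∑ j, X (e₁ i) ζ * X (e₂ j) ζ
    rw [← Finset.sum_mul_sum, pow_two]
    nth_rewrite 2 [hAB ζ]
    ring
  have hA1 : ((m : ℝ) - 1) * ∫ ζ, (∑ i, X (e₁ i) ζ) ^ 2 ∂(jointLaw P ρ m) =
      2 ^ k * ∑ i, c (e₁ i) (e₁ i) := by
    rw [hval, mul_neg, Finset.mul_sum]
    simp_rw [Finset.mul_sum, hoff _ _ (hne _ _)]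
    simp
  -- The same quantity expressed through the diagonal of the other half; averaging both forms
  -- produces the full trace, which the χ² bound controls.
  have hA2 : ((m : ℝ) - 1) * ∫ ζ, (∑ i, X (e₁ i) ζ) ^ 2 ∂(jointLaw P ρ m) =
      2 ^ k * ∑ i, c (e₂ i) (e₂ i) := by
    have hsymm : ∀ i j, c i j = c j i := fun i j => by simp only [hc, mul_comm]
    rw [hval, Finset.sum_comm, mul_neg, Finset.mul_sum]
    simp_rw [Finset.mul_sum, hsymm (e₁ _), hoff _ _ (hne _ _).symm]
    simp
  have hdiag : ∑ i, c (e₁ i) (e₁ i) + ∑ i, c (e₂ i) (e₂ i) = ∑ i, c i i :=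
    (sum_halves fun i => c i i).symm
  have hchi : (m : ℝ) * ∑ i, c i i ≤ C := by
    simp only [hc]
    rw [← integral_finsetSum _ fun i _ => hint i i, ← integral_const_mul]
    have hCint : ∫ _ζ, C ∂(jointLaw P ρ m) = C := by simp
    rw [← hCint]
    refine integral_mono_ae ((integrable_finsetSum _ fun i _ => hint i i).const_mul _)
      (integrable_const _) ?_
    filter_upwards [ae_jointLaw (P := P) hρ m] with ζ hζ
    refine le_trans (le_of_eq ?_) (hC ζ.1 hζ.1 ζ.2 hζ.2)
    unfold chiSq
    rw [Finset.mul_sum]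
    refine Finset.sum_congr rfl fun i _ => ?_
    simp only [hX, hmdef]
    push_cast
    field_simp
  have hkm : (2 : ℝ) ^ k * 2 = m := by rw [hmdef]; push_cast; rw [pow_succ]
  change ∫ ζ, (∑ i, X (e₁ i) ζ) ^ 2 ∂(jointLaw P ρ m) ≤ _
  have hmc : (2 : ℝ) ^ (k + 1) = m := by rw [hmdef]; push_cast; rfl
  rw [hmc, le_div_iff₀ (by linarith)]
  have h5 : (2 : ℝ) ^ k * ∑ i, c (e₁ i) (e₁ i) + 2 ^ k * ∑ i, c (e₂ i) (e₂ i) =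
      2 ^ k * ∑ i, c i i := by rw [← mul_add, hdiag]
  have h6 : (2 : ℝ) ^ k * 2 * ∑ i, c i i = m * ∑ i, c i i := by rw [hkm]
  linarith

variable (hg : ∀ x ∈ attackSet P ρ, ‖g x‖ ≤ M)
include hg

theorem ae_norm_gradEst_le (hS : S.Valid) (hε : 0 < ε) (hρ : 0 < ρ) (hM : 0 ≤ M) {m : ℕ}
    (hm : 0 < m) :
    ∀ᵐ ζ ∂(jointLaw P ρ m), ‖gradEst S ε h g ζ.2‖ ≤ M * (1 + S.weightErr ε) := by
  filter_upwards [ae_jointLaw_attackSet hρ m] with ζ hζ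
  exact norm_gradEst_le hS hε hm hM fun i => hg _ (hζ i)

theorem memLp_gradEst (hS : S.Valid) (hε : 0 < ε) (hρ : 0 < ρ) (hM : 0 ≤ M) (hh : Measurable h)
    (hgm : Measurable g) {m : ℕ} (hm : 0 < m) :
    MemLp (fun ζ : E × (Fin m → E) => gradEst S ε h g ζ.2) 2 (jointLaw P ρ m) := by
  have := isProbabilityMeasure_jointLaw (P := P) hρ m
  exact MemLp.of_bound
    ((measurable_gradEst hS hh hgm m).comp measurable_snd).aestronglyMeasurable _
    (ae_norm_gradEst_le hg hS hε hρ hM hm)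

theorem integral_norm_sq_gradEst_le (hS : S.Valid) (hε : 0 < ε) (hρ : 0 < ρ) (hM : 0 ≤ M)
    {m : ℕ} (hm : 0 < m) :
    ∫ ζ, ‖gradEst S ε h g ζ.2‖ ^ 2 ∂(jointLaw P ρ m) ≤ (M * (1 + S.weightErr ε)) ^ 2 := by
  have := isProbabilityMeasure_jointLaw (P := P) hρ m
  refine (integral_mono_of_nonneg (Eventually.of_forall fun ζ => sq_nonneg _)
    (integrable_const ((M * (1 + S.weightErr ε)) ^ 2)) ?_).trans (by simp)
  filter_upwards [ae_norm_gradEst_le (h := h) hg hS hε hρ hM hm] with ζ hζ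
  gcongr

theorem memLp_levelDiff (hS : S.Valid) (hε : 0 < ε) (hρ : 0 < ρ) (hM : 0 ≤ M)
    (hh : Measurable h) (hgm : Measurable g) (l : ℕ) :
    MemLp (fun ζ : E × (Fin (2 ^ l) → E) => levelDiff S ε h g l ζ.2) 2
      (jointLaw P ρ (2 ^ l)) := by
  cases l with
  | zero => exact memLp_gradEst hg hS hε hρ hM hh hgm (by positivity)
  | succ k =>
    have h0 := memLp_gradEst (S := S) (ε := ε) (h := h) hg hS hε hρ hM hh hgm
      (m := 2 ^ (k + 1)) (by positivity)
    have h1 := memLp_gradEst (S := S) (ε := ε) (h := h) hg hS hε hρ hM hh hgm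
      (m := 2 ^ k) (by positivity)
    have h2 := h1.comp_measurePreserving (measurePreserving_jointLaw hρ (firstHalf_injective k))
    have h3 := h1.comp_measurePreserving (measurePreserving_jointLaw hρ (secondHalf_injective k))
    exact h0.sub ((h2.add h3).const_smul (1 / 2 : ℝ))

theorem integral_levelDiff_succ (hS : S.Valid) (hε : 0 < ε) (hρ : 0 < ρ) (hM : 0 ≤ M)
    (hh : Measurable h) (hgm : Measurable g) (k : ℕ) :
    ∫ ζ, levelDiff S ε h g (k + 1) ζ.2 ∂(jointLaw P ρ (2 ^ (k + 1))) =
      ∫ ζ, gradEst S ε h g ζ.2 ∂(jointLaw P ρ (2 ^ (k + 1))) -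
        ∫ ζ, gradEst S ε h g ζ.2 ∂(jointLaw P ρ (2 ^ k)) := by
  have := isProbabilityMeasure_jointLaw (P := P) hρ (2 ^ k)
  have := isProbabilityMeasure_jointLaw (P := P) hρ (2 ^ (k + 1))
  have h0 := (memLp_gradEst (S := S) (ε := ε) (h := h) hg hS hε hρ hM hh hgm
    (m := 2 ^ (k + 1)) (by positivity)).integrable one_le_two
  have h1 := (memLp_gradEst (S := S) (ε := ε) (h := h) hg hS hε hρ hM hh hgm
    (m := 2 ^ k) (by positivity)).integrable one_le_two
  have hp1 := measurePreserving_jointLaw (P := P) hρ (firstHalf_injective k)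
  have hp2 := measurePreserving_jointLaw (P := P) hρ (secondHalf_injective k)
  have h2 : Integrable (fun ζ : E × (Fin (2 ^ (k + 1)) → E) =>
      gradEst S ε h g (firstHalf ζ.2)) (jointLaw P ρ (2 ^ (k + 1))) :=
    hp1.integrable_comp_of_integrable h1
  have h3 : Integrable (fun ζ : E × (Fin (2 ^ (k + 1)) → E) =>
      gradEst S ε h g (secondHalf ζ.2)) (jointLaw P ρ (2 ^ (k + 1))) :=
    hp2.integrable_comp_of_integrable h1
  have e2 : ∫ ζ, gradEst S ε h g (firstHalf ζ.2) ∂(jointLaw P ρ (2 ^ (k + 1))) =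
      ∫ ζ, gradEst S ε h g ζ.2 ∂(jointLaw P ρ (2 ^ k)) :=
    integral_comp_measurePreserving hp1 h1.aestronglyMeasurable
  have e3 : ∫ ζ, gradEst S ε h g (secondHalf ζ.2) ∂(jointLaw P ρ (2 ^ (k + 1))) =
      ∫ ζ, gradEst S ε h g ζ.2 ∂(jointLaw P ρ (2 ^ k)) :=
    integral_comp_measurePreserving hp2 h1.aestronglyMeasurable
  change ∫ ζ, (gradEst S ε h g ζ.2 - (1 / 2 : ℝ) • (gradEst S ε h g (firstHalf ζ.2) +
    gradEst S ε h g (secondHalf ζ.2))) ∂(jointLaw P ρ (2 ^ (k + 1))) = _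
  have h4 : Integrable (fun ζ : E × (Fin (2 ^ (k + 1)) → E) => (1 / 2 : ℝ) •
      (gradEst S ε h g (firstHalf ζ.2) + gradEst S ε h g (secondHalf ζ.2)))
      (jointLaw P ρ (2 ^ (k + 1))) := (h2.add h3).smul (1 / 2 : ℝ)
  rw [integral_sub h0 h4, integral_smul, integral_add h2 h3, e2, e3,
    ← two_smul ℝ, smul_smul]
  norm_num

/-- The mean of a level difference is the difference of the gradient means at consecutive levels, so
the sum telescopes. -/
theorem sum_integral_levelDiff (hS : S.Valid) (hε : 0 < ε) (hρ : 0 < ρ) (hM : 0 ≤ M)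
    (hh : Measurable h) (hgm : Measurable g) (L : ℕ) :
    ∑ l ∈ Finset.range (L + 1), ∫ ζ, levelDiff S ε h g l ζ.2 ∂(jointLaw P ρ (2 ^ l)) =
      ∫ ζ, gradEst S ε h g ζ.2 ∂(jointLaw P ρ (2 ^ L)) := by
  induction L with
  | zero => rw [Finset.sum_range_one]; rfl
  | succ k ih =>
    rw [Finset.sum_range_succ, ih, integral_levelDiff_succ hg hS hε hρ hM hh hgm]
    abel

/-- The order 2^{-l} comes from the variance of the half sum, the remaining term from the solver.
Level 0 has no difference and fits the bound because C ≥ 1. -/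
theorem integral_norm_sq_levelDiff_le (hS : S.Valid) (hε : 0 < ε) (hρ : 0 < ρ) (hM : 0 ≤ M)
    (hh : Measurable h) (hC1 : 1 ≤ C) (l : ℕ)
    (hC : ∀ z ∈ P.support, ∀ w : Fin (2 ^ l) → E, (∀ i, w i ∈ Metric.closedBall z ρ) →
      chiSq (S.optWeight fun j => h (w j)) ≤ C) :
    ∫ ζ, ‖levelDiff S ε h g l ζ.2‖ ^ 2 ∂(jointLaw P ρ (2 ^ l)) ≤
      M ^ 2 * (3 * C / 2 ^ l + 12 * S.weightErr ε ^ 2) := by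
  have hd := Penalty.weightErr_nonneg (S := S) ε
  cases l with
  | zero =>
    refine (integral_norm_sq_gradEst_le hg hS hε hρ hM (by positivity)).trans ?_
    rw [mul_pow, pow_zero, div_one]
    gcongr
    nlinarith [sq_nonneg (S.weightErr ε - 1 / 2)]
  | succ k =>
    have := isProbabilityMeasure_jointLaw (P := P) hρ (2 ^ (k + 1))
    set A : E × (Fin (2 ^ (k + 1)) → E) → ℝ := fun ζ => ∑ i : Fin (2 ^ k), firstHalf
      (fun j => S.optWeight (fun j => h (ζ.2 j)) j - 1 / 2 ^ (k + 1)) i with hA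
    have hAm : Measurable A := by
      refine Finset.measurable_sum _ fun i _ => ?_
      exact ((hS.measurable_optWeight (by positivity) _).comp (measurable_pi_lambda _ fun j =>
        hh.comp ((measurable_pi_apply j).comp measurable_snd))).sub_const _
    have hAb : ∀ ζ, |A ζ| ≤ 2 ^ k * 1 := by
      intro ζ
      refine (Finset.abs_sum_le_sum_abs _ _).trans ?_
      have : ∀ i ∈ (Finset.univ : Finset (Fin (2 ^ k))), |firstHalf (fun j => S.optWeight
          (fun j => h (ζ.2 j)) j - 1 / 2 ^ (k + 1)) i| ≤ (1 : ℝ) := by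
        intro i _
        have hm : 0 < 2 ^ (k + 1) := by positivity
        have h0 : 0 ≤ firstHalf (S.optWeight (fun j => h (ζ.2 j))) i :=
          hS.weight_nonneg _ _ _
        have h1 : firstHalf (S.optWeight (fun j => h (ζ.2 j))) i ≤ 1 :=
          hS.optWeight_le_one _ hm _
        have h2 : (0 : ℝ) ≤ 1 / 2 ^ (k + 1) := by positivity
        have h3 : (1 : ℝ) / 2 ^ (k + 1) ≤ 1 := by
          rw [div_le_one (by positivity)]; exact one_le_pow₀ one_le_two
        change |firstHalf (S.optWeight (fun j => h (ζ.2 j))) i - 1 / 2 ^ (k + 1)| ≤ 1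
        rw [abs_le]
        constructor <;> linarith
      refine (Finset.sum_le_card_nsmul _ _ _ this).trans (le_of_eq ?_)
      simp
    have hA2 : Integrable (fun ζ => A ζ ^ 2) (jointLaw P ρ (2 ^ (k + 1))) := by
      refine Integrable.of_bound (hAm.pow_const 2).aestronglyMeasurable ((2 ^ k * 1) ^ 2)
        (Eventually.of_forall fun ζ => ?_)
      rw [norm_pow, Real.norm_eq_abs]
      gcongr
      exact hAb ζ
    have hAint := integral_sq_sum_half_le hS hρ hh k hC
    change ∫ ζ, A ζ ^ 2 ∂_ ≤ _ at hAint
    have hpow : (2 : ℝ) ≤ 2 ^ (k + 1) := by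
      rw [pow_succ]
      have : (1 : ℝ) ≤ 2 ^ k := one_le_pow₀ one_le_two
      linarith
    have hAint2 : ∫ ζ, A ζ ^ 2 ∂(jointLaw P ρ (2 ^ (k + 1))) ≤ C / (2 * 2 ^ (k + 1)) := by
      -- Here 4(m - 1) ≥ 2m, because m = 2^(k+1) is at least 2.
      exact hAint.trans (div_le_div_of_nonneg_left (by linarith) (by positivity) (by linarith))
    calc ∫ ζ, ‖levelDiff S ε h g (k + 1) ζ.2‖ ^ 2 ∂(jointLaw P ρ (2 ^ (k + 1)))
        ≤ ∫ ζ, M ^ 2 * (6 * A ζ ^ 2 + 12 * S.weightErr ε ^ 2)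
            ∂(jointLaw P ρ (2 ^ (k + 1))) := by
          refine integral_mono_of_nonneg (Eventually.of_forall fun ζ => sq_nonneg _)
            (((hA2.const_mul 6).add (integrable_const _)).const_mul _) ?_
          filter_upwards [ae_jointLaw_attackSet hρ (2 ^ (k + 1))] with ζ hζ
          have hb := norm_levelDiff_succ_le (h := h) hS hε hM (w := ζ.2) fun i => hg _ (hζ i)
          change _ ≤ M * (2 * |A ζ| + 2 * S.weightErr ε) at hb
          calc ‖levelDiff S ε h g (k + 1) ζ.2‖ ^ 2
              ≤ (M * (2 * |A ζ| + 2 * S.weightErr ε)) ^ 2 := by gcongr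
            _ ≤ _ := by
                rw [mul_pow]
                gcongr
                rw [← sq_abs (A ζ)]
                -- The inequality is (2a + 2δ)² ≤ 6a² + 12δ², with defect 2(a - 2δ)².
                nlinarith [sq_nonneg (|A ζ| - 2 * S.weightErr ε)]
      _ = M ^ 2 * (6 * ∫ ζ, A ζ ^ 2 ∂(jointLaw P ρ (2 ^ (k + 1))) + 12 * S.weightErr ε ^ 2) := by
          rw [integral_const_mul, integral_add (hA2.const_mul 6) (integrable_const _),
            integral_const_mul]
          simp
      _ ≤ _ := by
          gcongr
          calc 6 * ∫ ζ, A ζ ^ 2 ∂(jointLaw P ρ (2 ^ (k + 1))) ≤ 6 * (C / (2 * 2 ^ (k + 1))) := by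
                gcongr
            _ = _ := by field_simp; norm_num

end Moments

end

end PhiDRO

set_option linter.unusedSectionVars false

namespace PhiDRO

noncomputable section

/-- A regular subgradient of a Lipschitz function is bounded by the Lipschitz constant. -/
theorem IsSubgradAt.norm_le {p : ℕ} {u : EuclideanSpace ℝ (Fin p) → ℝ}
    {v x : EuclideanSpace ℝ (Fin p)} (hv : IsSubgradAt u v x) {M : ℝ}
    (hu : ∀ᶠ y in 𝓝 x, u y - u x ≤ M * ‖y - x‖) : ‖v‖ ≤ |M| := by
  rcases eq_or_ne v 0 with h0 | h0
  · rw [h0, norm_zero]; exact abs_nonneg _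
  refine le_of_forall_pos_le_add fun c hc => ?_
  have hv0 : 0 < ‖v‖ := norm_pos_iff.2 h0
  -- The subgradient inequality is tested along the ray x + tv, where the inner product equals
  -- t‖v‖².
  have hlim : Tendsto (fun t : ℝ => x + t • v) (𝓝[>] 0) (𝓝 x) := by
    have : Tendsto (fun t : ℝ => x + t • v) (𝓝 0) (𝓝 (x + (0 : ℝ) • v)) :=
      (continuous_const.add (continuous_id.smul continuous_const)).tendsto 0
    rw [zero_smul, add_zero] at this
    exact this.mono_left nhdsWithin_le_nhds
  obtain ⟨t, ⟨h1, h2⟩, ht⟩ :=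
    (((hlim.eventually (hv c hc)).and (hlim.eventually hu)).and self_mem_nhdsWithin).exists
  have ht0 : (0 : ℝ) < t := ht
  rw [add_sub_cancel_left, norm_smul, Real.norm_eq_abs, abs_of_pos ht0] at h1 h2
  rw [inner_smul_right, real_inner_self_eq_norm_sq] at h1
  have h3 : t * ‖v‖ * ‖v‖ ≤ t * ‖v‖ * (M + c) := by nlinarith
  have h4 := le_of_mul_le_mul_left h3 (mul_pos ht0 hv0)
  linarith [le_abs_self M]

/-! ### Mean and second moment of one randomized multilevel copy. -/

section Estimators

variable {E : Type*} [NormedAddCommGroup E] [NormedSpace ℝ E] [FiniteDimensional ℝ E]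
  [MeasureSpace E] [BorelSpace E] [(volume : Measure E).IsAddHaarMeasure] {ρ : ℝ}
  {P : Measure E} [IsProbabilityMeasure P]
  {p : ℕ} {S : Penalty} {ε : ℝ} {h : E → ℝ} {g : E → EuclideanSpace ℝ (Fin p)} {M C : ℝ}

variable (S ε h g) in
/-- A single copy of the randomized multilevel estimator. -/
def levelEst (L : ℕ) (x : (l : Fin (L + 1)) × (E × (Fin (2 ^ (l : ℕ)) → E))) :
    EuclideanSpace ℝ (Fin p) :=
  (levelProb L x.1)⁻¹ • levelDiff S ε h g x.1 x.2.2

theorem measurable_levelEst (hS : S.Valid) (hh : Measurable h) (hg : Measurable g) (L : ℕ) :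
    Measurable (levelEst S ε h g L) :=
  measurable_sigma fun l => by
    have h1 : Measurable fun ζ : E × (Fin (2 ^ (l : ℕ)) → E) => levelDiff S ε h g l ζ.2 :=
      (measurable_levelDiff hS hh hg (l : ℕ)).comp measurable_snd
    exact h1.const_smul (levelProb L l)⁻¹

variable (hg : ∀ x ∈ attackSet P ρ, ‖g x‖ ≤ M)
include hg

theorem integral_levelEst (hS : S.Valid) (hε : 0 < ε) (hρ : 0 < ρ) (hM : 0 ≤ M)
    (hh : Measurable h) (hgm : Measurable g) (L : ℕ) :
    ∫ x, levelEst S ε h g L x ∂(levelLaw P ρ L) =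
      ∫ ζ, gradEst S ε h g ζ.2 ∂(jointLaw P ρ (2 ^ L)) := by
  have hint : ∀ l : ℕ, Integrable (fun ζ : E × (Fin (2 ^ l) → E) =>
      levelDiff S ε h g l ζ.2) (jointLaw P ρ (2 ^ l)) := fun l => by
    have := isProbabilityMeasure_jointLaw (P := P) hρ (2 ^ l)
    exact (memLp_levelDiff hg hS hε hρ hM hh hgm l).integrable one_le_two
  have h1 := (integral_levelLaw (P := P) (ρ := ρ)
    (measurable_levelEst (ε := ε) hS hh hgm L).stronglyMeasurable
    (fun l => (hint l).smul (levelProb L l)⁻¹)).2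
  rw [h1, ← sum_integral_levelDiff hg hS hε hρ hM hh hgm L, ← Fin.sum_univ_eq_sum_range
    (fun l => ∫ ζ, levelDiff S ε h g l ζ.2 ∂(jointLaw P ρ (2 ^ l)))]
  refine Finset.sum_congr rfl fun l _ => ?_
  change levelProb L l • ∫ ζ, (levelProb L l)⁻¹ • levelDiff S ε h g l ζ.2
    ∂(jointLaw P ρ (2 ^ (l : ℕ))) = _
  rw [integral_smul, smul_smul, mul_inv_cancel₀ (levelProb_pos L l).ne', one_smul]

theorem levelEst_sq (hS : S.Valid) (hε : 0 < ε) (hρ : 0 < ρ) (hM : 0 ≤ M)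
    (hh : Measurable h) (hgm : Measurable g) (L : ℕ) :
    Integrable (fun x => ‖levelEst S ε h g L x‖ ^ 2) (levelLaw P ρ L) ∧
    ∫ x, ‖levelEst S ε h g L x‖ ^ 2 ∂(levelLaw P ρ L) =
      ∑ l ∈ Finset.range (L + 1), (levelProb L l)⁻¹ *
        ∫ ζ, ‖levelDiff S ε h g l ζ.2‖ ^ 2 ∂(jointLaw P ρ (2 ^ l)) := by
  have hint : ∀ l : ℕ, Integrable (fun ζ : E × (Fin (2 ^ l) → E) =>
      ‖levelDiff S ε h g l ζ.2‖ ^ 2) (jointLaw P ρ (2 ^ l)) := fun l =>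
    (memLp_levelDiff hg hS hε hρ hM hh hgm l).integrable_norm_pow two_ne_zero
  have hsq : ∀ (l : Fin (L + 1)) (ζ : E × (Fin (2 ^ (l : ℕ)) → E)),
      ‖levelEst S ε h g L ⟨l, ζ⟩‖ ^ 2 =
        (levelProb L l)⁻¹ ^ 2 * ‖levelDiff S ε h g l ζ.2‖ ^ 2 := by
    intro l ζ
    change ‖(levelProb L l)⁻¹ • levelDiff S ε h g l ζ.2‖ ^ 2 = _
    rw [norm_smul, mul_pow, Real.norm_eq_abs, sq_abs]
  have h1 := integral_levelLaw (P := P) (ρ := ρ)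
    (Y := fun x => ‖levelEst S ε h g L x‖ ^ 2)
    ((measurable_levelEst (ε := ε) hS hh hgm L).norm.pow_const 2).stronglyMeasurable
    (fun l => by
      simp_rw [hsq]
      exact (hint l).const_mul _)
  refine ⟨h1.1, ?_⟩
  rw [h1.2, ← Fin.sum_univ_eq_sum_range (fun l => (levelProb L l)⁻¹ *
    ∫ ζ, ‖levelDiff S ε h g l ζ.2‖ ^ 2 ∂(jointLaw P ρ (2 ^ l)))]
  refine Finset.sum_congr rfl fun l _ => ?_
  simp_rw [hsq]
  rw [integral_const_mul, smul_eq_mul, ← mul_assoc]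
  congr 1
  have := (levelProb_pos L l).ne'
  field_simp

theorem memLp_levelEst (hS : S.Valid) (hε : 0 < ε) (hρ : 0 < ρ) (hM : 0 ≤ M)
    (hh : Measurable h) (hgm : Measurable g) (L : ℕ) :
    MemLp (levelEst S ε h g L) 2 (levelLaw P ρ L) :=
  (memLp_two_iff_integrable_sq_norm
    (measurable_levelEst hS hh hgm L).aestronglyMeasurable).2
    (levelEst_sq hg hS hε hρ hM hh hgm L).1

/-- Dividing by the level probability inside the square and averaging leaves one factor 1/P(l) ≤ 2 ·
2^l. The variance part then gives 6C at each of the L + 1 levels; the solver part is a geometric sum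
below 24δ² · 2^(L+1), and δ² = 2ε/(κη) turns it into the term with 96. -/
theorem integral_norm_sq_levelEst_le (hS : S.Valid) (hε : 0 < ε) (hρ : 0 < ρ) (hM : 0 ≤ M)
    (hh : Measurable h) (hgm : Measurable g) (hC1 : 1 ≤ C)
    (hC : ∀ z ∈ P.support, ∀ (m : ℕ) (w : Fin m → E), 0 < m →
      (∀ i, w i ∈ Metric.closedBall z ρ) → chiSq (S.optWeight fun j => h (w j)) ≤ C) (L : ℕ) :
    ∫ x, ‖levelEst S ε h g L x‖ ^ 2 ∂(levelLaw P ρ L) ≤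
      96 * M ^ 2 / (S.kappa * S.eta) * (2 ^ L * ε) + 6 * (L + 1) * M ^ 2 * C := by
  rw [(levelEst_sq hg hS hε hρ hM hh hgm L).2]
  have hk : 0 < S.kappa * S.eta := mul_pos hS.kappa_pos hS.eta_pos
  have hterm : ∀ l ∈ Finset.range (L + 1), (levelProb L l)⁻¹ *
      ∫ ζ, ‖levelDiff S ε h g l ζ.2‖ ^ 2 ∂(jointLaw P ρ (2 ^ l)) ≤
        M ^ 2 * (6 * C) + M ^ 2 * (24 * S.weightErr ε ^ 2) * 2 ^ l := by
    intro l _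
    have h1 : (levelProb L l)⁻¹ ≤ 2 * 2 ^ l := by
      unfold levelProb
      rw [inv_div, inv_pow, inv_pow, div_inv_eq_mul]
      have : (0 : ℝ) < (2 ^ L)⁻¹ := by positivity
      gcongr
      linarith
    have h2 := integral_norm_sq_levelDiff_le hg hS hε hρ hM hh hC1 l
      (fun z hz w hw => hC z hz _ w (by positivity) hw)
    calc _ ≤ 2 * 2 ^ l * (M ^ 2 * (3 * C / 2 ^ l + 12 * S.weightErr ε ^ 2)) := by
          refine mul_le_mul h1 h2 (integral_nonneg fun ζ => sq_nonneg _) (by positivity)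
      _ = _ := by field_simp; ring
  refine (Finset.sum_le_sum hterm).trans ?_
  rw [Finset.sum_add_distrib, Finset.sum_const, Finset.card_range, nsmul_eq_mul,
    ← Finset.mul_sum, geom_sum_eq (by norm_num), hS.sq_weightErr hε]
  push_cast
  have h3 : M ^ 2 * (24 * (2 * ε / (S.kappa * S.eta))) * ((2 ^ (L + 1) - 1) / (2 - 1)) ≤
      96 * M ^ 2 / (S.kappa * S.eta) * (2 ^ L * ε) := by
    calc M ^ 2 * (24 * (2 * ε / (S.kappa * S.eta))) * ((2 ^ (L + 1) - 1) / (2 - 1))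
        ≤ M ^ 2 * (24 * (2 * ε / (S.kappa * S.eta))) * 2 ^ (L + 1) := by
          gcongr
          norm_num
      _ = _ := by rw [pow_succ]; ring
  linarith

end Estimators

end

end PhiDRO

set_option linter.unusedSectionVars false

namespace PhiDRO

noncomputable section

/-! ### The gradient of the surrogate objective -/

/-- Regular subgradients pass under the integral sign. -/
theorem isSubgradAt_integral {Ω : Type*} [MeasurableSpace Ω] {μ : Measure Ω}
    [IsProbabilityMeasure μ] {p : ℕ} {F : EuclideanSpace ℝ (Fin p) → Ω → ℝ}
    {G : Ω → EuclideanSpace ℝ (Fin p)} {x : EuclideanSpace ℝ (Fin p)} {M N : ℝ}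
    (hF : ∀ᶠ y in 𝓝 x, AEStronglyMeasurable (F y) μ) (hFx : Integrable (F x) μ)
    (hlip : ∀ᶠ y in 𝓝 x, ∀ᵐ ω ∂μ, |F y ω - F x ω| ≤ M * ‖y - x‖)
    (hG : AEStronglyMeasurable G μ) (hGb : ∀ᵐ ω ∂μ, ‖G ω‖ ≤ N)
    (hsub : ∀ᵐ ω ∂μ, IsSubgradAt (fun y => F y ω) (G ω) x) :
    IsSubgradAt (fun y => ∫ ω, F y ω ∂μ) (∫ ω, G ω ∂μ) x := by
  have hGint : Integrable G μ := Integrable.of_bound hG N hGb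
  have hFint : ∀ᶠ y in 𝓝 x, Integrable (F y) μ := by
    filter_upwards [hF, hlip] with y hy hy2
    have h1 : Integrable (fun ω => F y ω - F x ω) μ :=
      Integrable.of_bound (hy.sub hFx.aestronglyMeasurable) _
        (by simpa only [Real.norm_eq_abs] using hy2)
    exact (h1.add hFx).congr (Eventually.of_forall fun ω => by simp)
  -- The negative part of the normalized remainder. A regular subgradient says exactly that it tends
  -- to 0, and Lipschitz bounds dominate it, so dominated convergence applies.
  set q : EuclideanSpace ℝ (Fin p) → Ω → ℝ := fun y ω =>
    min 0 ((F y ω - F x ω - inner ℝ (G ω) (y - x)) * ‖y - x‖⁻¹) with hq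
  have hlim : Tendsto (fun y => ∫ ω, q y ω ∂μ) (𝓝[≠] x) (𝓝 (∫ _ω, (0 : ℝ) ∂μ)) := by
    refine tendsto_integral_filter_of_dominated_convergence (fun _ => |M| + N) ?_ ?_
      (integrable_const _) ?_
    · filter_upwards [hF.filter_mono nhdsWithin_le_nhds] with y hy
      have h1 : AEStronglyMeasurable
          (fun ω => (F y ω - F x ω - inner ℝ (G ω) (y - x)) * ‖y - x‖⁻¹) μ :=
        ((hy.sub hFx.aestronglyMeasurable).sub (hG.inner aestronglyMeasurable_const)).mul_const _
      exact (aestronglyMeasurable_const.inf h1)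
    · filter_upwards [hlip.filter_mono nhdsWithin_le_nhds, self_mem_nhdsWithin] with y hy hne
      filter_upwards [hy, hGb] with ω h1 h2
      have hpos : 0 < ‖y - x‖ := norm_pos_iff.2 (sub_ne_zero.2 hne)
      have h3 : |(F y ω - F x ω - inner ℝ (G ω) (y - x)) * ‖y - x‖⁻¹| ≤ |M| + N := by
        rw [abs_mul, abs_of_pos (inv_pos.2 hpos), ← div_eq_mul_inv, div_le_iff₀ hpos]
        have h4 : |(inner ℝ (G ω) (y - x) : ℝ)| ≤ N * ‖y - x‖ :=
          (abs_real_inner_le_norm _ _).trans (by gcongr)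
        calc _ ≤ |F y ω - F x ω| + |(inner ℝ (G ω) (y - x) : ℝ)| := abs_sub _ _
          _ ≤ |M| * ‖y - x‖ + N * ‖y - x‖ := by
            refine add_le_add (h1.trans ?_) h4
            gcongr
            exact le_abs_self M
          _ = _ := by ring
      rw [Real.norm_eq_abs]
      refine le_trans ?_ h3
      rw [hq]
      simp only
      rcases le_total 0 ((F y ω - F x ω - inner ℝ (G ω) (y - x)) * ‖y - x‖⁻¹) with h | h
      · rw [min_eq_left h, abs_zero]; exact abs_nonneg _
      · rw [min_eq_right h]
    · filter_upwards [hsub] with ω hω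
      rw [Metric.tendsto_nhds]
      intro c hc
      filter_upwards [(hω (c / 2) (by linarith)).filter_mono nhdsWithin_le_nhds,
        self_mem_nhdsWithin] with y hy hne
      have hpos : 0 < ‖y - x‖ := norm_pos_iff.2 (sub_ne_zero.2 hne)
      have h1 : -(c / 2) ≤ (F y ω - F x ω - inner ℝ (G ω) (y - x)) * ‖y - x‖⁻¹ := by
        rw [← div_eq_mul_inv, le_div_iff₀ hpos]
        linarith
      have h2 : -(c / 2) ≤ q y ω := le_min (by linarith) h1
      have h3 : q y ω ≤ 0 := min_le_left _ _
      rw [Real.dist_eq, sub_zero, abs_of_nonpos h3]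
      linarith
  rw [integral_zero] at hlim
  intro c hc
  have hev : ∀ᶠ y in 𝓝[≠] x, -c < ∫ ω, q y ω ∂μ := hlim.eventually (lt_mem_nhds (by linarith))
  rw [eventually_nhdsWithin_iff] at hev
  filter_upwards [hev, hFint, hF] with y hy hyi hym
  by_cases hne : y = x
  · simp [hne]
  have hpos : 0 < ‖y - x‖ := norm_pos_iff.2 (sub_ne_zero.2 hne)
  have h1 := hy hne
  have hiG : Integrable (fun ω => (inner ℝ (G ω) (y - x) : ℝ)) μ := hGint.inner_const _
  have hD : Integrable (fun ω => (F y ω - F x ω - inner ℝ (G ω) (y - x)) * ‖y - x‖⁻¹) μ :=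
    ((hyi.sub hFx).sub hiG).mul_const _
  have h2 : ∫ ω, q y ω ∂μ ≤ ∫ ω, (F y ω - F x ω - inner ℝ (G ω) (y - x)) * ‖y - x‖⁻¹ ∂μ := by
    refine integral_mono ?_ hD fun ω => min_le_right _ _
    exact (integrable_const (0 : ℝ)).inf hD
  have hin : ∫ ω, (inner ℝ (G ω) (y - x) : ℝ) ∂μ = inner ℝ (∫ ω, G ω ∂μ) (y - x) := by
    rw [real_inner_comm, ← integral_inner hGint]
    exact integral_congr_ae (Eventually.of_forall fun ω => real_inner_comm _ _)
  have hFF : Integrable (fun ω => F y ω - F x ω) μ := hyi.sub hFx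
  rw [integral_mul_const, integral_sub hFF hiG, integral_sub hyi hFx,
    hin] at h2
  have h3 := h1.trans_le h2
  rw [← div_eq_mul_inv, lt_div_iff₀ hpos] at h3
  linarith

/-! ### The dual objective as a function of the data, at a fixed multiplier. -/

section Surrogate

variable {S : Penalty} {p : ℕ} {m : ℕ}

/-- The chain rule for the dual objective with the multiplier held fixed. -/
theorem isSubgradAt_dualValue (hS : S.Valid) {f : Fin m → EuclideanSpace ℝ (Fin p) → ℝ}
    {v : Fin m → EuclideanSpace ℝ (Fin p)} {x : EuclideanSpace ℝ (Fin p)}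
    (hv : ∀ i, IsSubgradAt (f i) (v i) x) (μ : ℝ) :
    IsSubgradAt (fun y => S.dualValue (fun i => f i y) μ)
      (∑ i, S.weight (fun i => f i x) μ i • v i) x := by
  intro c hc
  set W := ∑ i, S.weight (fun i => f i x) μ i with hW
  have hw0 : ∀ i, 0 ≤ S.weight (fun i => f i x) μ i := fun i => hS.weight_nonneg _ _ i
  have hW0 : 0 ≤ W := Finset.sum_nonneg fun i _ => hw0 i
  -- The tolerance is shared out over the total weight W; the denominator W + 1 avoids division by
  -- zero.
  have hc' : 0 < c / (W + 1) := div_pos hc (by linarith)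
  filter_upwards [eventually_all.2 fun i => hv i _ hc'] with y hy
  have h1 : S.dualValue (fun i => f i x) μ + ∑ i, S.weight (fun i => f i x) μ i *
      (f i y - f i x) ≤ S.dualValue (fun i => f i y) μ := by
    unfold Penalty.dualValue
    simp_rw [Penalty.weight_eq, mul_assoc]
    rw [← Finset.mul_sum, add_assoc, ← mul_add, ← Finset.sum_add_distrib]
    gcongr with i
    have := hS.conj_add_le (f i x - μ) (f i y - μ)
    rwa [sub_sub_sub_cancel_right] at this
  have h2 : ∑ i, S.weight (fun i => f i x) μ i *
      (inner ℝ (v i) (y - x) - c / (W + 1) * ‖y - x‖) ≤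
      ∑ i, S.weight (fun i => f i x) μ i * (f i y - f i x) :=
    Finset.sum_le_sum fun i _ => mul_le_mul_of_nonneg_left (by linarith [hy i]) (hw0 i)
  have h3 : ∑ i, S.weight (fun i => f i x) μ i *
      (inner ℝ (v i) (y - x) - c / (W + 1) * ‖y - x‖) =
      inner ℝ (∑ i, S.weight (fun i => f i x) μ i • v i) (y - x) -
        W * (c / (W + 1) * ‖y - x‖) := by
    rw [sum_inner, hW, Finset.sum_mul, ← Finset.sum_sub_distrib]
    refine Finset.sum_congr rfl fun i _ => ?_
    rw [real_inner_smul_left]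
    ring
  have h4 : W * (c / (W + 1) * ‖y - x‖) ≤ c * ‖y - x‖ := by
    rw [← mul_assoc]
    gcongr
    rw [mul_div_assoc', div_le_iff₀ (by linarith)]
    nlinarith
  linarith

theorem hasGradientAt_dualValue (hS : S.Valid) {f : Fin m → EuclideanSpace ℝ (Fin p) → ℝ}
    {v : Fin m → EuclideanSpace ℝ (Fin p)} {x : EuclideanSpace ℝ (Fin p)}
    (hv : ∀ i, HasGradientAt (f i) (v i) x) (μ : ℝ) :
    HasGradientAt (fun y => S.dualValue (fun i => f i y) μ)
      (∑ i, S.weight (fun i => f i x) μ i • v i) x := by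
  unfold Penalty.dualValue
  have h1 : ∀ i, HasFDerivAt (fun y => conj S.phi S.eta (f i y - μ))
      (S.argmax (f i x - μ) • (InnerProductSpace.toDual ℝ _) (v i)) x := fun i =>
    HasDerivAt.comp_hasFDerivAt (h₂ := conj S.phi S.eta) (f := fun y => f i y - μ) x
      (hS.hasDerivAt_conj (f i x - μ)) ((hv i).hasFDerivAt.sub_const μ)
  have h2 := ((HasFDerivAt.fun_sum fun i (_ : i ∈ Finset.univ) => h1 i).const_mul
    (1 / (m : ℝ))).const_add μ
  have h3 : (InnerProductSpace.toDual ℝ _) (∑ i, S.weight (fun i => f i x) μ i • v i) =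
      (1 / (m : ℝ)) • ∑ i, S.argmax (f i x - μ) • (InnerProductSpace.toDual ℝ _) (v i) := by
    rw [map_sum, Finset.smul_sum]
    refine Finset.sum_congr rfl fun i _ => ?_
    rw [Penalty.weight_eq, map_smul, mul_smul]
  rw [hasGradientAt_iff_hasFDerivAt, h3]
  exact h2

/-- Near the data, the dual objective with a fixed multiplier grows at most linearly. -/
theorem abs_dualValue_sub_le (hS : S.Valid) (hm : 0 < m) {u v : Fin m → ℝ} {r : ℝ}
    (huv : ∀ i, |u i - v i| ≤ r) (μ : ℝ) :
    |S.dualValue u μ - S.dualValue v μ| ≤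
      r * ∑ i, S.weight v μ i + r ^ 2 / (2 * S.kappa * S.eta) := by
  have hm' : (0 : ℝ) < m := by exact_mod_cast hm
  have hk : 0 < 2 * S.kappa * S.eta := mul_pos (mul_pos two_pos hS.kappa_pos) hS.eta_pos
  have hsplit : S.dualValue u μ - S.dualValue v μ = 1 / (m : ℝ) *
      ∑ i, (conj S.phi S.eta (u i - μ) - conj S.phi S.eta (v i - μ)) := by
    unfold Penalty.dualValue
    rw [Finset.sum_sub_distrib]
    ring
  have hrhs : r * ∑ i, S.weight v μ i + r ^ 2 / (2 * S.kappa * S.eta) = 1 / (m : ℝ) *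
      ∑ i, (S.argmax (v i - μ) * r + r ^ 2 / (2 * S.kappa * S.eta)) := by
    simp_rw [Penalty.weight_eq]
    rw [Finset.sum_add_distrib, Finset.sum_const, Finset.card_univ, Fintype.card_fin, nsmul_eq_mul,
      mul_add, ← mul_assoc (1 / (m : ℝ)) (m : ℝ), one_div_mul_cancel hm'.ne', one_mul,
      ← Finset.mul_sum, ← Finset.sum_mul]
    ring
  rw [hsplit, hrhs, abs_mul, abs_of_nonneg (by positivity : (0 : ℝ) ≤ 1 / m)]
  gcongr
  refine (Finset.abs_sum_le_sum_abs _ _).trans (Finset.sum_le_sum fun i _ => ?_)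
  have h1 := hS.conj_add_le (v i - μ) (u i - μ)
  have h2 := hS.conj_le_add (v i - μ) (u i - μ)
  rw [sub_sub_sub_cancel_right] at h1 h2
  have ha := hS.argmax_nonneg (v i - μ)
  have hr : (u i - v i) ^ 2 / (2 * S.kappa * S.eta) ≤ r ^ 2 / (2 * S.kappa * S.eta) := by
    gcongr ?_ / _
    exact sq_le_sq' (by linarith [(abs_le.1 (huv i)).1]) (abs_le.1 (huv i)).2
  have h3 := mul_le_mul_of_nonneg_left (abs_le.1 (huv i)).2 ha
  have h4 := mul_le_mul_of_nonneg_left (abs_le.1 (huv i)).1 ha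
  have h5 : 0 ≤ r ^ 2 / (2 * S.kappa * S.eta) := by positivity
  rw [abs_le]
  constructor <;> linarith

end Surrogate

section SurrogateLaw

variable {E : Type*} [NormedAddCommGroup E] [NormedSpace ℝ E] [FiniteDimensional ℝ E]
  [MeasureSpace E] [BorelSpace E] [(volume : Measure E).IsAddHaarMeasure] {ρ : ℝ}
  {P : Measure E} [IsProbabilityMeasure P] {p : ℕ} {S : Penalty} {ε : ℝ}

/-- Any single coordinate, paired with z, has the law of the level-0 sample. -/
theorem integrable_sample {h : E → ℝ} (hρ : 0 < ρ)
    (hint : Integrable (fun ζ : E × (Fin (2 ^ 0) → E) => h (ζ.2 0)) (sampleLaw P ρ 0)) {m : ℕ}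
    (i : Fin m) : Integrable (fun ζ : E × (Fin m → E) => h (ζ.2 i)) (jointLaw P ρ m) := by
  have hinj : Function.Injective (fun _ : Fin (2 ^ 0) => i) := fun a b _ =>
    Subsingleton.elim (α := Fin 1) a b
  exact (measurePreserving_jointLaw (P := P) hρ hinj).integrable_comp_of_integrable hint

theorem integrable_dualValue_muStar {h : E → ℝ} (hS : S.Valid) (hh : Measurable h) {m : ℕ}
    (hm : 0 < m) (hint : ∀ i : Fin m, Integrable (fun ζ : E × (Fin m → E) => h (ζ.2 i))
      (jointLaw P ρ m)) :
    Integrable (fun ζ : E × (Fin m → E) => S.dualValue (fun j => h (ζ.2 j))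
      (S.muStar fun j => h (ζ.2 j))) (jointLaw P ρ m) := by
  have hV : Measurable fun ζ : E × (Fin m → E) => fun j => h (ζ.2 j) :=
    measurable_pi_lambda _ fun j => hh.comp ((measurable_pi_apply j).comp measurable_snd)
  refine Integrable.mono' (integrable_finsetSum Finset.univ fun i _ => (hint i).abs)
    (hS.measurable_dualValue hV ((hS.measurable_muStar hm).comp hV)).aestronglyMeasurable
    (Eventually.of_forall fun ζ => ?_)
  rw [Real.norm_eq_abs]
  exact hS.abs_dualValue_muStar_le _ hm

theorem integrable_dualValue_outMu {h : E → ℝ} (hS : S.Valid) (hε : 0 < ε) (hρ : 0 < ρ)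
    (hh : Measurable h) {m : ℕ} (hm : 0 < m)
    (hint : ∀ i : Fin m, Integrable (fun ζ : E × (Fin m → E) => h (ζ.2 i)) (jointLaw P ρ m)) :
    Integrable (fun ζ : E × (Fin m → E) => S.dualValue (fun j => h (ζ.2 j))
      (S.outMu ε fun j => h (ζ.2 j))) (jointLaw P ρ m) := by
  have := isProbabilityMeasure_jointLaw (P := P) hρ m
  have hV : Measurable fun ζ : E × (Fin m → E) => fun j => h (ζ.2 j) :=
    measurable_pi_lambda _ fun j => hh.comp ((measurable_pi_apply j).comp measurable_snd)
  have h1 := integrable_dualValue_muStar (P := P) (ρ := ρ) hS hh hm hint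
  have h2 := hS.measurable_dualValue hV ((hS.measurable_outMu ε).comp hV)
  have h3 : Integrable (fun ζ : E × (Fin m → E) => S.dualValue (fun j => h (ζ.2 j))
      (S.outMu ε fun j => h (ζ.2 j)) - S.dualValue (fun j => h (ζ.2 j))
        (S.muStar fun j => h (ζ.2 j))) (jointLaw P ρ m) := by
    refine Integrable.of_bound (h2.aestronglyMeasurable.sub h1.aestronglyMeasurable) ε
      (Eventually.of_forall fun ζ => ?_)
    have h4 := hS.dualValue_muStar_le (fun j => h (ζ.2 j)) hm (S.outMu ε fun j => h (ζ.2 j))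
    have h5 := hS.dualValue_outMu_le (fun j => h (ζ.2 j)) hm hε
    rw [Real.norm_eq_abs, abs_of_nonneg (by linarith)]
    linarith
  exact (h3.add h1).congr (Eventually.of_forall fun ζ => by simp)

variable {U : Set (EuclideanSpace ℝ (Fin p))} {f : EuclideanSpace ℝ (Fin p) → E → ℝ} {Lf : ℝ}
  {g : E → EuclideanSpace ℝ (Fin p)} {θ : EuclideanSpace ℝ (Fin p)} {M : ℝ}

/-- The smoothness bound has a linear and a quadratic term in the distance. Within the unit ball
around θ the quadratic one is absorbed, and one Lipschitz constant serves for all samples, as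
domination requires. -/
theorem ae_abs_dualValue_sub_le (hS : S.Valid) (hε : 0 < ε) (hρ : 0 < ρ)
    (hθ : θ ∈ U)
    (hlip : ∀ z' ∈ attackSet P ρ, ∀ θ₁ ∈ U, ∀ θ₂ ∈ U, |f θ₁ z' - f θ₂ z'| ≤ Lf * ‖θ₁ - θ₂‖)
    {m : ℕ} (hm : 0 < m) :
    ∀ᵐ ζ ∂(jointLaw P ρ m), ∀ y ∈ U ∩ Metric.ball θ 1,
      |S.dualValue (fun j => f y (ζ.2 j)) (S.outMu ε fun j => f θ (ζ.2 j)) -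
        S.dualValue (fun j => f θ (ζ.2 j)) (S.outMu ε fun j => f θ (ζ.2 j))| ≤
      (|Lf| * (1 + S.weightErr ε) + Lf ^ 2 / (2 * S.kappa * S.eta)) * ‖y - θ‖ := by
  filter_upwards [ae_jointLaw_attackSet (P := P) hρ m] with ζ hζ y ⟨hy, hy1⟩
  have hd : ‖y - θ‖ ≤ 1 := by rw [← dist_eq_norm]; exact (Metric.mem_ball.1 hy1).le
  have hk : 0 < 2 * S.kappa * S.eta := mul_pos (mul_pos two_pos hS.kappa_pos) hS.eta_pos
  have h1 := abs_dualValue_sub_le hS hm (u := fun j => f y (ζ.2 j)) (v := fun j => f θ (ζ.2 j))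
    (r := |Lf| * ‖y - θ‖) (fun i => (hlip _ (hζ i) y hy θ hθ).trans
      (mul_le_mul_of_nonneg_right (le_abs_self _) (norm_nonneg _)))
    (S.outMu ε fun j => f θ (ζ.2 j))
  refine h1.trans ?_
  have h2 : ∑ i, S.weight (fun j => f θ (ζ.2 j)) (S.outMu ε fun j => f θ (ζ.2 j)) i ≤
      1 + S.weightErr ε := hS.sum_outWeight_le _ hm hε
  have h3 : (|Lf| * ‖y - θ‖) ^ 2 / (2 * S.kappa * S.eta) ≤
      Lf ^ 2 / (2 * S.kappa * S.eta) * ‖y - θ‖ := by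
    rw [mul_pow, sq_abs, mul_div_right_comm]
    gcongr
    nlinarith [norm_nonneg (y - θ)]
  calc _ ≤ |Lf| * ‖y - θ‖ * (1 + S.weightErr ε) + Lf ^ 2 / (2 * S.kappa * S.eta) * ‖y - θ‖ := by
        gcongr
    _ = _ := by ring

variable (hS : S.Valid) (hε : 0 < ε) (hρ : 0 < ρ) (hU : IsOpen U) (hθ : θ ∈ U)
  (hf : ∀ y ∈ U, Measurable (f y))
  (hlip : ∀ z' ∈ attackSet P ρ, ∀ θ₁ ∈ U, ∀ θ₂ ∈ U, |f θ₁ z' - f θ₂ z'| ≤ Lf * ‖θ₁ - θ₂‖)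
  (hg : Measurable g) (hgM : ∀ x ∈ attackSet P ρ, ‖g x‖ ≤ M) (hM : 0 ≤ M)
  (hint : Integrable (fun ζ : E × (Fin (2 ^ 0) → E) => f θ (ζ.2 0)) (sampleLaw P ρ 0))
include hS hε hρ hU hθ hf hlip hg hgM hM hint

/-- The multiplier stays frozen at θ while only the loss moves, so by the chain rule `gradEst` is a
subgradient of the integrand. -/
theorem isSubgradAt_surrogate (L : ℕ)
    (hsub : ∀ z' ∈ attackSet P ρ, IsSubgradAt (fun t => f t z') (g z') θ) :
    IsSubgradAt (surrogate S ε P ρ L f θ)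
      (∫ ζ, gradEst S ε (f θ) g ζ.2 ∂(jointLaw P ρ (2 ^ L))) θ := by
  have hm : 0 < 2 ^ L := by positivity
  have := isProbabilityMeasure_jointLaw (P := P) hρ (2 ^ L)
  have hV : ∀ y ∈ U, Measurable fun ζ : E × (Fin (2 ^ L) → E) => fun j => f y (ζ.2 j) :=
    fun y hy => measurable_pi_lambda _ fun j =>
      (hf y hy).comp ((measurable_pi_apply j).comp measurable_snd)
  refine isSubgradAt_integral (μ := jointLaw P ρ (2 ^ L))
    (M := |Lf| * (1 + S.weightErr ε) + Lf ^ 2 / (2 * S.kappa * S.eta)) (F := fun y (ζ : E × (Fin (2 ^ L) → E)) =>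
    S.dualValue (fun j => f y (ζ.2 j)) (S.outMu ε fun j => f θ (ζ.2 j))) ?_
    (integrable_dualValue_outMu hS hε hρ (hf θ hθ) hm fun i => integrable_sample hρ hint i)
    ?_
    ((measurable_gradEst hS (hf θ hθ) hg _).comp measurable_snd).aestronglyMeasurable
    (ae_norm_gradEst_le hgM hS hε hρ hM hm) ?_
  · filter_upwards [hU.mem_nhds hθ] with y hy
    exact (hS.measurable_dualValue (hV y hy)
      ((hS.measurable_outMu ε).comp (hV θ hθ))).aestronglyMeasurable
  · filter_upwards [(hU.inter Metric.isOpen_ball).mem_nhds ⟨hθ, Metric.mem_ball_self one_pos⟩]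
      with y hy
    filter_upwards [ae_abs_dualValue_sub_le hS hε hρ hθ hlip hm] with ζ hζ using hζ y hy
  · filter_upwards [ae_jointLaw_attackSet (P := P) hρ (2 ^ L)] with ζ hζ
    exact isSubgradAt_dualValue hS (f := fun i t => f t (ζ.2 i)) (v := fun i => g (ζ.2 i))
      (fun i => hsub _ (hζ i)) _

theorem hasGradientAt_surrogate (L : ℕ)
    (hgrad : ∀ z' ∈ attackSet P ρ, HasGradientAt (fun t => f t z') (g z') θ) :
    HasGradientAt (surrogate S ε P ρ L f θ)
      (∫ ζ, gradEst S ε (f θ) g ζ.2 ∂(jointLaw P ρ (2 ^ L))) θ := by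
  have hm : 0 < 2 ^ L := by positivity
  have := isProbabilityMeasure_jointLaw (P := P) hρ (2 ^ L)
  have hV : ∀ y ∈ U, Measurable fun ζ : E × (Fin (2 ^ L) → E) => fun j => f y (ζ.2 j) :=
    fun y hy => measurable_pi_lambda _ fun j =>
      (hf y hy).comp ((measurable_pi_apply j).comp measurable_snd)
  have hGint : Integrable (fun ζ : E × (Fin (2 ^ L) → E) => gradEst S ε (f θ) g ζ.2)
      (jointLaw P ρ (2 ^ L)) :=
    (memLp_gradEst hgM hS hε hρ hM (hf θ hθ) hg hm).integrable one_le_two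
  set T := (InnerProductSpace.toDual ℝ (EuclideanSpace ℝ (Fin p)))
  have hT : T (∫ ζ, gradEst S ε (f θ) g ζ.2 ∂(jointLaw P ρ (2 ^ L))) =
      ∫ ζ, T (gradEst S ε (f θ) g ζ.2) ∂(jointLaw P ρ (2 ^ L)) :=
    (T.toContinuousLinearEquiv.toContinuousLinearMap.integral_comp_comm hGint).symm
  rw [hasGradientAt_iff_hasFDerivAt, hT]
  refine (hasFDerivAt_integral_of_dominated_loc_of_lip' (μ := jointLaw P ρ (2 ^ L))
    (F := fun y (ζ : E × (Fin (2 ^ L) → E)) =>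
      S.dualValue (fun j => f y (ζ.2 j)) (S.outMu ε fun j => f θ (ζ.2 j)))
    (bound := fun _ => |Lf| * (1 + S.weightErr ε) + Lf ^ 2 / (2 * S.kappa * S.eta))
    ((hU.inter Metric.isOpen_ball).mem_nhds ⟨hθ, Metric.mem_ball_self one_pos⟩) ?_
    (integrable_dualValue_outMu hS hε hρ (hf θ hθ) hm fun i => integrable_sample hρ hint i)
    (T.continuous.comp_aestronglyMeasurable hGint.aestronglyMeasurable) ?_
    (integrable_const _) ?_).2
  · intro y hy
    exact (hS.measurable_dualValue (hV y hy.1)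
      ((hS.measurable_outMu ε).comp (hV θ hθ))).aestronglyMeasurable
  · exact ae_abs_dualValue_sub_le hS hε hρ hθ hlip hm
  · filter_upwards [ae_jointLaw_attackSet (P := P) hρ (2 ^ L)] with ζ hζ
    exact (hasGradientAt_dualValue hS (f := fun i t => f t (ζ.2 i)) (v := fun i => g (ζ.2 i))
      (fun i => hgrad _ (hζ i)) _).hasFDerivAt

end SurrogateLaw

end

end PhiDRO

namespace PhiDRO

noncomputable section

/-! ### Order statistics of uniform samples -/

section OrderStatistics

/-- The `k`-th order statistic, counting from zero. -/
def ordStat {m : ℕ} {α : Type*} [LinearOrder α] (x : Fin m → α) (k : Fin m) : α :=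
  x (Tuple.sort x k)

theorem ordStat_mono {m : ℕ} {α : Type*} [LinearOrder α] (x : Fin m → α) : Monotone (ordStat x) :=
  Tuple.monotone_sort x

theorem sum_ordStat {m : ℕ} {α M : Type*} [LinearOrder α] [AddCommMonoid M] (x : Fin m → α)
    (F : α → M) : ∑ k, F (ordStat x k) = ∑ j, F (x j) :=
  Equiv.sum_comp (Tuple.sort x) fun j => F (x j)

/-- The number of entries below a given value. -/
def numBelow {m : ℕ} {α : Type*} [LinearOrder α] (x : Fin m → α) (a : α) : ℕ :=
  (Finset.univ.filter fun i => x i < a).card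

theorem numBelow_ordStat_le {m : ℕ} {α : Type*} [LinearOrder α] (x : Fin m → α) (k : Fin m) :
    numBelow x (ordStat x k) ≤ k := by
  have h : numBelow x (ordStat x k) ≤ (Finset.Iio k).card := by
    refine Finset.card_le_card_of_injOn (fun i => (Tuple.sort x).symm i) ?_
      (Equiv.injective _).injOn
    intro i hi
    simp only [Finset.coe_filter, Finset.mem_univ, true_and, mem_ofPred_eq] at hi
    simp only [Finset.coe_Iio, mem_Iio]
    by_contra hcon
    have h1 := ordStat_mono x (not_lt.1 hcon)
    unfold ordStat at h1 hi
    rw [Equiv.apply_symm_apply] at h1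
    exact absurd hi (not_lt.2 h1)
  rwa [Fin.card_Iio] at h

/-- If the entry of rank k were below a, so would be the k + 1 entries of ranks 0 to k. -/
theorem le_ordStat_of_numBelow_le {m : ℕ} {α : Type*} [LinearOrder α] {x : Fin m → α} {a : α}
    {k : Fin m} (h : numBelow x a ≤ k) : a ≤ ordStat x k := by
  by_contra hcon
  have h1 : (Finset.Iic k).card ≤ numBelow x a := by
    refine Finset.card_le_card_of_injOn (fun i => Tuple.sort x i) ?_ (Equiv.injective _).injOn
    intro i hi
    simp only [Finset.coe_Iic, mem_Iic] at hi
    simp only [Finset.coe_filter, Finset.mem_univ, true_and, mem_ofPred_eq]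
    exact (ordStat_mono x hi).trans_lt (not_le.1 hcon)
  rw [Fin.card_Iic] at h1
  omega

variable {m : ℕ}

/-- There are finitely many sorting permutations, and each is selected by finitely many comparisons,
ties being broken by index. -/
theorem measurable_ordStat (k : Fin m) :
    Measurable fun x : Fin m → unitInterval => ordStat x k := by
  let _ : MeasurableSpace (Equiv.Perm (Fin m)) := ⊤
  have hd : DiscreteMeasurableSpace (Equiv.Perm (Fin m)) := ⟨fun _ => trivial⟩
  have hs : Measurable fun x : Fin m → unitInterval => Tuple.sort x := by
    refine measurable_to_countable' fun σ => ?_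
    have : (fun x : Fin m → unitInterval => Tuple.sort x) ⁻¹' {σ} =
        (⋂ (i) (j) (_ : i ≤ j), {x | x (σ i) ≤ x (σ j)}) ∩
          ⋂ (i) (j) (_ : i < j), ({x | x (σ i) = x (σ j)}ᶜ ∪ {_x | σ i < σ j}) := by
      ext x
      simp only [mem_preimage, mem_singleton_iff, mem_inter_iff, mem_iInter, mem_ofPred_eq,
        mem_union, mem_compl_iff]
      rw [eq_comm, Tuple.eq_sort_iff]
      refine and_congr ⟨fun h i j hij => h hij, fun h i j hij => h i j hij⟩ ?_
      exact forall₃_congr fun i j _ => imp_iff_not_or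
    rw [this]
    refine MeasurableSet.inter ?_ ?_
    · exact MeasurableSet.iInter fun i => MeasurableSet.iInter fun j => MeasurableSet.iInter
        fun _ => measurableSet_le (measurable_pi_apply _) (measurable_pi_apply _)
    · exact MeasurableSet.iInter fun i => MeasurableSet.iInter fun j => MeasurableSet.iInter
        fun _ => ((measurableSet_eq_fun (measurable_pi_apply (σ i))
          (measurable_pi_apply (σ j))).compl).union (MeasurableSet.const (σ i < σ j))
  have h2 : Measurable fun q : Equiv.Perm (Fin m) × (Fin m → unitInterval) => q.2 (q.1 k) :=
    measurable_from_prod_countable_right fun σ => measurable_pi_apply (σ k)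
  exact h2.comp (hs.prodMk measurable_id)

theorem measurable_numBelow {X : Type*} [MeasurableSpace X] {x : X → Fin m → unitInterval}
    {a : X → unitInterval} (hx : Measurable x) (ha : Measurable a) :
    Measurable fun ω => numBelow (x ω) (a ω) := by
  unfold numBelow
  simp_rw [Finset.card_filter]
  refine Finset.measurable_sum _ fun i _ => ?_
  exact Measurable.ite (measurableSet_lt ((measurable_pi_apply i).comp hx) ha)
    measurable_const measurable_const

theorem integrable_of_abs_le {X : Type*} [MeasurableSpace X] {μ : Measure X} [IsFiniteMeasure μ]
    {f : X → ℝ} (hf : Measurable f) {c : ℝ} (h : ∀ x, |f x| ≤ c) : Integrable f μ :=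
  Integrable.of_bound hf.aestronglyMeasurable c (Eventually.of_forall h)

theorem abs_coe_le_one (u : unitInterval) : |(u : ℝ)| ≤ 1 := by
  rw [abs_of_nonneg u.2.1]; exact u.2.2

/-- Among `m + 1` exchangeable samples, the first one has rank at most `k` with probability at
least `(k + 1) / (m + 1)`. -/
theorem measure_numBelow_le (k : ℕ) (hk : k ≤ m) :
    ((k : ℝ) + 1) / (m + 1) ≤ (volume : Measure (Fin (m + 1) → unitInterval)).real
      {y | numBelow y (y 0) ≤ k} := by
  set A : Fin (m + 1) → Set (Fin (m + 1) → unitInterval) := fun l =>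
    {y | numBelow y (y l) ≤ k} with hA
  have hAm : ∀ l, MeasurableSet (A l) := fun l =>
    measurableSet_le (measurable_numBelow measurable_id (measurable_pi_apply l)) measurable_const
  have heq : ∀ l, (volume : Measure (Fin (m + 1) → unitInterval)).real (A l) =
      (volume : Measure (Fin (m + 1) → unitInterval)).real (A 0) := by
    intro l
    have hmp := measurePreserving_comp_injective (volume : Measure unitInterval)
      (Equiv.swap 0 l).injective
    have h1 := hmp.measureReal_preimage (hAm 0).nullMeasurableSet
    rw [volume_pi, ← h1]
    congr 1
    ext y
    simp only [hA, mem_ofPred_eq, mem_preimage, numBelow, Equiv.swap_apply_left]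
    have : (Finset.univ.filter fun i => y (Equiv.swap 0 l i) < y l).card =
        (Finset.univ.filter fun i => y i < y l).card := by
      simp_rw [Finset.card_filter]
      exact Equiv.sum_comp (Equiv.swap 0 l) fun i => if y i < y l then 1 else 0
    rw [this]
  have hsum : (k : ℝ) + 1 ≤ ∑ l, (volume : Measure (Fin (m + 1) → unitInterval)).real (A l) := by
    have h1 : ∀ l, (volume : Measure (Fin (m + 1) → unitInterval)).real (A l) =
        ∫ y, (A l).indicator (fun _ => (1 : ℝ)) y := fun l => by
      rw [integral_indicator_const _ (hAm l), smul_eq_mul, mul_one]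
    simp_rw [h1]
    rw [← integral_finsetSum _ fun l _ => (integrable_const (1 : ℝ)).indicator (hAm l)]
    have h2 : ∫ _y : Fin (m + 1) → unitInterval, ((k : ℝ) + 1) = k + 1 := by simp
    rw [← h2]
    refine integral_mono (integrable_const _)
      (integrable_finsetSum _ fun l _ => (integrable_const (1 : ℝ)).indicator (hAm l)) fun y => ?_
    simp only
    -- Pointwise, the k + 1 coordinates of ranks 0 to k all have at most k coordinates below them.
    have h3 : (Finset.Iic (⟨k, by omega⟩ : Fin (m + 1))).card ≤
        (Finset.univ.filter fun l => y ∈ A l).card := by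
      refine Finset.card_le_card_of_injOn (fun i => Tuple.sort y i) ?_
        (Equiv.injective _).injOn
      intro i hi
      simp only [Finset.coe_Iic, mem_Iic] at hi
      simp only [Finset.coe_filter, Finset.mem_univ, true_and, mem_ofPred_eq]
      exact (numBelow_ordStat_le y i).trans hi
    rw [Fin.card_Iic, Finset.card_filter] at h3
    have h4 : ((k + 1 : ℕ) : ℝ) ≤ ((∑ l, if y ∈ A l then 1 else 0 : ℕ) : ℝ) := by
      exact_mod_cast h3
    push_cast at h4
    simpa [Set.indicator_apply] using h4
  simp_rw [heq] at hsum
  rw [Finset.sum_const, Finset.card_univ, Fintype.card_fin, nsmul_eq_mul] at hsum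
  push_cast at hsum
  rw [div_le_iff₀ (by positivity)]
  linarith

/-- The mean of an order statistic is the probability that a fresh uniform variable does not exceed
it. By the rank bound for m + 1 exchangeable variables this is at least (k + 1)/(m + 1), hence at
least k/m. -/
theorem le_integral_ordStat (k : Fin m) :
    (k : ℝ) / m ≤ ∫ x : Fin m → unitInterval, ((ordStat x k : unitInterval) : ℝ) := by
  have hm : (0 : ℝ) < m := by exact_mod_cast k.pos
  have hOm := measurable_ordStat k
  have h1 : ∫ x : Fin m → unitInterval, ((ordStat x k : unitInterval) : ℝ) =
      ((volume : Measure unitInterval).prod (volume : Measure (Fin m → unitInterval))).real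
        {q | q.1 ≤ ordStat q.2 k} := by
    have hset : MeasurableSet {q : unitInterval × (Fin m → unitInterval) |
        q.1 ≤ ordStat q.2 k} := measurableSet_le measurable_fst (hOm.comp measurable_snd)
    rw [Measure.real, Measure.prod_apply_symm hset, integral_eq_lintegral_of_nonneg_ae
      (Eventually.of_forall fun x => (ordStat x k).2.1)
      (hOm.subtype_coe).aestronglyMeasurable]
    congr 1
    refine lintegral_congr fun x => ?_
    rw [← unitInterval.volume_Iic]
    rfl
  have hmp := measurePreserving_piFinSuccAbove
    (fun _ : Fin (m + 1) => (volume : Measure unitInterval)) 0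
  have h2 : (volume : Measure (Fin (m + 1) → unitInterval)).real {y | numBelow y (y 0) ≤ k} ≤
      ((volume : Measure unitInterval).prod (volume : Measure (Fin m → unitInterval))).real
        {q | q.1 ≤ ordStat q.2 k} := by
    have hset : MeasurableSet {q : unitInterval × (Fin m → unitInterval) |
        q.1 ≤ ordStat q.2 k} := measurableSet_le measurable_fst (hOm.comp measurable_snd)
    have h3 := hmp.measureReal_preimage hset.nullMeasurableSet
    change _ = ((volume : Measure unitInterval).prod
      (volume : Measure (Fin m → unitInterval))).real _ at h3
    rw [← h3]
    refine measureReal_mono ?_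
    intro y hy
    change y 0 ≤ ordStat (fun j => y (Fin.succAbove 0 j)) k
    refine le_ordStat_of_numBelow_le ?_
    refine le_trans ?_ (show numBelow y (y 0) ≤ k from hy)
    refine Finset.card_le_card_of_injOn (fun i => Fin.succAbove 0 i) ?_
      (Fin.succAbove_right_injective).injOn
    intro i hi
    simpa [Fin.zero_succAbove] using (Finset.mem_filter.1 hi).2
  rw [h1]
  refine le_trans ?_ ((measure_numBelow_le (m := m) k k.2.le).trans h2)
  have hk : (k : ℝ) ≤ m := by exact_mod_cast k.2.le
  rw [div_le_div_iff₀ hm (by positivity)]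
  nlinarith

/-- Two distinct coordinates are independent, and P(yᵢ < u) = u. -/
theorem integral_mul_indicator_lt {r : unitInterval → ℝ} (hr : Measurable r) {c : ℝ}
    (hrc : ∀ u, |r u| ≤ c) {i j : Fin m} (hij : i ≠ j) :
    ∫ y : Fin m → unitInterval, r (y j) * (if y i < y j then 1 else 0) =
      ∫ u : unitInterval, r u * u := by
  have hinj : Function.Injective (![i, j] : Fin 2 → Fin m) := by
    intro a b h
    fin_cases a <;> fin_cases b <;> simp_all
  have hmp := (measurePreserving_finTwoArrow (volume : Measure unitInterval)).comp
    (measurePreserving_comp_injective (volume : Measure unitInterval) hinj)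
  have hset : MeasurableSet {q : unitInterval × unitInterval | q.1 < q.2} :=
    measurableSet_lt measurable_fst measurable_snd
  have hfm : Measurable fun q : unitInterval × unitInterval =>
      r q.2 * (if q.1 < q.2 then (1 : ℝ) else 0) :=
    (hr.comp measurable_snd).mul (Measurable.ite hset measurable_const measurable_const)
  have hint : Integrable (fun q : unitInterval × unitInterval =>
      r q.2 * (if q.1 < q.2 then (1 : ℝ) else 0))
      ((volume : Measure unitInterval).prod (volume : Measure unitInterval)) := by
    refine integrable_of_abs_le hfm (c := c) fun q => ?_
    split_ifs
    · simpa using hrc q.2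
    · simpa using (abs_nonneg _).trans (hrc q.2)
  have h1 := integral_comp_measurePreserving hmp hfm.aestronglyMeasurable
  have h2 : ∫ y : Fin m → unitInterval, r (y j) * (if y i < y j then (1 : ℝ) else 0) =
      ∫ q, r q.2 * (if q.1 < q.2 then (1 : ℝ) else 0)
        ∂((volume : Measure unitInterval).prod (volume : Measure unitInterval)) := h1
  rw [h2, integral_prod_symm _ hint]
  refine integral_congr_ae (Eventually.of_forall fun u => ?_)
  simp only
  rw [integral_const_mul]
  congr 1
  have h3 : (fun v : unitInterval => if v < u then (1 : ℝ) else 0) =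
      (Iio u).indicator fun _ => 1 := by
    ext v; simp [Set.indicator_apply]
  rw [h3, integral_indicator_const _ measurableSet_Iio, smul_eq_mul, mul_one, Measure.real,
    unitInterval.volume_Iio, ENNReal.toReal_ofReal u.2.1]

theorem integral_comp_coord {r : unitInterval → ℝ} (hr : Measurable r) (j : Fin m) :
    ∫ y : Fin m → unitInterval, r (y j) = ∫ u, r u :=
  integral_comp_eval (μ := fun _ : Fin m => (volume : Measure unitInterval))
    hr.aestronglyMeasurable

/-- Two independent samples, coupled in increasing order: the weighted displacement is at most the
mass of the weight. -/
theorem integral_coupling_le {r : unitInterval → ℝ} (hr : Measurable r) {c : ℝ}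
    (hr0 : ∀ u, 0 ≤ r u) (hrc : ∀ u, |r u| ≤ c) :
    ∫ q : (Fin m → unitInterval) × (Fin m → unitInterval),
      ∑ k, r (ordStat q.2 k) * (((ordStat q.2 k : unitInterval) : ℝ) - (ordStat q.1 k : unitInterval)) ≤ ∫ u, r u := by
  rcases Nat.eq_zero_or_pos m with hm0 | hm0
  · subst hm0
    simp only [Finset.univ_eq_empty, Finset.sum_empty, integral_zero]
    exact integral_nonneg hr0
  have hm : (0 : ℝ) < m := by exact_mod_cast hm0
  have hrm : ∀ k, Measurable fun y : Fin m → unitInterval => r (ordStat y k) := fun k =>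
    hr.comp (measurable_ordStat k)
  have hOm : ∀ k, Measurable fun y : Fin m → unitInterval => ((ordStat y k : unitInterval) : ℝ) := fun k =>
    measurable_subtype_coe.comp (measurable_ordStat k)
  have hmulb : ∀ u v : unitInterval, |r u * v| ≤ c := by
    intro u v
    rw [abs_mul]
    calc |r u| * |(v : ℝ)| ≤ |r u| * 1 := by
          gcongr
          exact abs_coe_le_one v
      _ ≤ c := by rw [mul_one]; exact hrc u
  have hi1 : ∀ k, Integrable (fun q : (Fin m → unitInterval) × (Fin m → unitInterval) =>
      r (ordStat q.2 k) * ((ordStat q.2 k : unitInterval) : ℝ)) := fun k =>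
    integrable_of_abs_le (((hrm k).comp measurable_snd).mul ((hOm k).comp measurable_snd))
      fun q => hmulb _ _
  have hi2 : ∀ k, Integrable (fun q : (Fin m → unitInterval) × (Fin m → unitInterval) =>
      r (ordStat q.2 k) * ((ordStat q.1 k : unitInterval) : ℝ)) := fun k =>
    integrable_of_abs_le (((hrm k).comp measurable_snd).mul ((hOm k).comp measurable_fst))
      fun q => hmulb _ _
  have hi3 : ∀ k, Integrable (fun y : Fin m → unitInterval =>
      r (ordStat y k) * ((ordStat y k : unitInterval) : ℝ)) := fun k =>
    integrable_of_abs_le ((hrm k).mul (hOm k)) fun q => hmulb _ _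
  have hi4 : ∀ k, Integrable (fun y : Fin m → unitInterval => r (ordStat y k)) := fun k =>
    integrable_of_abs_le (hrm k) fun q => hrc _
  have hI1 : ∀ k, ∫ q : (Fin m → unitInterval) × (Fin m → unitInterval),
      r (ordStat q.2 k) * ((ordStat q.2 k : unitInterval) : ℝ) =
        ∫ y : Fin m → unitInterval, r (ordStat y k) * ((ordStat y k : unitInterval) : ℝ) := fun k =>
    integral_comp_measurePreserving (measurePreserving_snd
      (μ := (volume : Measure (Fin m → unitInterval)))) (hi3 k).aestronglyMeasurable
  have hI2 : ∀ k, ∫ q : (Fin m → unitInterval) × (Fin m → unitInterval),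
      r (ordStat q.2 k) * ((ordStat q.1 k : unitInterval) : ℝ) =
        (∫ x : Fin m → unitInterval, ((ordStat x k : unitInterval) : ℝ)) *
          ∫ y : Fin m → unitInterval, r (ordStat y k) := fun k => by
    simp_rw [mul_comm (r _)]
    exact integral_prod_mul (fun x : Fin m → unitInterval => ((ordStat x k : unitInterval) : ℝ))
      fun y => r (ordStat y k)
  -- The samples are independent and r ≥ 0, so the order statistic of the first sample may be
  -- replaced by the lower bound k/m of its mean.
  have hstep : ∫ q : (Fin m → unitInterval) × (Fin m → unitInterval),
      ∑ k, r (ordStat q.2 k) * (((ordStat q.2 k : unitInterval) : ℝ) - (ordStat q.1 k : unitInterval)) ≤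
      ∫ y : Fin m → unitInterval, ∑ k, r (ordStat y k) * (((ordStat y k : unitInterval) : ℝ) - k / m) := by
    simp_rw [mul_sub, Finset.sum_sub_distrib]
    rw [integral_sub (integrable_finsetSum _ fun k _ => hi1 k)
      (integrable_finsetSum _ fun k _ => hi2 k),
      integral_sub (integrable_finsetSum _ fun k _ => hi3 k)
      (integrable_finsetSum _ fun k _ => (hi4 k).mul_const _),
      integral_finsetSum _ fun k _ => hi1 k, integral_finsetSum _ fun k _ => hi2 k,
      integral_finsetSum _ fun k _ => hi3 k,
      integral_finsetSum _ fun k _ => (hi4 k).mul_const _]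
    simp_rw [hI1, hI2, integral_mul_const]
    refine sub_le_sub_left (Finset.sum_le_sum fun k _ => ?_) _
    rw [mul_comm]
    exact mul_le_mul_of_nonneg_right (le_integral_ordStat k) (integral_nonneg fun y => hr0 _)
  refine hstep.trans ?_
  have hi5 : ∀ j, Integrable (fun y : Fin m → unitInterval => r (y j) * (y j : ℝ)) := fun j =>
    integrable_of_abs_le ((hr.comp (measurable_pi_apply j)).mul
      (measurable_subtype_coe.comp (measurable_pi_apply j))) fun y => hmulb _ _
  have hi6 : ∀ i j, Integrable (fun y : Fin m → unitInterval =>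
      r (y j) * (if y i < y j then (1 : ℝ) else 0)) := fun i j => by
    refine integrable_of_abs_le ((hr.comp (measurable_pi_apply j)).mul (Measurable.ite
      (measurableSet_lt (measurable_pi_apply i) (measurable_pi_apply j))
      measurable_const measurable_const)) (c := c) fun y => ?_
    split_ifs
    · simpa using hrc _
    · simpa using (abs_nonneg _).trans (hrc (y j))
  -- The rank k is at least the number of entries strictly below, which removes the sorting: what
  -- remains is a sum over pairs of coordinates.
  have hpt : ∀ y : Fin m → unitInterval,
      ∑ k, r (ordStat y k) * (((ordStat y k : unitInterval) : ℝ) - k / m) ≤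
        ∑ j, (r (y j) * (y j : ℝ) - 1 / m * ∑ i, r (y j) * (if y i < y j then (1 : ℝ) else 0)) := by
    intro y
    have h1 : ∑ j, (r (y j) * (y j : ℝ) - 1 / m * ∑ i, r (y j) *
        (if y i < y j then (1 : ℝ) else 0)) = ∑ k, (r (ordStat y k) * ((ordStat y k : unitInterval) : ℝ) -
          1 / m * ∑ i, r (ordStat y k) * (if y i < ordStat y k then (1 : ℝ) else 0)) :=
      (sum_ordStat y fun a => r a * (a : ℝ) - 1 / m * ∑ i, r a *
        (if y i < a then (1 : ℝ) else 0)).symm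
    rw [h1]
    refine Finset.sum_le_sum fun k _ => ?_
    rw [mul_sub, ← Finset.mul_sum]
    refine sub_le_sub_left ?_ _
    have h2 : ∑ i, (if y i < ordStat y k then (1 : ℝ) else 0) ≤ k := by
      have := numBelow_ordStat_le y k
      unfold numBelow at this
      rw [Finset.card_filter] at this
      exact_mod_cast this
    calc 1 / (m : ℝ) * (r (ordStat y k) * ∑ i, (if y i < ordStat y k then (1 : ℝ) else 0))
        ≤ 1 / (m : ℝ) * (r (ordStat y k) * k) := by
          have := hr0 (ordStat y k)
          gcongr
      _ = _ := by ring
  refine (integral_mono ?_ ?_ hpt).trans ?_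
  · exact integrable_finsetSum _ fun k _ => by
      simp_rw [mul_sub]
      exact (hi3 k).sub ((hi4 k).mul_const _)
  · exact integrable_finsetSum _ fun j _ =>
      (hi5 j).sub ((integrable_finsetSum _ fun i _ => hi6 i j).const_mul _)
  have hi7 : ∀ j ∈ Finset.univ, Integrable (fun y : Fin m → unitInterval => r (y j) * (y j : ℝ) -
      1 / m * ∑ i, r (y j) * (if y i < y j then (1 : ℝ) else 0)) := fun j _ =>
    (hi5 j).sub ((integrable_finsetSum _ fun i _ => hi6 i j).const_mul _)
  rw [integral_finsetSum _ hi7]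
  -- Of the m pairs the diagonal one vanishes, so ∫ r u is reduced by the fraction (m - 1)/m and 1/m
  -- of it is left.
  have hval : ∀ j : Fin m, ∫ y : Fin m → unitInterval, (r (y j) * (y j : ℝ) - 1 / m *
      ∑ i, r (y j) * (if y i < y j then (1 : ℝ) else 0)) =
      1 / m * ∫ u : unitInterval, r u * u := by
    intro j
    rw [integral_sub (hi5 j) ((integrable_finsetSum _ fun i _ => hi6 i j).const_mul _),
      integral_const_mul, integral_finsetSum _ fun i _ => hi6 i j,
      integral_comp_coord (r := fun u => r u * (u : ℝ)) (hr.mul measurable_subtype_coe) j,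
      ← Finset.sum_erase_add _ _ (Finset.mem_univ j),
      Finset.sum_congr rfl fun i hi => integral_mul_indicator_lt hr hrc (Finset.ne_of_mem_erase hi),
      Finset.sum_const, Finset.card_erase_of_mem (Finset.mem_univ j), Finset.card_univ,
      Fintype.card_fin, nsmul_eq_mul, Nat.cast_sub hm0]
    simp only [lt_irrefl, if_false, mul_zero, integral_zero, add_zero, Nat.cast_one]
    field_simp
    ring
  simp_rw [hval]
  rw [Finset.sum_const, Finset.card_univ, Fintype.card_fin, nsmul_eq_mul, ← mul_assoc,
    mul_one_div_cancel hm.ne', one_mul]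
  refine integral_mono ?_ (integrable_of_abs_le hr hrc) fun u => ?_
  · exact integrable_of_abs_le (hr.mul measurable_subtype_coe) fun u => hmulb u u
  · exact mul_le_of_le_one_right (hr0 u) u.2.2

end OrderStatistics

end

end PhiDRO

namespace PhiDRO

noncomputable section

/-! ### Sample average approximation for a Lipschitz quantile function -/

section QuantileSAA

variable {S : Penalty} {Q : unitInterval → ℝ} {G : ℝ}

theorem continuous_of_abs_sub_le (hG : ∀ u v : unitInterval, |Q u - Q v| ≤ G * |(u : ℝ) - v|) :
    Continuous Q := by
  have : LipschitzWith (Real.toNNReal G) Q := by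
    refine LipschitzWith.of_dist_le_mul fun u v => ?_
    rw [Real.dist_eq, Subtype.dist_eq, Real.dist_eq]
    refine (hG u v).trans ?_
    gcongr
    exact Real.le_coe_toNNReal G
  exact this.continuous

theorem integrable_of_continuous {X : Type*} [TopologicalSpace X] [CompactSpace X]
    [MeasurableSpace X] [OpensMeasurableSpace X] {μ : Measure X} [IsFiniteMeasure μ]
    {F : X → ℝ} (hF : Continuous F) : Integrable F μ := by
  obtain ⟨c, hc⟩ := isCompact_univ.exists_bound_of_continuousOn hF.continuousOn
  exact integrable_of_abs_le hF.measurable fun x => hc x (mem_univ x)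

/-- The intermediate value theorem between the extreme values of Q, where the argument of `argmax`
has constant sign and `argmax 0 = 1` decides the comparison. The solution is the population
multiplier. -/
theorem exists_integral_argmax_eq_one (hS : S.Valid) (hQc : Continuous Q) (hQ : Monotone Q) :
    ∃ μ, ∫ u, S.argmax (Q u - μ) = 1 := by
  have hcont : ∀ μ, Continuous fun u => S.argmax (Q u - μ) := fun μ =>
    hS.continuous_argmax.comp (hQc.sub continuous_const)
  have hint : ∀ μ, Integrable fun u => S.argmax (Q u - μ) := fun μ =>
    integrable_of_continuous (hcont μ)
  have hC : Continuous fun μ => ∫ u, S.argmax (Q u - μ) := by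
    have : LipschitzWith (Real.toNNReal (1 / (S.kappa * S.eta)))
        fun μ => ∫ u, S.argmax (Q u - μ) := by
      refine LipschitzWith.of_dist_le_mul fun a b => ?_
      rw [Real.dist_eq, Real.dist_eq, ← integral_sub (hint a) (hint b)]
      refine (abs_integral_le_integral_abs).trans ?_
      have h1 : ∀ u, |S.argmax (Q u - a) - S.argmax (Q u - b)| ≤
          Real.toNNReal (1 / (S.kappa * S.eta)) * |a - b| := by
        intro u
        refine (hS.abs_argmax_sub_le _ _).trans ?_
        rw [show Q u - a - (Q u - b) = -(a - b) by ring, abs_neg, div_eq_inv_mul, ← one_div]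
        gcongr
        exact Real.le_coe_toNNReal _
      refine (integral_mono ((hint a).sub (hint b)).abs (integrable_const _) h1).trans ?_
      simp
    exact this.continuous
  have h0 : 1 ≤ ∫ u, S.argmax (Q u - Q 0) := by
    have : ∫ _u : unitInterval, (1 : ℝ) ≤ ∫ u, S.argmax (Q u - Q 0) := by
      refine integral_mono (integrable_const _) (hint _) fun u => ?_
      rw [← hS.argmax_zero]
      exact hS.argmax_mono (sub_nonneg.2 (hQ u.2.1))
    simpa using this
  have h1 : ∫ u, S.argmax (Q u - Q 1) ≤ 1 := by
    have : ∫ u, S.argmax (Q u - Q 1) ≤ ∫ _u : unitInterval, (1 : ℝ) := by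
      refine integral_mono (hint _) (integrable_const _) fun u => ?_
      simp only
      rw [← hS.argmax_zero]
      exact hS.argmax_mono (sub_nonpos.2 (hQ u.2.2))
    simpa using this
  obtain ⟨μ, -, hμ⟩ := intermediate_value_Icc' (hQ (show (0 : unitInterval) ≤ 1 from (1 : unitInterval).2.1))
    hC.continuousOn ⟨h1, h0⟩
  exact ⟨μ, hμ⟩

variable {m : ℕ}

theorem integral_mean_comp_coord (hm : 0 < m) {F : unitInterval → ℝ} (hF : Continuous F) :
    ∫ y : Fin m → unitInterval, 1 / (m : ℝ) * ∑ j, F (y j) = ∫ u, F u := by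
  have hm' : (m : ℝ) ≠ 0 := by exact_mod_cast hm.ne'
  have hi : ∀ j ∈ Finset.univ, Integrable fun y : Fin m → unitInterval => F (y j) := fun j _ =>
    integrable_of_continuous (hF.comp (continuous_apply j))
  rw [integral_const_mul, integral_finsetSum _ hi]
  simp_rw [integral_comp_coord hF.measurable]
  rw [Finset.sum_const, Finset.card_univ, Fintype.card_fin, nsmul_eq_mul, ← mul_assoc,
    one_div_mul_cancel hm', one_mul]

/-- Lower bound on the dual objective of a sample by linearization along an ordered coupling. -/
theorem le_dualValue_comp (hS : S.Valid) (hQc : Continuous Q) {μ : ℝ}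
    (hμ : ∫ u, S.argmax (Q u - μ) = 1) (hm : 0 < m) (x : Fin m → unitInterval) (μ' : ℝ) :
    μ + (∫ u, conj S.phi S.eta (Q u - μ)) - 1 / m * ∫ y : Fin m → unitInterval,
      ∑ k, S.argmax (Q (ordStat y k) - μ) * (Q (ordStat y k) - Q (ordStat x k)) ≤
      S.dualValue (fun j => Q (x j)) μ' := by
  have hm' : (0 : ℝ) < m := by exact_mod_cast hm
  have hac := hS.continuous_argmax
  have hcj := hS.continuous_conj
  have hrc : Continuous fun u => S.argmax (Q u - μ) :=
    hS.continuous_argmax.comp (hQc.sub continuous_const)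
  have hcc : Continuous fun u => conj S.phi S.eta (Q u - μ) :=
    hS.continuous_conj.comp (hQc.sub continuous_const)
  have hO : ∀ k, Measurable fun y : Fin m → unitInterval => ordStat y k := measurable_ordStat
  have hI1 : Integrable fun y : Fin m → unitInterval =>
      ∑ k, S.argmax (Q (ordStat y k) - μ) * (Q (ordStat y k) - Q (ordStat x k)) := by
    refine integrable_finsetSum _ fun k _ => ?_
    have h2 : Continuous fun u => S.argmax (Q u - μ) * (Q u - Q (ordStat x k)) :=
      hrc.mul (hQc.sub continuous_const)
    obtain ⟨c, hc⟩ := isCompact_univ.exists_bound_of_continuousOn h2.continuousOn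
    exact integrable_of_abs_le (h2.measurable.comp (hO k)) fun y => hc _ (mem_univ _)
  have hI2 : Integrable fun y : Fin m → unitInterval =>
      1 / m * ∑ j, conj S.phi S.eta (Q (y j) - μ) :=
    integrable_of_continuous (by fun_prop)
  have hI3 : Integrable fun y : Fin m → unitInterval =>
      (μ - μ') * (1 / m * ∑ j, S.argmax (Q (y j) - μ)) :=
    integrable_of_continuous (by fun_prop)
  -- The conjugate at the k-th smallest data value is linearized at the k-th smallest value of y.
  -- After integration over y the slope has mean 1, so μ' cancels and the bound holds for every
  -- multiplier, also one that depends on x.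
  have hpt : ∀ y : Fin m → unitInterval, μ' + 1 / m * ∑ j, conj S.phi S.eta (Q (y j) - μ) +
      (μ - μ') * (1 / m * ∑ j, S.argmax (Q (y j) - μ)) - 1 / m *
      ∑ k, S.argmax (Q (ordStat y k) - μ) * (Q (ordStat y k) - Q (ordStat x k)) ≤
      S.dualValue (fun j => Q (x j)) μ' := by
    intro y
    unfold Penalty.dualValue
    rw [← sum_ordStat x fun a => conj S.phi S.eta (Q a - μ'),
      ← sum_ordStat y fun a => conj S.phi S.eta (Q a - μ),
      ← sum_ordStat y fun a => S.argmax (Q a - μ)]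
    have h1 : ∑ k, (conj S.phi S.eta (Q (ordStat y k) - μ) + S.argmax (Q (ordStat y k) - μ) *
        ((Q (ordStat x k) - μ') - (Q (ordStat y k) - μ))) ≤
        ∑ k, conj S.phi S.eta (Q (ordStat x k) - μ') :=
      Finset.sum_le_sum fun k _ => hS.conj_add_le _ _
    have h2 : ∑ k, (conj S.phi S.eta (Q (ordStat y k) - μ) + S.argmax (Q (ordStat y k) - μ) *
        ((Q (ordStat x k) - μ') - (Q (ordStat y k) - μ))) =
        ∑ k, conj S.phi S.eta (Q (ordStat y k) - μ) +
          (μ - μ') * ∑ k, S.argmax (Q (ordStat y k) - μ) -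
          ∑ k, S.argmax (Q (ordStat y k) - μ) * (Q (ordStat y k) - Q (ordStat x k)) := by
      rw [Finset.mul_sum, ← Finset.sum_add_distrib, ← Finset.sum_sub_distrib]
      exact Finset.sum_congr rfl fun k _ => by ring
    rw [h2] at h1
    have h3 := mul_le_mul_of_nonneg_left h1 (by positivity : (0 : ℝ) ≤ 1 / m)
    linarith
  have h1 := integral_mono ((((integrable_const μ').add hI2).add hI3).sub (hI1.const_mul (1 / (m : ℝ))))
    (integrable_const _) hpt
  simp only [integral_const, probReal_univ, smul_eq_mul, one_mul] at h1
  refine le_trans (le_of_eq ?_) h1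
  change _ = ∫ y : Fin m → unitInterval, ((μ' + 1 / m * ∑ j, conj S.phi S.eta (Q (y j) - μ)) +
      (μ - μ') * (1 / m * ∑ j, S.argmax (Q (y j) - μ))) - 1 / m *
      ∑ k, S.argmax (Q (ordStat y k) - μ) * (Q (ordStat y k) - Q (ordStat x k))
  have hI4 : Integrable fun y : Fin m → unitInterval =>
      μ' + 1 / m * ∑ j, conj S.phi S.eta (Q (y j) - μ) := (integrable_const μ').add hI2
  have hI5 : Integrable fun y : Fin m → unitInterval =>
      μ' + 1 / m * ∑ j, conj S.phi S.eta (Q (y j) - μ) +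
      (μ - μ') * (1 / m * ∑ j, S.argmax (Q (y j) - μ)) := hI4.add hI3
  rw [integral_sub hI5 (hI1.const_mul _), integral_add hI4 hI3,
    integral_add (integrable_const _) hI2, integral_const_mul (μ - μ'),
    integral_mean_comp_coord hm hrc, integral_mean_comp_coord hm hcc, hμ, integral_const_mul,
    integral_const, probReal_univ, one_smul]
  ring

/-- The expected displacement of values along the ordered coupling. -/
theorem integral_value_coupling_le (hS : S.Valid) (hQ : Monotone Q)
    (hG : ∀ u v : unitInterval, |Q u - Q v| ≤ G * |(u : ℝ) - v|) {μ : ℝ}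
    (hμ : ∫ u, S.argmax (Q u - μ) = 1) :
    ∫ q : (Fin m → unitInterval) × (Fin m → unitInterval),
      ∑ k, S.argmax (Q (ordStat q.2 k) - μ) * (Q (ordStat q.2 k) - Q (ordStat q.1 k)) ≤ G := by
  have hQc := continuous_of_abs_sub_le hG
  have hG0 : 0 ≤ G := by
    have := (abs_nonneg _).trans (hG 0 1)
    simpa using this
  have hrc : Continuous fun u => S.argmax (Q u - μ) :=
    hS.continuous_argmax.comp (hQc.sub continuous_const)
  have hac := hS.continuous_argmax
  have hr0 : ∀ u, 0 ≤ S.argmax (Q u - μ) := fun u => hS.argmax_nonneg _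
  obtain ⟨c, hc⟩ := isCompact_univ.exists_bound_of_continuousOn hrc.continuousOn
  have hcb : ∀ u, |S.argmax (Q u - μ)| ≤ c := fun u => hc u (mem_univ u)
  have hO : ∀ k, Measurable fun y : Fin m → unitInterval => ordStat y k := measurable_ordStat
  -- Exchanging the two samples symmetrizes the sum into products of increments of r and of F.
  have key : ∀ F : unitInterval → ℝ, Continuous F →
      Integrable (fun q : (Fin m → unitInterval) × (Fin m → unitInterval) =>
        ∑ k, S.argmax (Q (ordStat q.2 k) - μ) * (F (ordStat q.2 k) - F (ordStat q.1 k))) ∧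
      2 * ∫ q : (Fin m → unitInterval) × (Fin m → unitInterval),
        ∑ k, S.argmax (Q (ordStat q.2 k) - μ) * (F (ordStat q.2 k) - F (ordStat q.1 k)) =
      ∫ q : (Fin m → unitInterval) × (Fin m → unitInterval),
        ∑ k, (S.argmax (Q (ordStat q.2 k) - μ) - S.argmax (Q (ordStat q.1 k) - μ)) *
          (F (ordStat q.2 k) - F (ordStat q.1 k)) := by
    intro F hF
    have h2 : Continuous fun q : unitInterval × unitInterval =>
        S.argmax (Q q.2 - μ) * (F q.2 - F q.1) := by fun_prop
    obtain ⟨d, hd⟩ := isCompact_univ.exists_bound_of_continuousOn h2.continuousOn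
    have hi : Integrable (fun q : (Fin m → unitInterval) × (Fin m → unitInterval) =>
        ∑ k, S.argmax (Q (ordStat q.2 k) - μ) * (F (ordStat q.2 k) - F (ordStat q.1 k))) := by
      refine integrable_finsetSum _ fun k _ => ?_
      exact integrable_of_abs_le (h2.measurable.comp (((hO k).comp measurable_fst).prodMk
        ((hO k).comp measurable_snd))) fun q => hd (_, _) (mem_univ _)
    have hsw := integral_prod_swap (μ := (volume : Measure (Fin m → unitInterval)))
      (ν := (volume : Measure (Fin m → unitInterval)))
      fun q : (Fin m → unitInterval) × (Fin m → unitInterval) =>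
        ∑ k, S.argmax (Q (ordStat q.2 k) - μ) * (F (ordStat q.2 k) - F (ordStat q.1 k))
    have his := hi.swap
    refine ⟨hi, ?_⟩
    rw [two_mul]
    nth_rewrite 2 [show (volume : Measure ((Fin m → unitInterval) × (Fin m → unitInterval))) =
      (volume : Measure (Fin m → unitInterval)).prod volume from rfl]
    rw [← hsw]
    refine (integral_add hi his).symm.trans (integral_congr_ae (Eventually.of_forall fun q => ?_))
    simp only [Function.comp, Prod.fst_swap, Prod.snd_swap]
    rw [← Finset.sum_add_distrib]
    exact Finset.sum_congr rfl fun k _ => by ring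
  obtain ⟨hi1, he1⟩ := key Q hQc
  obtain ⟨hi2, he2⟩ := key (fun u => (u : ℝ)) continuous_subtype_val
  have hcoup := integral_coupling_le (m := m) hrc.measurable hr0 hcb
  rw [hμ] at hcoup
  have hi3 : ∀ F : unitInterval → ℝ, Continuous F →
      Integrable (fun q : (Fin m → unitInterval) × (Fin m → unitInterval) =>
        ∑ k, (S.argmax (Q (ordStat q.2 k) - μ) - S.argmax (Q (ordStat q.1 k) - μ)) *
          (F (ordStat q.2 k) - F (ordStat q.1 k))) := by
    intro F hF
    have h2 : Continuous fun q : unitInterval × unitInterval =>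
        (S.argmax (Q q.2 - μ) - S.argmax (Q q.1 - μ)) * (F q.2 - F q.1) := by fun_prop
    obtain ⟨d, hd⟩ := isCompact_univ.exists_bound_of_continuousOn h2.continuousOn
    refine integrable_finsetSum _ fun k _ => ?_
    exact integrable_of_abs_le (h2.measurable.comp (((hO k).comp measurable_fst).prodMk
      ((hO k).comp measurable_snd))) fun q => hd (_, _) (mem_univ _)
  -- The increments of r and Q have the same sign, so the Lipschitz bound may be applied inside the
  -- product; without symmetrization the sign would be uncontrolled.
  have hle : ∀ u v : unitInterval, (S.argmax (Q v - μ) - S.argmax (Q u - μ)) * (Q v - Q u) ≤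
      G * ((S.argmax (Q v - μ) - S.argmax (Q u - μ)) * ((v : ℝ) - u)) := by
    intro u v
    rcases le_total u v with huv | huv
    · have h1 : S.argmax (Q u - μ) ≤ S.argmax (Q v - μ) :=
        hS.argmax_mono (by linarith [hQ huv])
      have h2 : Q v - Q u ≤ G * ((v : ℝ) - u) := by
        have := (le_abs_self _).trans (hG v u)
        rwa [abs_of_nonneg (sub_nonneg.2 (show (u : ℝ) ≤ v from huv))] at this
      have := mul_le_mul_of_nonneg_left h2 (sub_nonneg.2 h1)
      linarith
    · have h1 : S.argmax (Q v - μ) ≤ S.argmax (Q u - μ) :=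
        hS.argmax_mono (by linarith [hQ huv])
      have h2 : Q u - Q v ≤ G * ((u : ℝ) - v) := by
        have := (le_abs_self _).trans (hG u v)
        rwa [abs_of_nonneg (sub_nonneg.2 (show (v : ℝ) ≤ u from huv))] at this
      have := mul_le_mul_of_nonneg_left h2 (sub_nonneg.2 h1)
      linarith
  have hfin : ∫ q : (Fin m → unitInterval) × (Fin m → unitInterval),
        ∑ k, (S.argmax (Q (ordStat q.2 k) - μ) - S.argmax (Q (ordStat q.1 k) - μ)) *
          (Q (ordStat q.2 k) - Q (ordStat q.1 k)) ≤
      ∫ q : (Fin m → unitInterval) × (Fin m → unitInterval),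
        G * ∑ k, (S.argmax (Q (ordStat q.2 k) - μ) - S.argmax (Q (ordStat q.1 k) - μ)) *
          (((ordStat q.2 k : unitInterval) : ℝ) - (ordStat q.1 k : unitInterval)) := by
    refine integral_mono (hi3 Q hQc) ((hi3 _ continuous_subtype_val).const_mul G) fun q => ?_
    simp only
    rw [Finset.mul_sum]
    exact Finset.sum_le_sum fun k _ => hle _ _
  rw [integral_const_mul, ← he1, ← he2] at hfin
  have := mul_le_mul_of_nonneg_left hcoup hG0
  linarith

/-- The optimal value of a sample of size `m` underestimates the population value by at most
`G / m` on average. -/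
theorem integral_dualValue_muStar_mem (hS : S.Valid) (hQ : Monotone Q)
    (hG : ∀ u v : unitInterval, |Q u - Q v| ≤ G * |(u : ℝ) - v|) {μ : ℝ}
    (hμ : ∫ u, S.argmax (Q u - μ) = 1) (hm : 0 < m) :
    ∫ x : Fin m → unitInterval, S.dualValue (fun j => Q (x j)) (S.muStar fun j => Q (x j)) ∈
      Icc (μ + (∫ u, conj S.phi S.eta (Q u - μ)) - G / m)
        (μ + ∫ u, conj S.phi S.eta (Q u - μ)) := by
  have hm' : (0 : ℝ) < m := by exact_mod_cast hm
  have hac := hS.continuous_argmax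
  have hcj := hS.continuous_conj
  have hQc := continuous_of_abs_sub_le hG
  have hrc : Continuous fun u => S.argmax (Q u - μ) :=
    hS.continuous_argmax.comp (hQc.sub continuous_const)
  have hcc : Continuous fun u => conj S.phi S.eta (Q u - μ) :=
    hS.continuous_conj.comp (hQc.sub continuous_const)
  have hV : Measurable fun x : Fin m → unitInterval => fun j => Q (x j) :=
    measurable_pi_lambda _ fun j => hQc.measurable.comp (measurable_pi_apply j)
  obtain ⟨c, hc⟩ := isCompact_univ.exists_bound_of_continuousOn hQc.continuousOn
  have hD : Integrable fun x : Fin m → unitInterval =>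
      S.dualValue (fun j => Q (x j)) (S.muStar fun j => Q (x j)) := by
    refine integrable_of_abs_le (hS.measurable_dualValue hV ((hS.measurable_muStar hm).comp hV))
      (c := m * c) fun x => ?_
    refine (hS.abs_dualValue_muStar_le _ hm).trans ?_
    refine (Finset.sum_le_sum fun j _ => hc (x j) (mem_univ _)).trans ?_
    simp
  have hI2 : Integrable fun y : Fin m → unitInterval =>
      1 / m * ∑ j, conj S.phi S.eta (Q (y j) - μ) :=
    integrable_of_continuous (by fun_prop)
  constructor
  · have hpt : ∀ x : Fin m → unitInterval, _ := fun x =>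
      le_dualValue_comp hS hQc hμ hm x (S.muStar fun j => Q (x j))
    have h2 : Continuous fun q : unitInterval × unitInterval =>
        S.argmax (Q q.2 - μ) * (Q q.2 - Q q.1) := by fun_prop
    obtain ⟨d, hd⟩ := isCompact_univ.exists_bound_of_continuousOn h2.continuousOn
    have hi : Integrable (fun q : (Fin m → unitInterval) × (Fin m → unitInterval) =>
        ∑ k, S.argmax (Q (ordStat q.2 k) - μ) * (Q (ordStat q.2 k) - Q (ordStat q.1 k)))
        ((volume : Measure (Fin m → unitInterval)).prod volume) := by
      refine integrable_finsetSum _ fun k _ => ?_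
      exact integrable_of_abs_le (h2.measurable.comp
        (((measurable_ordStat k).comp measurable_fst).prodMk
        ((measurable_ordStat k).comp measurable_snd))) fun q => hd (_, _) (mem_univ _)
    have h3 := integral_mono ((integrable_const _).sub (hi.integral_prod_left.const_mul
      (1 / (m : ℝ)))) hD hpt
    refine le_trans ?_ h3
    have h4 := integral_prod _ hi
    have h5 := integral_value_coupling_le (m := m) hS hQ hG hμ
    change ∫ q, _ ∂((volume : Measure (Fin m → unitInterval)).prod volume) ≤ G at h5
    rw [h4] at h5
    change _ ≤ ∫ x : Fin m → unitInterval, (μ + (∫ u, conj S.phi S.eta (Q u - μ))) - 1 / m *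
      ∫ y : Fin m → unitInterval,
      ∑ k, S.argmax (Q (ordStat y k) - μ) * (Q (ordStat y k) - Q (ordStat x k))
    rw [integral_sub (integrable_const _) (hi.integral_prod_left.const_mul _), integral_const_mul,
      integral_const, probReal_univ, one_smul, div_eq_mul_one_div, mul_comm G]
    have := mul_le_mul_of_nonneg_left h5 (by positivity : (0 : ℝ) ≤ 1 / m)
    linarith
  -- The sample minimum is at most the sample dual value at the fixed population multiplier μ, whose
  -- mean is the population value.
  · have h3 := integral_mono hD ((integrable_const μ).add hI2) fun x =>
      hS.dualValue_muStar_le (fun j => Q (x j)) hm μ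
    refine h3.trans (le_of_eq ?_)
    change ∫ y : Fin m → unitInterval, μ + 1 / m * ∑ j, conj S.phi S.eta (Q (y j) - μ) = _
    rw [integral_add (integrable_const _) hI2, integral_const, probReal_univ, one_smul,
      integral_mean_comp_coord hm hcc]

end QuantileSAA

end

end PhiDRO

namespace PhiDRO

noncomputable section

/-! ### Quantile representation of a distribution on the line -/

section Quantile

variable {μ : Measure ℝ} [IsProbabilityMeasure μ] {G : ℝ}

/-- Right continuity of the cdf makes the infimum a minimum, which yields the Galois connection. -/
theorem quantile_le_iff {u : ℝ} (hu : u ∈ Ioo (0 : ℝ) 1) (t : ℝ) :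
    quantile μ u ≤ t ↔ u ≤ μ.real (Iic t) := by
  have hF : ∀ t, μ.real (Iic t) = cdf μ t := fun t => (cdf_eq_real μ t).symm
  have hmono : Monotone (cdf μ) := monotone_cdf μ
  have hne : {t : ℝ | u ≤ μ.real (Iic t)}.Nonempty := by
    obtain ⟨t, ht⟩ := ((tendsto_cdf_atTop μ).eventually (lt_mem_nhds hu.2)).exists
    exact ⟨t, by simpa [hF] using ht.le⟩
  have hbdd : BddBelow {t : ℝ | u ≤ μ.real (Iic t)} := by
    obtain ⟨t, ht⟩ := ((tendsto_cdf_atBot μ).eventually (gt_mem_nhds hu.1)).exists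
    refine ⟨t, fun s hs => ?_⟩
    by_contra hcon
    have h1 : u ≤ cdf μ s := by simpa [hF] using hs
    exact absurd (h1.trans (hmono (not_le.1 hcon).le)) (not_le.2 ht)
  constructor
  · intro h
    have hgt : ∀ s, t < s → u ≤ cdf μ s := by
      intro s hs
      obtain ⟨r, hr, hrs⟩ := exists_lt_of_csInf_lt hne (h.trans_lt hs)
      have h1 : u ≤ cdf μ r := by simpa [hF] using hr
      exact h1.trans (hmono hrs.le)
    rw [hF]
    have hc := ((cdf μ).right_continuous t).mono Ioi_subset_Ici_self
    refine ge_of_tendsto hc ?_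
    filter_upwards [self_mem_nhdsWithin] with s hs using hgt s hs
  · intro h
    exact csInf_le hbdd h

theorem quantile_mono {u v : ℝ} (hu : u ∈ Ioo (0 : ℝ) 1) (hv : v ∈ Ioo (0 : ℝ) 1) (huv : u ≤ v) :
    quantile μ u ≤ quantile μ v :=
  (quantile_le_iff hu _).2 (huv.trans ((quantile_le_iff hv _).1 le_rfl))

/-- A Lipschitz inverse cdf extends to the closed unit interval, where it transports the uniform
distribution to the given one. -/
theorem exists_quantile_extension (hG : LipschitzQuantile μ G) :
    ∃ Q : unitInterval → ℝ, Monotone Q ∧ (∀ u v, |Q u - Q v| ≤ G * |(u : ℝ) - v|) ∧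
      (volume : Measure unitInterval).map Q = μ := by
  have hG0 : 0 ≤ G := by
    have := (abs_nonneg _).trans (hG (1 / 4) ⟨by norm_num, by norm_num⟩ (1 / 2)
      ⟨by norm_num, by norm_num⟩)
    norm_num at this
    linarith
  have hl : LipschitzOnWith (Real.toNNReal G) (quantile μ) (Ioo 0 1) := by
    refine LipschitzOnWith.of_dist_le_mul fun u hu v hv => ?_
    rw [Real.dist_eq, Real.dist_eq, Real.coe_toNNReal G hG0]
    exact hG u hu v hv
  obtain ⟨q, hq, heq⟩ := hl.extend_real
  have hQG : ∀ u v : unitInterval, |q u - q v| ≤ G * |(u : ℝ) - v| := by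
    intro u v
    have := hq.dist_le_mul u v
    rwa [Real.dist_eq, Real.dist_eq, Real.coe_toNNReal G hG0] at this
  refine ⟨fun u => q u, ?_, hQG, ?_⟩
  · intro u v huv
    -- Points are pulled slightly toward 1/2, into the open interval where the extension agrees with
    -- the monotone quantile function.
    have hlim : ∀ w : ℝ, Tendsto (fun d : ℝ => q ((1 - d) * w + d * (1 / 2))) (𝓝[>] 0)
        (𝓝 (q w)) := by
      intro w
      have hc : Continuous fun d : ℝ => q ((1 - d) * w + d * (1 / 2)) :=
        hq.continuous.comp (by fun_prop)
      have := (hc.tendsto 0).mono_left (nhdsWithin_le_nhds (s := Ioi (0 : ℝ)))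
      simpa using this
    refine le_of_tendsto_of_tendsto (hlim u) (hlim v) ?_
    have hI : Ioo (0 : ℝ) 1 ∈ 𝓝[>] (0 : ℝ) := Ioo_mem_nhdsGT one_pos
    filter_upwards [hI] with d hd
    have hin : ∀ w : unitInterval, (1 - d) * (w : ℝ) + d * (1 / 2) ∈ Ioo (0 : ℝ) 1 := by
      intro w
      have h1 : 0 < 1 - d := sub_pos.2 hd.2
      constructor
      · have := mul_nonneg h1.le w.2.1
        linarith [hd.1]
      · have := mul_le_mul_of_nonneg_left w.2.2 h1.le
        linarith [hd.1]
    rw [← heq (hin u), ← heq (hin v)]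
    refine quantile_mono (hin u) (hin v) ?_
    have h1 : 0 < 1 - d := sub_pos.2 hd.2
    have h2 : (u : ℝ) ≤ v := huv
    gcongr
  · have hQm : Measurable fun u : unitInterval => q u :=
      hq.continuous.measurable.comp measurable_subtype_coe
    have := Measure.isProbabilityMeasure_map (μ := (volume : Measure unitInterval)) hQm.aemeasurable
    refine Measure.ext_of_Iic _ _ fun t => ?_
    rw [Measure.map_apply hQm measurableSet_Iic]
    have hF : μ.real (Iic t) ∈ unitInterval := ⟨measureReal_nonneg, measureReal_le_one⟩
    have h0 : ∀ᵐ u : unitInterval, u ≠ 0 := by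
      rw [ae_iff]
      refine measure_mono_null (t := Iic 0) ?_ (by simp [unitInterval.volume_Iic])
      intro u hu
      simpa using hu
    have h1 : ∀ᵐ u : unitInterval, u ≠ 1 := by
      rw [ae_iff]
      refine measure_mono_null (t := Ici 1) ?_ (by simp [unitInterval.volume_Ici])
      intro u hu
      have : u = 1 := by simpa using hu
      exact this.ge
    -- The two endpoints, where the Galois connection is not available, are null.
    have h2 : (fun u : unitInterval => q u) ⁻¹' Iic t =ᵐ[volume] Iic ⟨μ.real (Iic t), hF⟩ := by
      filter_upwards [h0, h1] with u hu0 hu1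
      have hu : (u : ℝ) ∈ Ioo (0 : ℝ) 1 :=
        ⟨unitInterval.pos_iff_ne_zero.2 hu0, unitInterval.lt_one_iff_ne_one.2 hu1⟩
      refine propext ?_
      change q u ≤ t ↔ (u : ℝ) ≤ μ.real (Iic t)
      rw [← heq hu]
      exact quantile_le_iff hu t
    rw [measure_congr h2, unitInterval.volume_Iic, ofReal_measureReal]

end Quantile

/-! ### Duality -/

section Duality

variable {S : Penalty} {E : Type*} [MeasurableSpace E] {ν : Measure E} [IsProbabilityMeasure ν]
  {h : E → ℝ}

theorem integrable_comp_of_ae_abs_le (hh : Measurable h) {c : ℝ} (hc : ∀ᵐ x ∂ν, |h x| ≤ c)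
    {F : ℝ → ℝ} (hF : Continuous F) : Integrable (fun x => F (h x)) ν := by
  obtain ⟨d, hd⟩ := (isCompact_Icc (a := -c) (b := c)).exists_bound_of_continuousOn hF.continuousOn
  refine Integrable.of_bound (hF.measurable.comp hh).aestronglyMeasurable d ?_
  filter_upwards [hc] with x hx using hd _ (abs_le.1 hx)

/-- Strong duality. The density `argmax (h x - μ)` has mass 1 and attains the value; every
competitor is bounded by integrating the Fenchel–Young inequality at its density. -/
theorem robustValue_eq (hS : S.Valid) (hh : Measurable h) {c : ℝ} (hc : ∀ᵐ x ∂ν, |h x| ≤ c)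
    {μ : ℝ} (hμ : ∫ x, S.argmax (h x - μ) ∂ν = 1) :
    robustValue S.phi S.eta ν h = μ + ∫ x, conj S.phi S.eta (h x - μ) ∂ν := by
  have hac := hS.continuous_argmax
  have hcj := hS.continuous_conj
  have hφm : Measurable S.phi := hS.isDivergence.lsc.measurable
  have hη := hS.eta_pos
  have hrc : Continuous fun t => S.argmax (t - μ) := by fun_prop
  have hcc : Continuous fun t => conj S.phi S.eta (t - μ) := by fun_prop
  have hci := integrable_comp_of_ae_abs_le hh hc hcc
  have hri := integrable_comp_of_ae_abs_le hh hc hrc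
  refine IsGreatest.csSup_eq ⟨?_, ?_⟩
  · set s : E → ℝ := fun x => S.argmax (h x - μ) with hs
    have hs0 : ∀ x, 0 ≤ s x := fun x => hS.argmax_nonneg _
    have hsm : Measurable s := hrc.measurable.comp hh
    have hd : Measurable fun x => ENNReal.ofReal (s x) := hsm.ennreal_ofReal
    have hlt : ∀ᵐ x ∂ν, ENNReal.ofReal (s x) < ⊤ :=
      Eventually.of_forall fun _ => ENNReal.ofReal_lt_top
    have hfp : ∀ t, finPart S.phi (S.argmax t) = (t * S.argmax t - conj S.phi S.eta t) / S.eta := by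
      intro t
      rw [hS.conj_eq]
      field_simp
      ring
    have hpi : Integrable (fun x => finPart S.phi (s x)) ν := by
      simp_rw [hs, hfp]
      exact integrable_comp_of_ae_abs_le (F := fun t => ((t - μ) * S.argmax (t - μ) -
        conj S.phi S.eta (t - μ)) / S.eta) hh hc (by fun_prop)
    have hlint : ∫⁻ x, S.phi ((ν.withDensity fun x => ENNReal.ofReal (s x)).rnDeriv ν x).toReal ∂ν =
        ENNReal.ofReal (∫ x, finPart S.phi (s x) ∂ν) := by
      rw [ofReal_integral_eq_lintegral_ofReal hpi
        (Eventually.of_forall fun x => IsDivergence.finPart_nonneg _ _)]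
      refine lintegral_congr_ae ?_
      filter_upwards [Measure.rnDeriv_withDensity ν hd] with x hx
      rw [hx, ENNReal.toReal_ofReal (hs0 x), finPart, ENNReal.ofReal_toReal]
      exact (hS.argmax_spec _).1
    refine ⟨ν.withDensity fun x => ENNReal.ofReal (s x), ?_, withDensity_absolutelyContinuous _ _,
      ?_, ?_, ?_⟩
    · constructor
      rw [withDensity_apply _ MeasurableSet.univ, Measure.restrict_univ,
        ← ofReal_integral_eq_lintegral_ofReal hri (Eventually.of_forall hs0), hμ,
        ENNReal.ofReal_one]
    · rw [integrable_withDensity_iff_integrable_smul' hd hlt]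
      simp_rw [ENNReal.toReal_ofReal (hs0 _), smul_eq_mul]
      exact integrable_comp_of_ae_abs_le (F := fun t => S.argmax (t - μ) * t) hh hc (by fun_prop)
    · rw [hlint]
      exact ENNReal.ofReal_ne_top
    · rw [hlint, ENNReal.toReal_ofReal
        (integral_nonneg fun x => IsDivergence.finPart_nonneg _ _),
        integral_withDensity_eq_integral_toReal_smul hd hlt]
      simp_rw [ENNReal.toReal_ofReal (hs0 _), smul_eq_mul]
      have h1 : Integrable (fun x => s x * h x) ν :=
        integrable_comp_of_ae_abs_le (F := fun t => S.argmax (t - μ) * t) hh hc (by fun_prop)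
      have h2 : μ = ∫ x, μ * s x ∂ν := by rw [integral_const_mul, hμ, mul_one]
      nth_rewrite 1 [h2]
      rw [← integral_const_mul, ← integral_add (hri.const_mul μ) hci,
        ← integral_sub h1 (hpi.const_mul _)]
      refine integral_congr_ae (Eventually.of_forall fun x => ?_)
      simp only [hs]
      rw [hS.conj_eq]
      ring
  · rintro _ ⟨γ, hγ, hγν, hint, hfin, rfl⟩
    set d : E → ℝ := fun x => (γ.rnDeriv ν x).toReal with hd
    have hdm : Measurable d := (Measure.measurable_rnDeriv γ ν).ennreal_toReal
    have h1 : Integrable (fun x => d x * h x) ν := (integrable_rnDeriv_smul_iff hγν).2 hint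
    have h2 : ∫ x, d x * h x ∂ν = ∫ x, h x ∂γ := integral_rnDeriv_smul hγν
    have h3 : Integrable d ν := Measure.integrable_toReal_rnDeriv
    have h4 : ∫ x, d x ∂ν = 1 := by
      rw [hd, Measure.integral_toReal_rnDeriv hγν]
      simp
    have h5 : Integrable (fun x => finPart S.phi (d x)) ν :=
      integrable_toReal_of_lintegral_ne_top (hφm.comp hdm).aemeasurable hfin
    have h6 : ∀ᵐ x ∂ν, S.phi (d x) < ⊤ := ae_lt_top (hφm.comp hdm) hfin
    have h7 : (∫⁻ x, S.phi (d x) ∂ν).toReal = ∫ x, finPart S.phi (d x) ∂ν :=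
      (integral_toReal (hφm.comp hdm).aemeasurable h6).symm
    have h8 : μ + ∫ x, conj S.phi S.eta (h x - μ) ∂ν =
        ∫ x, (μ * d x + conj S.phi S.eta (h x - μ)) ∂ν := by
      rw [integral_add (h3.const_mul μ) hci, integral_const_mul, h4, mul_one]
    change _ - S.eta * (∫⁻ x, S.phi (d x) ∂ν).toReal ≤ _
    rw [h7, ← h2, ← integral_const_mul, ← integral_sub h1 (h5.const_mul _), h8]
    refine integral_mono_ae (h1.sub (h5.const_mul _)) ((h3.const_mul μ).add hci) ?_
    filter_upwards [h6] with x hx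
    have := hS.le_conj (h x - μ) hx.ne
    linarith

/-- The optimal value of an i.i.d. sample of size `m` underestimates the robust value by at most
`G / m` on average, if the inverse cdf of the loss is `G`-Lipschitz. -/
theorem integral_dualValue_muStar_pi_mem (hS : S.Valid) (hh : Measurable h) {G : ℝ}
    (hG : LipschitzQuantile (ν.map h) G) {m : ℕ} (hm : 0 < m) :
    ∫ w : Fin m → E, S.dualValue (fun j => h (w j)) (S.muStar fun j => h (w j))
      ∂(Measure.pi fun _ => ν) ∈
      Icc (robustValue S.phi S.eta ν h - G / m) (robustValue S.phi S.eta ν h) := by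
  have := Measure.isProbabilityMeasure_map (μ := ν) hh.aemeasurable
  obtain ⟨Q, hQ, hQG, hlaw⟩ := exists_quantile_extension hG
  have hQc := continuous_of_abs_sub_le hQG
  obtain ⟨μ, hμ⟩ := exists_integral_argmax_eq_one hS hQc hQ
  obtain ⟨c, hc⟩ := isCompact_univ.exists_bound_of_continuousOn hQc.continuousOn
  have htr : ∀ F : ℝ → ℝ, Continuous F → ∫ x, F (h x) ∂ν = ∫ u, F (Q u) := by
    intro F hF
    rw [← integral_map hh.aemeasurable hF.aestronglyMeasurable, ← hlaw,
      integral_map hQc.measurable.aemeasurable hF.aestronglyMeasurable]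
  have hcb : ∀ᵐ x ∂ν, |h x| ≤ c := by
    have h1 : ∀ᵐ t ∂(ν.map h), |t| ≤ c := by
      rw [← hlaw, ae_map_iff hQc.measurable.aemeasurable
        (measurableSet_le continuous_abs.measurable measurable_const)]
      exact Eventually.of_forall fun u => hc u (mem_univ u)
    exact ae_of_ae_map hh.aemeasurable h1
  have hac := hS.continuous_argmax
  have hcj := hS.continuous_conj
  have hμν : ∫ x, S.argmax (h x - μ) ∂ν = 1 := by
    rw [htr (fun t => S.argmax (t - μ)) (by fun_prop), hμ]
  rw [robustValue_eq hS hh hcb hμν, htr (fun t => conj S.phi S.eta (t - μ)) (by fun_prop)]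
  have hkey := integral_dualValue_muStar_mem hS hQ hQG hμ hm
  have hΦ : Measurable fun v : Fin m → ℝ => S.dualValue v (S.muStar v) :=
    hS.measurable_dualValue measurable_id (hS.measurable_muStar hm)
  -- The losses of an i.i.d. sample and Q of uniform variables have the same joint law, so the
  -- estimate on the unit interval transfers.
  have hmap : (Measure.pi fun _ : Fin m => ν).map (fun w j => h (w j)) =
      (Measure.pi fun _ : Fin m => (volume : Measure unitInterval)).map fun x j => Q (x j) := by
    have i1 : ∀ _ : Fin m, SigmaFinite (ν.map h) := fun _ => inferInstance
    have i2 : ∀ _ : Fin m, SigmaFinite ((volume : Measure unitInterval).map Q) := fun _ => by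
      rw [hlaw]; infer_instance
    rw [Measure.pi_map_pi fun _ => hh.aemeasurable,
      Measure.pi_map_pi fun _ => hQc.measurable.aemeasurable, hlaw]
  have hhm : Measurable fun (w : Fin m → E) j => h (w j) :=
    measurable_pi_lambda _ fun j => hh.comp (measurable_pi_apply j)
  have hQm : Measurable fun (x : Fin m → unitInterval) j => Q (x j) :=
    measurable_pi_lambda _ fun j => hQc.measurable.comp (measurable_pi_apply j)
  rw [← integral_map (φ := fun (w : Fin m → E) j => h (w j)) hhm.aemeasurable
    hΦ.aestronglyMeasurable, hmap, integral_map hQm.aemeasurable hΦ.aestronglyMeasurable]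
  exact hkey

end Duality

/-! ### The bias of the surrogate objective -/

section Bias

variable {E : Type*} [NormedAddCommGroup E] [MeasureSpace E] [BorelSpace E]
  [(volume : Measure E).IsAddHaarMeasure] [NormedSpace ℝ E] [FiniteDimensional ℝ E]
  {P : Measure E} [IsProbabilityMeasure P] {ρ : ℝ} {S : Penalty} {h : E → ℝ} {G : ℝ}

/-- The estimate with error G/m is applied for each z and then integrated. It also gives
measurability of the robust value in z: this is an almost everywhere limit of kernel integrals of
sample values. The case m = 1 provides domination. -/
theorem integrable_robustValue_and_bias (hS : S.Valid) (hρ : 0 < ρ) (hh : Measurable h)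
    (hG : ∀ z ∈ P.support, LipschitzQuantile ((unifBall ρ z).map h) G)
    (hint : Integrable (fun ζ : E × (Fin (2 ^ 0) → E) => h (ζ.2 0)) (sampleLaw P ρ 0)) :
    Integrable (fun z => robustValue S.phi S.eta (unifBall ρ z) h) P ∧
      ∀ m : ℕ, 0 < m → ∫ ζ : E × (Fin m → E), S.dualValue (fun j => h (ζ.2 j))
        (S.muStar fun j => h (ζ.2 j)) ∂(jointLaw P ρ m) ∈
        Icc (objective S P ρ h - G / m) (objective S P ρ h) := by
  set R : E → ℝ := fun z => robustValue S.phi S.eta (unifBall ρ z) h with hR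
  set A : ℕ → E → ℝ := fun m z => ∫ w : Fin m → E, S.dualValue (fun j => h (w j))
    (S.muStar fun j => h (w j)) ∂(sampleKernel E ρ m z) with hA
  have hD : ∀ m, 0 < m → Integrable (fun ζ : E × (Fin m → E) => S.dualValue (fun j => h (ζ.2 j))
      (S.muStar fun j => h (ζ.2 j))) (jointLaw P ρ m) := fun m hm =>
    integrable_dualValue_muStar hS hh hm fun i => integrable_sample hρ hint i
  have hAi : ∀ m : ℕ, 0 < m → Integrable (A m) P := by
    intro m hm
    have := isMarkovKernel_sampleKernel (E := E) hρ m
    exact (hD m hm).integral_compProd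
  have hAeq : ∀ m : ℕ, 0 < m → ∫ ζ : E × (Fin m → E), S.dualValue (fun j => h (ζ.2 j))
        (S.muStar fun j => h (ζ.2 j)) ∂(jointLaw P ρ m) = ∫ z, A m z ∂P := by
    intro m hm
    have := isMarkovKernel_sampleKernel (E := E) hρ m
    exact Measure.integral_compProd (hD m hm)
  have hmem : ∀ᵐ z ∂P, ∀ m : ℕ, 0 < m → A m z ∈ Icc (R z - G / m) (R z) := by
    filter_upwards [ae_mem_support P] with z hz m hm
    have := isProbabilityMeasure_unifBall hρ z
    exact integral_dualValue_muStar_pi_mem hS hh (hG z hz) hm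
  have hRi : Integrable R P := by
    have hmeas : AEStronglyMeasurable R P := by
      refine aestronglyMeasurable_of_tendsto_ae atTop (f := fun k => A (k + 1))
        (fun k => (hAi (k + 1) k.succ_pos).aestronglyMeasurable) ?_
      filter_upwards [hmem] with z hz
      have hlim : Tendsto (fun k : ℕ => R z - G * (1 / ((k : ℝ) + 1))) atTop (𝓝 (R z)) := by
        simpa using (tendsto_one_div_add_atTop_nhds_zero_nat.const_mul G).const_sub (R z)
      refine tendsto_of_tendsto_of_tendsto_of_le_of_le hlim tendsto_const_nhds ?_ ?_
      · intro k
        have := (hz (k + 1) k.succ_pos).1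
        push_cast at this
        rwa [div_eq_mul_one_div] at this
      · intro k
        exact (hz (k + 1) k.succ_pos).2
    refine Integrable.mono' ((hAi 1 one_pos).abs.add (integrable_const |G|)) hmeas ?_
    filter_upwards [hmem] with z hz
    have h1 := hz 1 one_pos
    rw [Nat.cast_one, div_one] at h1
    simp only [Pi.add_apply, Real.norm_eq_abs]
    rw [abs_le]
    constructor
    · linarith [neg_abs_le (A 1 z), abs_nonneg G, h1.2]
    · linarith [le_abs_self (A 1 z), le_abs_self G, h1.1]
  refine ⟨hRi, fun m hm => ?_⟩
  rw [hAeq m hm]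
  constructor
  · have h1 : ∫ z, (R z - G / m) ∂P ≤ ∫ z, A m z ∂P := by
      refine integral_mono_ae (hRi.sub (integrable_const _)) (hAi m hm) ?_
      filter_upwards [hmem] with z hz using (hz m hm).1
    rw [integral_sub hRi (integrable_const _), integral_const, probReal_univ, one_smul] at h1
    exact h1
  · refine integral_mono_ae (hAi m hm) hRi ?_
    filter_upwards [hmem] with z hz using (hz m hm).2

theorem abs_surrogate_sub_objective_le {p : ℕ} (hS : S.Valid) {ε : ℝ} (hε : 0 < ε) (hρ : 0 < ρ)
    {f : EuclideanSpace ℝ (Fin p) → E → ℝ} {θ : EuclideanSpace ℝ (Fin p)}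
    (hh : Measurable (f θ))
    (hG : ∀ z ∈ P.support, LipschitzQuantile ((unifBall ρ z).map (f θ)) G)
    (hint : Integrable (fun ζ : E × (Fin (2 ^ 0) → E) => f θ (ζ.2 0)) (sampleLaw P ρ 0)) (L : ℕ) :
    |surrogate S ε P ρ L f θ θ - objective S P ρ (f θ)| ≤ ε + G * (2 : ℝ)⁻¹ ^ L := by
  have hm : 0 < 2 ^ L := by positivity
  have := isProbabilityMeasure_jointLaw (P := P) hρ (2 ^ L)
  have h1 := (integrable_robustValue_and_bias (S := S) hS hρ hh hG hint).2 (2 ^ L) hm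
  have hi : ∀ i : Fin (2 ^ L), Integrable (fun ζ : E × (Fin (2 ^ L) → E) => f θ (ζ.2 i))
    (jointLaw P ρ (2 ^ L)) := fun i => integrable_sample hρ hint i
  have hi1 := integrable_dualValue_muStar hS hh hm hi
  have hi2 := integrable_dualValue_outMu hS hε hρ hh hm hi
  have h2 : ∫ ζ : E × (Fin (2 ^ L) → E), S.dualValue (fun j => f θ (ζ.2 j))
      (S.muStar fun j => f θ (ζ.2 j)) ∂(jointLaw P ρ (2 ^ L)) ≤ surrogate S ε P ρ L f θ θ :=
    integral_mono hi1 hi2 fun ζ => hS.dualValue_muStar_le _ hm _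
  have h3 : surrogate S ε P ρ L f θ θ ≤ ∫ ζ : E × (Fin (2 ^ L) → E),
      (S.dualValue (fun j => f θ (ζ.2 j)) (S.muStar fun j => f θ (ζ.2 j)) + ε)
        ∂(jointLaw P ρ (2 ^ L)) :=
    integral_mono hi2 (hi1.add (integrable_const _)) fun ζ => hS.dualValue_outMu_le _ hm hε
  rw [integral_add hi1 (integrable_const _), integral_const, probReal_univ, one_smul] at h3
  have h4 : G / ((2 ^ L : ℕ) : ℝ) = G * (2 : ℝ)⁻¹ ^ L := by
    push_cast
    rw [inv_pow, div_eq_mul_inv]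
  rw [h4] at h1
  rw [abs_le]
  constructor <;> linarith [h1.1, h1.2]

end Bias

end

end PhiDRO

set_option linter.unusedSectionVars false

namespace PhiDRO

noncomputable section

/-! ### Costs -/

section Cost

/-- The initial interval has length at most W, which depends on the penalty and B only. So the
number of steps is a constant plus half of log₂(1/ε). -/
theorem exists_iterations_bound {S : Penalty} (hS : S.Valid) (B : ℝ) :
    ∃ A : ℝ, 0 < A ∧ ∀ ε : ℝ, 0 < ε → ε ≤ 1 / 2 → ∀ (m : ℕ) (v : Fin m → ℝ), 0 < m →
      (∀ i j, v i ≤ v j + B) → (S.iterations ε v : ℝ) + 2 ≤ A * Real.log (1 / ε) := by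
  have hη := hS.eta_pos
  have hk : 0 < 2 * S.kappa * S.eta := mul_pos (mul_pos two_pos hS.kappa_pos) hη
  set W : ℝ := |B| * (1 + S.eta) + |S.eta * S.K.toReal| + 1 with hW
  set c₀ : ℝ := |Real.logb 2 (W ^ 2 / (2 * S.kappa * S.eta))| with hc₀
  have hc₀0 : 0 ≤ c₀ := abs_nonneg _
  have hl2 : 0 < Real.log 2 := Real.log_pos one_lt_two
  refine ⟨(4 + c₀) / Real.log 2, by positivity, fun ε hε hε2 m v hm hv => ?_⟩
  have hne : Nonempty (Fin m) := ⟨⟨0, hm⟩⟩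
  have hB : B ≤ |B| := le_abs_self B
  have hsup : (⨆ i, v i) - (⨅ i, v i) ≤ |B| := by
    have : (⨆ i, v i) ≤ (⨅ i, v i) + |B| := ciSup_le fun i => by
      have : v i - |B| ≤ ⨅ j, v j := le_ciInf fun j => by linarith [hv i j]
      linarith
    linarith
  have hrange : S.upper v - Penalty.lower v ≤ W := by
    unfold Penalty.upper Penalty.lower
    have h1 : 0 ≤ |S.eta * S.K.toReal| := abs_nonneg _
    have h2 : 0 ≤ |B| * S.eta := by positivity
    split_ifs with hK
    · have := mul_le_mul_of_nonneg_left hsup hη.le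
      linarith
    · have := neg_abs_le (S.eta * S.K.toReal)
      linarith
  have hr0 : 0 ≤ S.upper v - Penalty.lower v := sub_nonneg.2 (hS.lower_le_upper v hm)
  set l := Real.log (1 / ε) / Real.log 2 with hl
  -- Because ε ≤ 1/2, the logarithm is at least 1 and absorbs all additive constants.
  have hl1 : 1 ≤ l := by
    rw [hl, le_div_iff₀ hl2, one_mul]
    exact Real.log_le_log two_pos (by rw [le_div_iff₀ hε]; linarith)
  set x : ℝ := 1 / 2 * Real.logb 2
    ((S.upper v - Penalty.lower v) ^ 2 / (2 * S.kappa * S.eta) * (1 / ε)) with hx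
  have hxle : x ≤ 1 / 2 * (c₀ + l) := by
    rcases hr0.eq_or_lt with h0 | h0
    · rw [hx, ← h0]
      simp only [ne_eq, OfNat.ofNat_ne_zero, not_false_eq_true, zero_pow, zero_div, zero_mul,
        Real.logb_zero, mul_zero]
      linarith
    · rw [hx]
      have hpos : 0 < (S.upper v - Penalty.lower v) ^ 2 / (2 * S.kappa * S.eta) := by positivity
      rw [Real.logb_mul hpos.ne' (by positivity)]
      have h1 : Real.logb 2 ((S.upper v - Penalty.lower v) ^ 2 / (2 * S.kappa * S.eta)) ≤
          Real.logb 2 (W ^ 2 / (2 * S.kappa * S.eta)) :=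
        Real.logb_le_logb_of_le one_lt_two hpos (by gcongr)
      have h2 := le_abs_self (Real.logb 2 (W ^ 2 / (2 * S.kappa * S.eta)))
      have h3 : Real.logb 2 (1 / ε) = l := rfl
      rw [h3]
      linarith
  have hT : (S.iterations ε v : ℝ) ≤ 1 + 1 / 2 * (c₀ + l) := by
    have h0 : 0 ≤ 1 / 2 * (c₀ + l) := by positivity
    unfold Penalty.iterations
    rw [← hx, Nat.cast_max, Nat.cast_one, max_le_iff]
    refine ⟨by linarith, ?_⟩
    have := Nat.ceil_lt_add_one h0
    have h2 : ((⌈x⌉₊ : ℕ) : ℝ) ≤ ((⌈1 / 2 * (c₀ + l)⌉₊ : ℕ) : ℝ) := by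
      exact_mod_cast Nat.ceil_mono hxle
    linarith
  have h4 : (4 + c₀) / Real.log 2 * Real.log (1 / ε) = (4 + c₀) * l := by
    rw [hl]; ring
  rw [h4]
  nlinarith

variable {E : Type*} [NormedAddCommGroup E] [NormedSpace ℝ E] [FiniteDimensional ℝ E]
  [MeasureSpace E] [BorelSpace E] [(volume : Measure E).IsAddHaarMeasure]
  {P : Measure E} [IsProbabilityMeasure P] {ρ B : ℝ} {S : Penalty} {h : E → ℝ} {ε T : ℝ}

theorem ae_jointLaw_sub_le (hρ : 0 < ρ) (hh : Measurable h)
    (hB : ∀ z ∈ P.support, ∃ a : ℝ, ∀ᵐ z' ∂(unifBall ρ z), h z' ∈ Icc a (a + B)) (m : ℕ) :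
    ∀ᵐ ζ ∂(jointLaw P ρ m), ∀ i j, h (ζ.2 i) ≤ h (ζ.2 j) + B := by
  have := isMarkovKernel_sampleKernel (E := E) hρ m
  unfold jointLaw
  have hm : ∀ i : Fin m, Measurable fun ζ : E × (Fin m → E) => h (ζ.2 i) := fun i =>
    hh.comp ((measurable_pi_apply i).comp measurable_snd)
  rw [Measure.ae_compProd_iff]
  · filter_upwards [ae_mem_support P] with z hz
    have := isProbabilityMeasure_unifBall hρ z
    obtain ⟨a, ha⟩ := hB z hz
    rw [sampleKernel_apply]
    have h1 : ∀ᵐ w ∂(Measure.pi fun _ : Fin m => unifBall ρ z), ∀ i, h (w i) ∈ Icc a (a + B) := by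
      rw [ae_all_iff]
      intro i
      exact (measurePreserving_eval (fun _ : Fin m => unifBall ρ z) i).quasiMeasurePreserving.ae ha
    filter_upwards [h1] with w hw i j
    linarith [(hw i).2, (hw j).1]
  · simp only [ofPred_forall]
    exact MeasurableSet.iInter fun i => MeasurableSet.iInter fun j =>
      measurableSet_le (hm i) ((hm j).add_const B)

theorem ae_levelLaw_sub_le (hρ : 0 < ρ) (hh : Measurable h)
    (hB : ∀ z ∈ P.support, ∃ a : ℝ, ∀ᵐ z' ∂(unifBall ρ z), h z' ∈ Icc a (a + B)) (L : ℕ) :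
    ∀ᵐ x ∂(levelLaw P ρ L), ∀ i j, h (x.2.2 i) ≤ h (x.2.2 j) + B := by
  have hset : MeasurableSet {x : (l : Fin (L + 1)) × (E × (Fin (2 ^ (l : ℕ)) → E)) |
      ∀ i j, h (x.2.2 i) ≤ h (x.2.2 j) + B} := by
    refine measurableSet_setOfPred.2 (measurable_sigma fun l => measurableSet_setOfPred.1 ?_)
    have hm : ∀ i : Fin (2 ^ (l : ℕ)), Measurable fun ζ : E × (Fin (2 ^ (l : ℕ)) → E) =>
      h (ζ.2 i) := fun i => hh.comp ((measurable_pi_apply i).comp measurable_snd)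
    simp only [ofPred_forall]
    exact MeasurableSet.iInter fun i => MeasurableSet.iInter fun j =>
      measurableSet_le (hm i) ((hm j).add_const B)
  unfold levelLaw
  rw [ae_finsetSum_measure_iff]
  intro l _
  refine Measure.ae_smul_measure ?_ _
  rw [ae_map_iff (measurable_sigmaMk' l).aemeasurable hset]
  exact ae_jointLaw_sub_le hρ hh hB (2 ^ (l : ℕ))

theorem solveCost_le (hS : S.Valid) {m : ℕ} (hm : 0 < m) {v : Fin m → ℝ}
    (hT : (S.iterations ε v : ℝ) + 2 ≤ T) : (S.solveCost ε v : ℝ) ≤ T * m := by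
  rw [hS.solveCost_eq v hm]
  push_cast
  gcongr

/-- The two half-size solves together cost as much as the full one. -/
theorem levelSolveCost_le (hS : S.Valid) (hT0 : 0 ≤ T)
    (hT : ∀ (m : ℕ) (v : Fin m → ℝ), 0 < m → (∀ i j, v i ≤ v j + B) →
      (S.iterations ε v : ℝ) + 2 ≤ T) {l : ℕ} {w : Fin (2 ^ l) → E}
    (hw : ∀ i j, h (w i) ≤ h (w j) + B) :
    (levelSolveCost S ε h l w : ℝ) ≤ 2 * T * 2 ^ l := by
  cases l with
  | zero =>
    have h1 := solveCost_le hS (by positivity) (hT _ (fun j => h (w j)) (by positivity) hw)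
    simp only [levelSolveCost, pow_zero, Nat.cast_one, mul_one] at h1 ⊢
    linarith
  | succ k =>
    have h1 := solveCost_le hS (by positivity) (hT _ (fun j => h (w j)) (by positivity) hw)
    have h2 := solveCost_le hS (by positivity)
      (hT _ (fun j => h (firstHalf w j)) (by positivity) fun i j => hw _ _)
    have h3 := solveCost_le hS (by positivity)
      (hT _ (fun j => h (secondHalf w j)) (by positivity) fun i j => hw _ _)
    simp only [levelSolveCost]
    push_cast at h1 h2 h3 ⊢
    have h4 : (2 : ℝ) ^ (k + 1) = 2 * 2 ^ k := pow_succ' 2 k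
    nlinarith

theorem sgCost_le (hS : S.Valid) (hρ : 0 < ρ) (hh : Measurable h)
    (hB : ∀ z ∈ P.support, ∃ a : ℝ, ∀ᵐ z' ∂(unifBall ρ z), h z' ∈ Icc a (a + B))
    (hT : ∀ (m : ℕ) (v : Fin m → ℝ), 0 < m → (∀ i j, v i ≤ v j + B) →
      (S.iterations ε v : ℝ) + 2 ≤ T) (L n : ℕ) :
    ∀ᵐ ω ∂(sgLaw P ρ L n), (sgCost S ε h ω : ℝ) ≤ n * ((2 + T) * 2 ^ L) := by
  have := isProbabilityMeasure_jointLaw (P := P) hρ (2 ^ L)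
  have h1 : ∀ᵐ ω ∂(sgLaw P ρ L n), ∀ k, ∀ i j, h ((ω k).2 i) ≤ h ((ω k).2 j) + B := by
    rw [ae_all_iff]
    intro k
    exact (measurePreserving_eval (fun _ : Fin n => jointLaw P ρ (2 ^ L)) k).quasiMeasurePreserving.ae
      (ae_jointLaw_sub_le hρ hh hB (2 ^ L))
  filter_upwards [h1] with ω hω
  unfold sgCost
  push_cast
  have h2 : ∀ k ∈ Finset.univ, (1 + 2 ^ L + (S.solveCost ε fun j => h ((ω k).2 j) : ℝ)) ≤
      (2 + T) * 2 ^ L := by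
    intro k _
    have h3 := solveCost_le hS (by positivity)
      (hT _ (fun j => h ((ω k).2 j)) (by positivity) (hω k))
    have h4 : (1 : ℝ) ≤ 2 ^ L := one_le_pow₀ one_le_two
    push_cast at h3
    linarith
  refine (Finset.sum_le_sum h2).trans (le_of_eq ?_)
  simp

/-- Each product P(l) · 2^l equals 1/(2 - 2^{-L}) ≤ 1, so every level adds at most c. -/
theorem lintegral_levelLaw_pow_le (hρ : 0 < ρ) {c : ℝ} (hc : 0 ≤ c) (L : ℕ) :
    ∫⁻ x, ENNReal.ofReal (c * 2 ^ (x.1 : ℕ)) ∂(levelLaw P ρ L) ≤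
      ENNReal.ofReal ((L + 1) * c) := by
  have hF : Measurable fun x : (l : Fin (L + 1)) × (E × (Fin (2 ^ (l : ℕ)) → E)) =>
      ENNReal.ofReal (c * 2 ^ (x.1 : ℕ)) := measurable_sigma fun l =>
    measurable_const (a := ENNReal.ofReal (c * 2 ^ (l : ℕ)))
  unfold levelLaw
  rw [lintegral_finsetSum_measure]
  have h1 : ∀ l ∈ (Finset.univ : Finset (Fin (L + 1))),
      ∫⁻ x, ENNReal.ofReal (c * 2 ^ (x.1 : ℕ)) ∂(ENNReal.ofReal (levelProb L l) •
        (sampleLaw P ρ l).map (fun ζ => (⟨l, ζ⟩ : (l : Fin (L + 1)) ×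
          (E × (Fin (2 ^ (l : ℕ)) → E))))) ≤ ENNReal.ofReal c := by
    intro l _
    have : IsProbabilityMeasure (sampleLaw P ρ l) := isProbabilityMeasure_jointLaw hρ _
    rw [lintegral_smul_measure, lintegral_map hF (measurable_sigmaMk' l)]
    change ENNReal.ofReal (levelProb L l) •
      ∫⁻ _ζ, ENNReal.ofReal (c * 2 ^ (l : ℕ)) ∂(sampleLaw P ρ l) ≤ _
    rw [lintegral_const, measure_univ, mul_one, smul_eq_mul, ← ENNReal.ofReal_mul (levelProb_pos L l).le]
    refine ENNReal.ofReal_le_ofReal ?_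
    have h2 : levelProb L l * 2 ^ (l : ℕ) ≤ 1 := by
      unfold levelProb
      have h3 : (2 : ℝ)⁻¹ ^ L ≤ 1 := pow_le_one₀ (by norm_num) (by norm_num)
      rw [div_mul_eq_mul_div, ← mul_pow, inv_mul_cancel₀ two_ne_zero, one_pow,
        div_le_one (by linarith)]
      linarith
    calc levelProb L l * (c * 2 ^ (l : ℕ)) = c * (levelProb L l * 2 ^ (l : ℕ)) := by ring
      _ ≤ c * 1 := by gcongr
      _ = c := mul_one c
  refine (Finset.sum_le_sum h1).trans (le_of_eq ?_)
  rw [Finset.sum_const, Finset.card_univ, Fintype.card_fin, nsmul_eq_mul,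
    ENNReal.ofReal_mul (by positivity)]
  congr 1
  rw [← Nat.cast_add_one, ENNReal.ofReal_natCast]

theorem lintegral_mlmcCost_le (hS : S.Valid) (hρ : 0 < ρ) (hh : Measurable h)
    (hB : ∀ z ∈ P.support, ∃ a : ℝ, ∀ᵐ z' ∂(unifBall ρ z), h z' ∈ Icc a (a + B)) (hT0 : 0 ≤ T)
    (hT : ∀ (m : ℕ) (v : Fin m → ℝ), 0 < m → (∀ i j, v i ≤ v j + B) →
      (S.iterations ε v : ℝ) + 2 ≤ T) (L n : ℕ) :
    ∫⁻ ω, (mlmcCost S ε h ω : ℝ≥0∞) ∂(mlmcLaw P ρ L n) ≤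
      ENNReal.ofReal (n * ((L + 1) * (2 + 2 * T))) := by
  have := isProbabilityMeasure_levelLaw (P := P) hρ L
  have hF : Measurable fun x : (l : Fin (L + 1)) × (E × (Fin (2 ^ (l : ℕ)) → E)) =>
      ENNReal.ofReal ((2 + 2 * T) * 2 ^ (x.1 : ℕ)) := measurable_sigma fun l =>
    measurable_const (a := ENNReal.ofReal ((2 + 2 * T) * 2 ^ (l : ℕ)))
  have h1 : ∀ᵐ ω ∂(mlmcLaw P ρ L n), ∀ k, ∀ i j, h ((ω k).2.2 i) ≤ h ((ω k).2.2 j) + B := by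
    rw [ae_all_iff]
    intro k
    exact (measurePreserving_eval (fun _ : Fin n => levelLaw P ρ L) k).quasiMeasurePreserving.ae
      (ae_levelLaw_sub_le hρ hh hB L)
  have h2 : ∀ᵐ ω ∂(mlmcLaw P ρ L n), (mlmcCost S ε h ω : ℝ≥0∞) ≤
      ∑ k, ENNReal.ofReal ((2 + 2 * T) * 2 ^ ((ω k).1 : ℕ)) := by
    filter_upwards [h1] with ω hω
    unfold mlmcCost
    rw [Nat.cast_sum]
    refine Finset.sum_le_sum fun k _ => ?_
    rw [← ENNReal.ofReal_natCast]
    refine ENNReal.ofReal_le_ofReal ?_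
    have h3 := levelSolveCost_le hS hT0 hT (hω k)
    have h4 : (1 : ℝ) ≤ 2 ^ ((ω k).1 : ℕ) := one_le_pow₀ one_le_two
    push_cast
    linarith
  refine (lintegral_mono_ae h2).trans ?_
  have hFk : ∀ k ∈ (Finset.univ : Finset (Fin n)), Measurable
      fun ω : Fin n → (l : Fin (L + 1)) × (E × (Fin (2 ^ (l : ℕ)) → E)) =>
        ENNReal.ofReal ((2 + 2 * T) * 2 ^ ((ω k).1 : ℕ)) := fun k _ =>
    hF.comp (measurable_pi_apply k)
  rw [lintegral_finsetSum _ hFk]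
  have h3 : ∀ k ∈ (Finset.univ : Finset (Fin n)), ∫⁻ ω, ENNReal.ofReal ((2 + 2 * T) *
      2 ^ ((ω k).1 : ℕ)) ∂(mlmcLaw P ρ L n) ≤ ENNReal.ofReal ((L + 1) * (2 + 2 * T)) := by
    intro k _
    refine le_trans (le_of_eq ?_) (lintegral_levelLaw_pow_le (P := P) hρ
      (by linarith : 0 ≤ 2 + 2 * T) L)
    exact (measurePreserving_eval (fun _ : Fin n => levelLaw P ρ L) k).lintegral_comp hF
  refine (Finset.sum_le_sum h3).trans (le_of_eq ?_)
  rw [Finset.sum_const, Finset.card_univ, Fintype.card_fin, nsmul_eq_mul,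
    ENNReal.ofReal_mul (Nat.cast_nonneg n), ENNReal.ofReal_natCast]

/-- Uniform cost bounds for both estimators. -/
theorem exists_cost_bound (hS : S.Valid) (B : ℝ) : ∃ A : ℝ, 0 < A ∧
    ∀ ε : ℝ, 0 < ε → ε ≤ 1 / 2 → ∃ T : ℝ, 0 ≤ T ∧
      (∀ (m : ℕ) (v : Fin m → ℝ), 0 < m → (∀ i j, v i ≤ v j + B) →
        (S.iterations ε v : ℝ) + 2 ≤ T) ∧ 2 * (2 + 2 * T) ≤ A * Real.log (1 / ε) := by
  obtain ⟨A, hA, h⟩ := exists_iterations_bound hS B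
  have hl2 : 0 < Real.log 2 := Real.log_pos one_lt_two
  -- The fixed cost 4 is paid by the first summand, since log(1/ε) ≥ log 2; the second summand pays
  -- 4T.
  refine ⟨4 / Real.log 2 + 4 * A, by positivity, fun ε hε hε2 =>
    ⟨A * Real.log (1 / ε), ?_, h ε hε hε2, ?_⟩⟩
  · refine mul_nonneg hA.le (Real.log_nonneg ?_)
    rw [le_div_iff₀ hε]
    linarith
  · have hl : Real.log 2 ≤ Real.log (1 / ε) :=
      Real.log_le_log two_pos (by rw [le_div_iff₀ hε]; linarith)
    have : 4 ≤ 4 / Real.log 2 * Real.log (1 / ε) := by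
      rw [div_mul_eq_mul_div, le_div_iff₀ hl2]
      linarith
    linarith

end Cost

end

end PhiDRO

set_option linter.unusedSectionVars false

namespace PhiDRO

noncomputable section

/-! ### Moments of the averaged estimators -/

section AveragedEstimators

variable {E : Type*} [NormedAddCommGroup E] [NormedSpace ℝ E] [FiniteDimensional ℝ E]
  [MeasureSpace E] [BorelSpace E] [(volume : Measure E).IsAddHaarMeasure] {ρ : ℝ}
  {P : Measure E} [IsProbabilityMeasure P]
  {p : ℕ} {S : Penalty} {ε : ℝ} {h : E → ℝ} {g : E → EuclideanSpace ℝ (Fin p)} {M C : ℝ}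

theorem sgEst_eq_average (L n : ℕ) : (sgEst S ε h g : (Fin n → E × (Fin (2 ^ L) → E)) → _) =
    average n (fun ζ : E × (Fin (2 ^ L) → E) => gradEst S ε h g ζ.2) := rfl

theorem mlmcEst_eq_average (L n : ℕ) :
    (mlmcEst S ε h g : (Fin n → (l : Fin (L + 1)) × (E × (Fin (2 ^ (l : ℕ)) → E))) → _) =
    average n (levelEst S ε h g L) := rfl

theorem sgLaw_eq_pi (P : Measure E) (ρ : ℝ) (L n : ℕ) :
    sgLaw P ρ L n = Measure.pi fun _ => jointLaw P ρ (2 ^ L) := rfl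

theorem sgEst_moments (hg : ∀ x ∈ attackSet P ρ, ‖g x‖ ≤ |M|) (hS : S.Valid) (hε : 0 < ε)
    (hρ : 0 < ρ) (hh : Measurable h) (hgm : Measurable g) (L : ℕ) {n : ℕ} (hn : 1 ≤ n) :
    MemLp (sgEst S ε h g) 2 (sgLaw P ρ L n) ∧
      ∫ ω, sgEst S ε h g ω ∂(sgLaw P ρ L n) =
        ∫ ζ, gradEst S ε h g ζ.2 ∂(jointLaw P ρ (2 ^ L)) ∧
      ∫ ω, ‖sgEst S ε h g ω‖ ^ 2 ∂(sgLaw P ρ L n) ≤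
        2 * M ^ 2 * (1 + 2 * ε / (S.kappa * S.eta)) ∧
      vecVar (sgEst S ε h g) (sgLaw P ρ L n) ≤
        2 * M ^ 2 * (1 + 2 * ε / (S.kappa * S.eta)) / n := by
  have hm : 0 < 2 ^ L := by positivity
  have hM : 0 ≤ |M| := abs_nonneg M
  have i1 := isProbabilityMeasure_jointLaw (P := P) hρ (2 ^ L)
  have hY := memLp_gradEst hg hS hε hρ hM hh hgm hm
  have hY2 : ∫ ζ, ‖gradEst S ε h g ζ.2‖ ^ 2 ∂(jointLaw P ρ (2 ^ L)) ≤
      2 * M ^ 2 * (1 + 2 * ε / (S.kappa * S.eta)) := by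
    refine (integral_norm_sq_gradEst_le hg hS hε hρ hM hm).trans ?_
    rw [mul_pow, sq_abs, ← hS.sq_weightErr hε]
    have := mul_nonneg (sq_nonneg M) (sq_nonneg (1 - S.weightErr ε))
    linarith
  rw [sgLaw_eq_pi, sgEst_eq_average]
  refine ⟨memLp_average n hY, integral_average hn (hY.integrable one_le_two),
    (integral_norm_sq_average_le hn hY).trans hY2, (vecVar_average_le hn hY).trans ?_⟩
  rw [one_div_mul_eq_div]
  gcongr

theorem mlmcEst_moments (hg : ∀ x ∈ attackSet P ρ, ‖g x‖ ≤ |M|) (hS : S.Valid) (hε : 0 < ε)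
    (hρ : 0 < ρ) (hh : Measurable h) (hgm : Measurable g) (hC1 : 1 ≤ C)
    (hC : ∀ z ∈ P.support, ∀ (m : ℕ) (w : Fin m → E), (∀ i, w i ∈ Metric.closedBall z ρ) →
      ∀ γ : Fin m → ℝ, IsOptimalWeight S.phi S.eta (fun i => h (w i)) γ → chiSq γ ≤ C)
    (L : ℕ) {n : ℕ} (hn : 1 ≤ n) :
    MemLp (mlmcEst S ε h g) 2 (mlmcLaw P ρ L n) ∧
      ∫ ω, mlmcEst S ε h g ω ∂(mlmcLaw P ρ L n) =
        ∫ ζ, gradEst S ε h g ζ.2 ∂(jointLaw P ρ (2 ^ L)) ∧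
      ∫ ω, ‖mlmcEst S ε h g ω‖ ^ 2 ∂(mlmcLaw P ρ L n) ≤
        96 * M ^ 2 / (S.kappa * S.eta) * (2 ^ L * ε) + 6 * (L + 1) * M ^ 2 * C ∧
      vecVar (mlmcEst S ε h g) (mlmcLaw P ρ L n) ≤
        1 / n * (96 * M ^ 2 / (S.kappa * S.eta) * (2 ^ L * ε) + 6 * (L + 1) * M ^ 2 * C) := by
  have hM : 0 ≤ |M| := abs_nonneg M
  have i1 := isProbabilityMeasure_levelLaw (P := P) hρ L
  have hY := memLp_levelEst hg hS hε hρ hM hh hgm L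
  have hY2 : ∫ x, ‖levelEst S ε h g L x‖ ^ 2 ∂(levelLaw P ρ L) ≤
      96 * M ^ 2 / (S.kappa * S.eta) * (2 ^ L * ε) + 6 * (L + 1) * M ^ 2 * C := by
    rw [← sq_abs M]
    exact integral_norm_sq_levelEst_le hg hS hε hρ hM hh hgm hC1
      (fun z hz m w hm0 hw => hC z hz m w hw _ (hS.isOptimalWeight_optWeight _ hm0)) L
  have hmean := integral_levelEst hg hS hε hρ hM hh hgm L
  rw [mlmcEst_eq_average]
  unfold mlmcLaw
  refine ⟨memLp_average n hY, (integral_average hn (hY.integrable one_le_two)).trans hmean,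
    (integral_norm_sq_average_le hn hY).trans hY2, (vecVar_average_le hn hY).trans ?_⟩
  gcongr

end AveragedEstimators

end

end PhiDRO

/-! ### Assembly of the proposition. -/

theorem mainTheorem7 (S : Penalty) (hS : S.Valid) (B : ℝ) :
    ∃ A : ℝ, 0 < A ∧
    ∀ {E : Type*} [NormedAddCommGroup E] [NormedSpace ℝ E] [FiniteDimensional ℝ E]
      [MeasureSpace E] [BorelSpace E] [(volume : Measure E).IsAddHaarMeasure] (p : ℕ)
      (ρ : ℝ) (_ : 0 < ρ) (P : Measure E) [IsProbabilityMeasure P]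
      (Θ U : Set (EuclideanSpace ℝ (Fin p))) (_ : IsOpen U) (_ : Θ ⊆ U)
      -- the loss, measurable in `z` and Lipschitz in `θ`
      (f : EuclideanSpace ℝ (Fin p) → E → ℝ) (_ : ∀ θ ∈ U, Measurable (f θ))
      (Lf : ℝ) (_ : ∀ z' ∈ attackSet P ρ, ∀ θ₁ ∈ U, ∀ θ₂ ∈ U,
        |f θ₁ z' - f θ₂ z'| ≤ Lf * ‖θ₁ - θ₂‖)
      -- its (sub)gradient in `θ`
      (g : EuclideanSpace ℝ (Fin p) → E → EuclideanSpace ℝ (Fin p))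
      (_ : ∀ θ ∈ Θ, Measurable (g θ))
      (_ : ∀ θ ∈ Θ, ∀ z' ∈ attackSet P ρ, IsSubgradAt (fun t => f t z') (g θ z') θ)
      -- the bound on the chi-square divergence of the optimal probability vectors
      (C : ℝ) (_ : 1 ≤ C)
      (_ : ∀ θ ∈ Θ, ∀ z ∈ P.support, ∀ (m : ℕ) (w : Fin m → E),
        (∀ i, w i ∈ Metric.closedBall z ρ) → ∀ γ : Fin m → ℝ,
        IsOptimalWeight S.phi S.eta (fun i => f θ (w i)) γ → chiSq γ ≤ C)
      (ε : ℝ) (_ : 0 < ε) (L n : ℕ) (_ : 1 ≤ n) (θ : EuclideanSpace ℝ (Fin p)) (_ : θ ∈ Θ),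
      -- bias
      (MemLp (sgEst S ε (f θ) (g θ)) 2 (sgLaw P ρ L n) ∧
        MemLp (mlmcEst S ε (f θ) (g θ)) 2 (mlmcLaw P ρ L n) ∧
        ∫ ω, sgEst S ε (f θ) (g θ) ω ∂(sgLaw P ρ L n) =
          ∫ ω, mlmcEst S ε (f θ) (g θ) ω ∂(mlmcLaw P ρ L n) ∧
        ∀ G : ℝ,
          (∀ θ' ∈ Θ, ∀ z ∈ P.support, LipschitzQuantile ((unifBall ρ z).map (f θ')) G) →
          Integrable (fun ζ : E × (Fin (2 ^ 0) → E) => f θ (ζ.2 0)) (sampleLaw P ρ 0) →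
          IsSubgradAt (surrogate S ε P ρ L f θ)
            (∫ ω, sgEst S ε (f θ) (g θ) ω ∂(sgLaw P ρ L n)) θ ∧
          ((∀ z' ∈ attackSet P ρ, HasGradientAt (fun t => f t z') (g θ z') θ) →
            HasGradientAt (surrogate S ε P ρ L f θ)
              (∫ ω, sgEst S ε (f θ) (g θ) ω ∂(sgLaw P ρ L n)) θ) ∧
          Integrable (fun z => robustValue S.phi S.eta (unifBall ρ z) (f θ)) P ∧
          |surrogate S ε P ρ L f θ θ - objective S P ρ (f θ)| ≤ ε + G * (2 : ℝ)⁻¹ ^ L) ∧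
      -- second-order moments
      (∫ ω, ‖sgEst S ε (f θ) (g θ) ω‖ ^ 2 ∂(sgLaw P ρ L n) ≤
          2 * Lf ^ 2 * (1 + 2 * ε / (S.kappa * S.eta)) ∧
        ∫ ω, ‖mlmcEst S ε (f θ) (g θ) ω‖ ^ 2 ∂(mlmcLaw P ρ L n) ≤
          96 * Lf ^ 2 / (S.kappa * S.eta) * (2 ^ L * ε) + 6 * (L + 1) * Lf ^ 2 * C) ∧
      -- variances
      (vecVar (sgEst S ε (f θ) (g θ)) (sgLaw P ρ L n) ≤
          2 * Lf ^ 2 * (1 + 2 * ε / (S.kappa * S.eta)) / n ∧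
        vecVar (mlmcEst S ε (f θ) (g θ)) (mlmcLaw P ρ L n) ≤
          1 / n * (96 * Lf ^ 2 / (S.kappa * S.eta) * (2 ^ L * ε) +
            6 * (L + 1) * Lf ^ 2 * C)) ∧
      -- costs
      (ε ≤ 1 / 2 →
        (∀ z ∈ P.support, ∃ a : ℝ, ∀ᵐ z' ∂(unifBall ρ z), f θ z' ∈ Icc a (a + B)) →
        (∀ᵐ ω ∂(sgLaw P ρ L n),
          (sgCost S ε (f θ) ω : ℝ) ≤ A * (n * 2 ^ L * Real.log (1 / ε))) ∧
        (1 ≤ L → ∫⁻ ω, (mlmcCost S ε (f θ) ω : ℝ≥0∞) ∂(mlmcLaw P ρ L n) ≤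
          ENNReal.ofReal (A * (n * L * Real.log (1 / ε))))) := by
  obtain ⟨A, hA, hcost⟩ := exists_cost_bound hS B
  refine ⟨A, hA, ?_⟩
  intro E _ _ _ _ _ _ p ρ hρ P _ Θ U hU hΘU f hf Lf hlip g hgm hsub C hC1 hC ε hε L n hn θ hθ
  have hθU := hΘU hθ
  have hh := hf θ hθU
  -- A regular subgradient at a point of the open set U is bounded by the Lipschitz constant, so
  -- every sampled gradient is bounded almost surely.
  have hg : ∀ x ∈ attackSet P ρ, ‖g θ x‖ ≤ |Lf| := fun x hx =>
    (hsub θ hθ x hx).norm_le (Filter.mem_of_superset (hU.mem_nhds hθU) fun y hy =>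
      (le_abs_self _).trans (hlip x hx y hy θ hθU))
  obtain ⟨a1, a2, a3, a4⟩ := sgEst_moments hg hS hε hρ hh (hgm θ hθ) L hn
  obtain ⟨b1, b2, b3, b4⟩ := mlmcEst_moments hg hS hε hρ hh (hgm θ hθ) hC1 (hC θ hθ) L hn
  refine ⟨⟨a1, b1, a2.trans b2.symm, ?_⟩, ⟨a3, b3⟩, ⟨a4, b4⟩, ?_⟩
  · intro G hG hint
    rw [a2]
    have hM : 0 ≤ |Lf| := abs_nonneg _
    exact ⟨isSubgradAt_surrogate hS hε hρ hU hθU hf hlip (hgm θ hθ) hg hM hint L (hsub θ hθ),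
      hasGradientAt_surrogate hS hε hρ hU hθU hf hlip (hgm θ hθ) hg hM hint L,
      (integrable_robustValue_and_bias hS hρ hh (hG θ hθ) hint).1,
      abs_surrogate_sub_objective_le hS hε hρ hh (hG θ hθ) hint L⟩
  · intro hε2 hB
    obtain ⟨T, hT0, hT, hTA⟩ := hcost ε hε hε2
    constructor
    · filter_upwards [sgCost_le hS hρ hh hB hT L n] with ω hω
      refine hω.trans ?_
      have h1 : 2 + T ≤ A * Real.log (1 / ε) := by linarith
      calc (n : ℝ) * ((2 + T) * 2 ^ L) ≤ n * (A * Real.log (1 / ε) * 2 ^ L) := by gcongr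
        _ = A * (n * 2 ^ L * Real.log (1 / ε)) := by ring
    · intro hL
      refine (lintegral_mlmcCost_le hS hρ hh hB hT0 hT L n).trans (ENNReal.ofReal_le_ofReal ?_)
      have hL1 : (1 : ℝ) ≤ L := by exact_mod_cast hL
      have h1 : ((L : ℝ) + 1) * (2 + 2 * T) ≤ L * (A * Real.log (1 / ε)) := by
        -- This is where L ≥ 1 enters: the L + 1 levels are at most 2L.
        calc ((L : ℝ) + 1) * (2 + 2 * T) ≤ (L + L) * (2 + 2 * T) := by gcongr
          _ = L * (2 * (2 + 2 * T)) := by ring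
          _ ≤ L * (A * Real.log (1 / ε)) := by gcongr
      calc (n : ℝ) * ((L + 1) * (2 + 2 * T)) ≤ n * (L * (A * Real.log (1 / ε))) := by gcongr
        _ = A * (n * L * Real.log (1 / ε)) := by ring
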